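/- Let $(V,Y,\mathbf 1,\omega)$ be a vertex operator algebra over $\mathbb C$ (with $\mathbb Z$-grading $V=\bigoplus_n V_n$ by the eigenvalues of $L(0)$, $\dim V_n<\infty$, $V_n=0$ for $n\ll 0$), and let $g$ be an automorphism of $V$ of finite order $T$. For $0\le r\le T-1$ put $V^r=\{v\in V: gv=e^{2\pi i r/T}v\}$, and put $\delta_r=1$ if $r=0$ and $\delta_r=0$ otherwise. For homogeneous $u\in V^r$ and $v\in V$ let $$u\circ_g v=\operatorname{Res}_z\frac{(1+z)^{\operatorname{wt}u-1+\delta_r+r/T}}{z^{1+\delta_r}}\,Y(u,z)v ,$$ let $O_g(V)$ be the linear span of all such $u\circ_g v$, and let $A_g(V)=V/O_g(V)$. A weak $g$-twisted $V$-module is a complex vector space $M$ with a linear map $v\mapsto Y_M(v,z)=\sum_{n\in\mathbb Q}v_nz^{-n-1}$, $v_n\in\operatorname{End}M$, such that for $u\in V^r$, $v\in V$, $w\in M$: $u_n=0$ unless $n\in\frac rT+\mathbb Z$; $v_lw=0$ for $l\gg0$; $Y_M(\mathbf 1,z)=1$; and the twisted Jacobi identity holds: $$z_0^{-1}\delta\Big(\tfrac{z_1-z_2}{z_0}\Big)Y_M(u,z_1)Y_M(v,z_2)-z_0^{-1}\delta\Big(\tfrac{z_2-z_1}{-z_0}\Big)Y_M(v,z_2)Y_M(u,z_1)=z_2^{-1}\Big(\tfrac{z_1-z_0}{z_2}\Big)^{-r/T}\delta\Big(\tfrac{z_1-z_0}{z_2}\Big)Y_M(Y(u,z_0)v,z_2).$$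 An (ordinary) $g$-twisted $V$-module is a weak $g$-twisted $V$-module $M$ that is the direct sum of the eigenspaces $M_\lambda$ ($\lambda\in\mathbb C$) of $L(0)=\omega_1$, with every $M_\lambda$ finite-dimensional and, for each fixed $\lambda$, $M_{\lambda+n/T}=0$ for all sufficiently small integers $n$. It is simple if it is nonzero and has no submodules other than $0$ and itself. **Theorem.** If $A_g(V)$ is finite-dimensional and nonzero, then there is at least one simple (ordinary) $g$-twisted $V$-module. -/

import Mathlib

universe u

open scoped BigOperators

noncomputable section

/-- A vertex operator algebra over `ℂ`, in the sense of Borcherds and Frenkel-Lepowsky-Meurman.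
The vertex operators are `Y(u,z) = ∑ₙ uₙ z^{-n-1}`, where
`uₙ = VertexOperator.ncoeff (Y u) n` for `n : ℤ`.  That `Y(u,z)v` has only finitely many negative
powers of `z` is part of `VertexOperator`.  The modes of `ω` are `L(n) = ω_{n+1}`.
The `ℤ`-grading is the one by the eigenspaces of `L(0)`: the weight-`n` space is
`{v | L(0) v = n v}`. -/
class VertexOperatorAlgebra (V : Type u) [AddCommGroup V] [Module ℂ V] where
  /-- The vertex operator map `u ↦ Y(u,z)`. -/
  Y : V →ₗ[ℂ] VertexOperator ℂ V
  /-- The vacuum vector `𝟏`. -/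
  vacuum : V
  /-- The Virasoro vector `ω`. -/
  omega : V
  /-- The central charge (rank). -/
  rank : ℂ
  /-- `Y(𝟏,z) = 1`. -/
  vacuum_mode (n : ℤ) : VertexOperator.ncoeff (Y vacuum) n = if n = -1 then 1 else 0
  /-- `Y(u,z)𝟏` has no negative powers of `z`. -/
  creation_of_nonneg (u : V) (n : ℤ) (hn : 0 ≤ n) : VertexOperator.ncoeff (Y u) n vacuum = 0
  /-- The constant term of `Y(u,z)𝟏` is `u`. -/
  creation (u : V) : VertexOperator.ncoeff (Y u) (-1) vacuum = u
  /-- The Jacobi identity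
  `z₀⁻¹δ((z₁-z₂)/z₀) Y(u,z₁)Y(v,z₂)w - z₀⁻¹δ((z₂-z₁)/(-z₀)) Y(v,z₂)Y(u,z₁)w
    = z₂⁻¹δ((z₁-z₀)/z₂) Y(Y(u,z₀)v,z₂)w`:
  equality of the coefficients of `z₀^{-l-1} z₁^{-m-1} z₂^{-n-1}`.  All three sums have only
  finitely many nonzero terms. -/
  jacobi (u v w : V) (l m n : ℤ) :
    (∑ᶠ i : ℕ, ((-1 : ℂ) ^ i * ((Ring.choose l i : ℤ) : ℂ)) •
        VertexOperator.ncoeff (Y u) (m + l - i) (VertexOperator.ncoeff (Y v) (n + i) w))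
      - (∑ᶠ i : ℕ, ((-1 : ℂ) ^ (l + i) * ((Ring.choose l i : ℤ) : ℂ)) •
        VertexOperator.ncoeff (Y v) (n + l - i) (VertexOperator.ncoeff (Y u) (m + i) w))
      = ∑ᶠ i : ℕ, ((Ring.choose m i : ℤ) : ℂ) •
        VertexOperator.ncoeff (Y (VertexOperator.ncoeff (Y u) (l + i) v)) (m + n - i) w
  /-- The Virasoro relations
  `[L(m),L(n)] = (m-n) L(m+n) + (m³-m)/12 δ_{m+n,0} rank`, where `L(n) = ω_{n+1}`. -/
  virasoro (m n : ℤ) (v : V) :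
    VertexOperator.ncoeff (Y omega) (m + 1) (VertexOperator.ncoeff (Y omega) (n + 1) v)
      - VertexOperator.ncoeff (Y omega) (n + 1) (VertexOperator.ncoeff (Y omega) (m + 1) v)
      = ((m : ℂ) - n) • VertexOperator.ncoeff (Y omega) (m + n + 1) v
        + (if m + n = 0 then ((m : ℂ) ^ 3 - m) / 12 * rank else 0) • v
  /-- `Y(L(-1)u,z) = d/dz Y(u,z)`. -/
  derivative (u : V) (n : ℤ) :
    VertexOperator.ncoeff (Y (VertexOperator.ncoeff (Y omega) 0 u)) n
      = (-(n : ℂ)) • VertexOperator.ncoeff (Y u) (n - 1)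
  /-- `V` is the direct sum of its weight spaces, all weights being integers. -/
  grading : DirectSum.IsInternal
    (fun n : ℤ => Module.End.eigenspace (VertexOperator.ncoeff (Y omega) 1) (n : ℂ))
  /-- The weight spaces are finite-dimensional. -/
  finite_weight (n : ℤ) :
    FiniteDimensional ℂ (Module.End.eigenspace (VertexOperator.ncoeff (Y omega) 1) (n : ℂ))
  /-- The weights are bounded below. -/
  weight_bounded_below : ∃ N : ℤ, ∀ n < N,
    Module.End.eigenspace (VertexOperator.ncoeff (Y omega) 1) (n : ℂ) = ⊥

namespace VertexOperatorAlgebra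

variable {V : Type u} [AddCommGroup V] [Module ℂ V] [VertexOperatorAlgebra V]

/-- The mode `uₙ` in `Y(u,z) = ∑ₙ uₙ z^{-n-1}`. -/
def mode (u : V) (n : ℤ) : Module.End ℂ V := VertexOperator.ncoeff (Y u) n

/-- The homogeneous subspace of vectors of weight `d`, i.e. `{v | L(0) v = d v}`. -/
def weightSpace (V : Type u) [AddCommGroup V] [Module ℂ V] [VertexOperatorAlgebra V] (d : ℤ) :
    Submodule ℂ V :=
  Module.End.eigenspace (mode (omega : V) 1) (d : ℂ)

/-- A linear automorphism `g` of `V` is an automorphism of the vertex operator algebra if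
`g Y(u,z) g⁻¹ = Y(g u,z)` for all `u`, and `g` fixes `𝟏` and `ω`. -/
structure IsAutomorphism (g : V ≃ₗ[ℂ] V) : Prop where
  map_mode (u v : V) (n : ℤ) : g (mode u n v) = mode (g u) n (g v)
  map_vacuum : g vacuum = vacuum
  map_omega : g omega = omega

/-- The eigenspace `V^r = {v | g v = e^{2πir/T} v}`, where `T` is the order of `g`. -/
def twistedSector (g : V ≃ₗ[ℂ] V) (r : ℕ) : Submodule ℂ V :=
  Module.End.eigenspace (g : Module.End ℂ V)
    (Complex.exp (2 * Real.pi * Complex.I * r / orderOf g))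

/-- For `u` of weight `d` in `V^r` (`0 ≤ r < T`) the product
`u ∘_g v = Res_z (1+z)^{d-1+δ_r+r/T} z^{-1-δ_r} Y(u,z)v`, that is
`∑_{i ≥ 0} (d-1+δ_r+r/T choose i) u_{i-1-δ_r} v` (finitely many nonzero terms), where
`δ_r = 1` if `r = 0` and `δ_r = 0` otherwise. -/
def circ (g : V ≃ₗ[ℂ] V) (d : ℤ) (r : ℕ) (u v : V) : V :=
  ∑ᶠ i : ℕ, Ring.choose ((d : ℂ) - 1 + (if r = 0 then 1 else 0) + (r : ℂ) / orderOf g) i •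
    mode u ((i : ℤ) - 1 - (if r = 0 then 1 else 0)) v

/-- The subspace `O_g(V)`, spanned by all `u ∘_g v` with `u ∈ V^r` homogeneous, `0 ≤ r < T`. -/
def twistedO (g : V ≃ₗ[ℂ] V) : Submodule ℂ V :=
  Submodule.span ℂ {x | ∃ (r : ℕ) (d : ℤ) (u v : V), r < orderOf g ∧
    u ∈ twistedSector g r ∧ u ∈ weightSpace V d ∧ x = circ g d r u v}

/-- The vector space `A_g(V) = V / O_g(V)` underlying the twisted Zhu algebra. -/
abbrev TwistedZhu (g : V ≃ₗ[ℂ] V) : Type u := V ⧸ twistedO g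

/-- A weak `g`-twisted `V`-module structure on `M`: a linear map
`v ↦ Y_M(v,z) = ∑_{n ∈ ℚ} vₙ z^{-n-1}` with values in formal series of endomorphisms of `M`,
where `vₙ = mode v n`; `T` denotes the order of `g`. -/
structure WeakTwistedModule (g : V ≃ₗ[ℂ] V) (M : Type u) [AddCommGroup M] [Module ℂ M] where
  /-- The linear map sending `v` to the family of its modes `vₙ`, `n ∈ ℚ`. -/
  mode : V →ₗ[ℂ] (ℚ → Module.End ℂ M)
  /-- For `u ∈ V^r`, only the modes `uₙ` with `n ∈ r/T + ℤ` occur. -/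
  mode_eq_zero (r : ℕ) (hr : r < orderOf g) (u : V) (hu : u ∈ twistedSector g r) (n : ℚ)
    (hn : ∀ k : ℤ, n ≠ (r : ℚ) / orderOf g + k) : mode u n = 0
  /-- `v_l w = 0` for `l` sufficiently large. -/
  truncation (v : V) (w : M) : ∃ N : ℚ, ∀ l : ℚ, N ≤ l → mode v l w = 0
  /-- `Y_M(𝟏,z) = 1`. -/
  vacuum_mode (n : ℚ) : mode vacuum n = if n = -1 then 1 else 0
  /-- The twisted Jacobi identity, for `u ∈ V^r`,
  `z₀⁻¹δ((z₁-z₂)/z₀) Y_M(u,z₁)Y_M(v,z₂)w - z₀⁻¹δ((z₂-z₁)/(-z₀)) Y_M(v,z₂)Y_M(u,z₁)w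
    = z₂⁻¹((z₁-z₀)/z₂)^{-r/T} δ((z₁-z₀)/z₂) Y_M(Y(u,z₀)v,z₂)w`:
  equality of the coefficients of `z₀^{-l-1} z₁^{-m-1} z₂^{-n-1}`, where `m = r/T + k`.
  (No power of `z₁` with `m ∉ r/T + ℤ` occurs on either side.)
  All three sums have only finitely many nonzero terms. -/
  jacobi (r : ℕ) (hr : r < orderOf g) (u : V) (hu : u ∈ twistedSector g r) (v : V) (w : M)
    (l k : ℤ) (m n : ℚ) (hm : m = (r : ℚ) / orderOf g + k) :
    (∑ᶠ i : ℕ, ((-1 : ℂ) ^ i * ((Ring.choose l i : ℤ) : ℂ)) •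
        mode u (m + l - i) (mode v (n + i) w))
      - (∑ᶠ i : ℕ, ((-1 : ℂ) ^ (l + i) * ((Ring.choose l i : ℤ) : ℂ)) •
        mode v (n + l - i) (mode u (m + i) w))
      = ∑ᶠ i : ℕ, Ring.choose (m : ℂ) i •
        mode (VertexOperatorAlgebra.mode u (l + i) v) (m + n - i) w

namespace WeakTwistedModule

variable {g : V ≃ₗ[ℂ] V} {M : Type u} [AddCommGroup M] [Module ℂ M]

/-- The subspace `M_c = {w | L(0) w = c w}`, where `L(0) = ω₁`. -/
def weightSpace (X : WeakTwistedModule g M) (c : ℂ) : Submodule ℂ M :=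
  Module.End.eigenspace (X.mode omega 1) c

/-- A weak `g`-twisted module is an (ordinary) `g`-twisted module if it is the direct sum of the
eigenspaces `M_c` of `L(0)`, each `M_c` is finite-dimensional, and for each fixed `c` one has
`M_{n/T+c} = 0` for all sufficiently small integers `n`. -/
structure IsOrdinary (X : WeakTwistedModule g M) : Prop where
  grading : DirectSum.IsInternal (fun c : ℂ => X.weightSpace c)
  finite_weight (c : ℂ) : FiniteDimensional ℂ (X.weightSpace c)
  bounded_below (c : ℂ) : ∃ N : ℤ, ∀ n : ℤ, n < N →
    X.weightSpace ((n : ℂ) / orderOf g + c) = ⊥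

/-- A module is simple if it is nonzero and its only subspaces stable under all modes `vₙ` are
`0` and the whole space.  (In an ordinary module a stable subspace is stable under `L(0)`, hence
graded and itself an ordinary module.) -/
structure IsSimple (X : WeakTwistedModule g M) : Prop where
  nontrivial : Nontrivial M
  eq_bot_or_eq_top (W : Submodule ℂ M) (hW : ∀ (v : V) (n : ℚ), ∀ w ∈ W, X.mode v n w ∈ W) :
    W = ⊥ ∨ W = ⊤

end WeakTwistedModule

end VertexOperatorAlgebra

end

/-!
The twisted module is found inside `V*`.  The functionals `f` for which the poles of `f(Y(a,z)v)`
at `z = -1` and at `z = ∞` are bounded uniformly in `v` form a `g`-twisted module: its modes are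
the coefficients of the expansion of `f(Y(a,z)v)` at `z = -1`, twisted by `(1+z)^{r/T}`, and its
Jacobi identity comes from that of `V` by the residue theorem.  It contains `A_g(V)*`, the
functionals vanishing on `O_g(V)`, and these are killed by all weight-lowering modes, so an
eigenvector of `L(0)` in the finite-dimensional space `A_g(V)*` generates a lowest weight module,
which has a simple subquotient.

The eigenvalue `c` is chosen so that no `c + x` with `x > 0` is an eigenvalue of `L(0)` on
`A_g(V)*`.  Zero modes of `V` restricted to a weight space `M_{c+q}` and paired with a functional
that kills whatever has passed through a lower weight give elements of `A_g(V)*` of eigenvalue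
`c + q`.  For `q > 0` there are therefore none, and every functional on `M_{c+q}` lies in the
space obtained from one functional on the lowest weight space by applying the modes of `V`.  That
space has countable dimension because `V` does, so `M_{c+q}` is finite-dimensional.
-/

noncomputable section

namespace VertexOperatorAlgebra

open Filter Finset PowerSeries

section BinomialSeries

lemma rescale_C {R : Type*} [CommSemiring R] (a r : R) : rescale a (C r) = C r := by
  ext c
  rw [coeff_rescale, coeff_C]
  split_ifs with h
  · rw [h, pow_zero, one_mul]
  · rw [mul_zero]

variable {R : Type*} [CommRing R] [BinomialRing R]

/-- The series `(1-X)^(-j)`. -/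
def negBinomialSeries (j : R) : PowerSeries R := rescale (-1) (binomialSeries R (-j))

@[simp] lemma coeff_negBinomialSeries (j : R) (i : ℕ) :
    coeff i (negBinomialSeries j) = (-1) ^ i * Ring.choose (-j) i := by
  rw [negBinomialSeries, coeff_rescale, binomialSeries_coeff, smul_eq_mul, mul_one]

lemma negBinomialSeries_add (j k : R) :
    negBinomialSeries (j + k) = negBinomialSeries j * negBinomialSeries k := by
  rw [negBinomialSeries, neg_add, binomialSeries_add, map_mul]
  rfl

lemma negBinomialSeries_zero : negBinomialSeries (0 : R) = 1 := by
  rw [negBinomialSeries, neg_zero, binomialSeries_zero, map_one]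

lemma negBinomialSeries_neg_one : negBinomialSeries (-1 : R) = 1 - X := by
  have h : binomialSeries R (1 : R) = 1 + X := by simpa using binomialSeries_nat (R := R) (A := R) 1
  rw [negBinomialSeries, neg_neg, h, map_add, map_one, rescale_X, map_neg, map_one]
  ring

/-- The expansion of the divided derivative of `X^p (1+X)^α`. -/
lemma mk_choose_mul_choose (α p : R) (i : ℕ) :
    PowerSeries.mk (fun c : ℕ => Ring.choose α c * Ring.choose (p + c) i) =
      ∑ x ∈ antidiagonal i, C (Ring.choose α x.1 * Ring.choose p x.2) *
        (X ^ x.1 * binomialSeries R (α - x.1)) := by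
  ext c
  rw [coeff_mk, map_sum, add_comm p, Ring.add_choose_eq i (Commute.all (c : R) p), mul_sum]
  refine sum_congr rfl fun x _ => ?_
  rw [coeff_C_mul, coeff_X_pow_mul', Ring.choose_natCast]
  split_ifs with h
  · have := Ring.choose_smul_choose α h
    rw [nsmul_eq_mul] at this
    rw [binomialSeries_coeff, smul_eq_mul, mul_one]
    linear_combination Ring.choose p x.2 * this
  · rw [Nat.choose_eq_zero_of_lt (not_le.mp h), Nat.cast_zero, mul_zero, zero_mul, mul_zero]

lemma mk_negBinomialSeries_mul_choose (j p : R) (i : ℕ) :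
    PowerSeries.mk (fun c : ℕ => coeff c (negBinomialSeries j) * Ring.choose (p + c) i) =
      ∑ x ∈ antidiagonal i, C (Ring.choose p x.1 * Ring.choose (-j) x.2 * (-1) ^ x.2) *
        (X ^ x.2 * negBinomialSeries (j + x.2)) := by
  have hrescale := congrArg (rescale (-1 : R)) (mk_choose_mul_choose (-j) p i)
  have hmk : PowerSeries.mk
        (fun c : ℕ => coeff c (negBinomialSeries j) * Ring.choose (p + c) i) =
      rescale (-1) (PowerSeries.mk fun c : ℕ => Ring.choose (-j) c * Ring.choose (p + c) i) := by
    ext c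
    rw [coeff_mk, coeff_negBinomialSeries, coeff_rescale, coeff_mk, mul_assoc]
  rw [hmk, hrescale, map_sum, ← Nat.sum_antidiagonal_swap]
  refine sum_congr rfl fun x _ => ?_
  rw [Prod.fst_swap, Prod.snd_swap, map_mul (rescale (-1 : R)), map_mul (rescale (-1 : R)),
    rescale_C, map_pow, rescale_X, mul_pow, ← map_pow, negBinomialSeries, neg_add', map_mul C,
    map_mul C, map_mul C]
  ring

end BinomialSeries

section Truncation

variable {E : Type*} [AddCommGroup E]

lemma finsum_eq_sum_range {x : ℕ → E} {N : ℕ} (h : ∀ i, N ≤ i → x i = 0) :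
    ∑ᶠ i, x i = ∑ i ∈ range N, x i :=
  finsum_eq_sum_of_support_subset _ fun i hi => by
    simpa using not_le.mp fun hNi => hi (h i hNi)

lemma eventually_forall_add_natCast_le {P : ℤ → Prop} (hP : ∀ᶠ n in atTop, P n) (p : ℤ) :
    ∀ᶠ N : ℕ in atTop, ∀ n, p + N ≤ n → P n := by
  obtain ⟨B, hB⟩ := eventually_atTop.mp hP
  filter_upwards [eventually_ge_atTop (B - p).toNat] with N hN n hn
  exact hB n (by lia)

lemma eventually_forall_ge_of_eventually {P : ℤ → ℤ → Prop} (hP : ∀ q, ∀ᶠ n in atTop, P q n)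
    (hlarge : ∀ᶠ q in atTop, ∀ n, P q n) (q₀ : ℤ) : ∀ᶠ n in atTop, ∀ q, q₀ ≤ q → P q n := by
  obtain ⟨Q, hQ⟩ := eventually_atTop.mp hlarge
  have hfin : ∀ᶠ n in atTop, ∀ q ∈ Finset.Ico q₀ Q, P q n :=
    (Finset.Ico q₀ Q).eventually_all.mpr fun q _ => hP q
  filter_upwards [hfin] with n hn q hq
  by_cases hqQ : q < Q
  · exact hn q (Finset.mem_Ico.mpr ⟨hq, hqQ⟩)
  · exact hQ q (not_lt.mp hqQ) n

end Truncation

section Action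

variable {R E : Type*} [CommRing R] [AddCommGroup E] [Module R E]

/-- The action of power series on sequences indexed by `ℤ`, with `X` acting as the shift
`x ↦ (p ↦ x (p + 1))`; it is meaningful on sequences that vanish for large indices. -/
def act (c : PowerSeries R) (x : ℤ → E) (p : ℤ) : E :=
  ∑ᶠ i : ℕ, coeff i c • x (p + i)

lemma act_eq_sum (c : PowerSeries R) {x : ℤ → E} {p : ℤ} {N : ℕ} (h : ∀ n, p + N ≤ n → x n = 0) :
    act c x p = ∑ i ∈ range N, coeff i c • x (p + i) :=
  finsum_eq_sum_range fun i hi => by rw [h _ (by lia), smul_zero]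

lemma act_congr (c : PowerSeries R) {x y : ℤ → E} {p : ℤ} (h : ∀ n, p ≤ n → x n = y n) :
    act c x p = act c y p :=
  finsum_congr fun i => by rw [h _ (by lia)]

lemma act_eq_zero (c : PowerSeries R) {x : ℤ → E} {p : ℤ} (h : ∀ n, p ≤ n → x n = 0) :
    act c x p = 0 := by
  rw [act_eq_sum c (N := 0) (by simpa using h), sum_range_zero]

lemma eventually_act_eq_zero (c : PowerSeries R) {x : ℤ → E} (hx : ∀ᶠ n in atTop, x n = 0) :
    ∀ᶠ n in atTop, act c x n = 0 :=
  (eventually_forall_ge_atTop.mpr hx).mono fun _ => act_eq_zero c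

variable {x : ℤ → E} (hx : ∀ᶠ n in atTop, x n = 0) (p : ℤ)
include hx

lemma eventually_act_eq_sum :
    ∀ᶠ N : ℕ in atTop, ∀ c : PowerSeries R, act c x p = ∑ i ∈ range N, coeff i c • x (p + i) :=
  (eventually_forall_add_natCast_le hx p).mono fun _ hN c => act_eq_sum c hN

lemma act_add_left (c d : PowerSeries R) : act (c + d) x p = act c x p + act d x p := by
  obtain ⟨N, hN⟩ := (eventually_act_eq_sum (R := R) hx p).exists
  simp only [hN, map_add, add_smul, sum_add_distrib]

lemma act_sum_left {ι : Type*} (s : Finset ι) (c : ι → PowerSeries R) :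
    act (∑ k ∈ s, c k) x p = ∑ k ∈ s, act (c k) x p := by
  obtain ⟨N, hN⟩ := (eventually_act_eq_sum (R := R) hx p).exists
  simp only [hN, map_sum, Finset.sum_smul]
  exact sum_comm

lemma act_sub_left (c d : PowerSeries R) : act (c - d) x p = act c x p - act d x p := by
  rw [eq_sub_iff_add_eq, ← act_add_left hx, sub_add_cancel]

lemma act_add_right (c : PowerSeries R) {y : ℤ → E} (hy : ∀ᶠ n in atTop, y n = 0) :
    act c (fun n => x n + y n) p = act c x p + act c y p := by
  have hxy : ∀ᶠ n in atTop, x n + y n = 0 := by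
    filter_upwards [hx, hy] with n hxn hyn
    rw [hxn, hyn, add_zero]
  obtain ⟨N, hNx, hNy, hNxy⟩ := ((eventually_act_eq_sum (R := R) hx p).and
    ((eventually_act_eq_sum (R := R) hy p).and (eventually_act_eq_sum (R := R) hxy p))).exists
  simp only [hNx, hNy, hNxy, smul_add, sum_add_distrib]

lemma act_C_mul (a : R) (c : PowerSeries R) : act (C a * c) x p = a • act c x p := by
  obtain ⟨N, hN⟩ := (eventually_act_eq_sum (R := R) hx p).exists
  simp only [hN, coeff_C_mul, mul_smul, smul_sum]

lemma act_X_pow_mul (k : ℕ) (c : PowerSeries R) : act (X ^ k * c) x p = act c x (p + k) := by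
  obtain ⟨N, hN⟩ := (eventually_forall_add_natCast_le hx p).exists
  rw [act_eq_sum (N := k + N) _ fun n hn => hN n (by lia),
    act_eq_sum (N := N) _ fun n hn => hN n (by lia), sum_range_add, sum_eq_zero, zero_add]
  · refine sum_congr rfl fun i _ => ?_
    rw [coeff_X_pow_mul', if_pos (Nat.le_add_right k i), Nat.add_sub_cancel_left, Nat.cast_add,
      add_assoc]
  · intro i hi
    rw [coeff_X_pow_mul', if_neg (by simpa using hi), zero_smul]

lemma act_one : act (1 : PowerSeries R) x p = x p := by
  obtain ⟨N, hN⟩ := (eventually_forall_add_natCast_le hx p).exists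
  rw [act_eq_sum (N := N + 1) _ fun n hn => hN n (by lia), sum_range_succ']
  simp [coeff_one]

lemma act_mul (c d : PowerSeries R) : act (c * d) x p = act c (act d x) p := by
  obtain ⟨N, hN⟩ := (eventually_forall_add_natCast_le hx p).exists
  rw [act_eq_sum _ hN,
    act_eq_sum _ (N := N) fun n hn => act_eq_zero _ fun m hm => hN m (by lia)]
  calc
    ∑ k ∈ range N, coeff k (c * d) • x (p + k)
      = ∑ k ∈ range N, ∑ i ∈ range (k + 1),
          (coeff i c * coeff (k - i) d) • x (p + (i + (k - i) : ℕ)) := by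
        refine sum_congr rfl fun k _ => ?_
        rw [coeff_mul, Nat.sum_antidiagonal_eq_sum_range_succ_mk, Finset.sum_smul]
        refine sum_congr rfl fun i hi => ?_
        rw [Nat.add_sub_cancel' (mem_range_succ_iff.mp hi)]
    _ = ∑ i ∈ range N, ∑ j ∈ range (N - i),
          (coeff i c * coeff j d) • x (p + (i + j : ℕ)) :=
        sum_range_diag_flip N fun i j => (coeff i c * coeff j d) • x (p + (i + j : ℕ))
    _ = ∑ i ∈ range N, coeff i c • act d x (p + i) := by
        refine sum_congr rfl fun i hi => ?_
        have hiN := mem_range.mp hi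
        rw [act_eq_sum d (N := N - i) fun n hn => hN n (by lia), smul_sum]
        simp only [smul_smul, Nat.cast_add, add_assoc]

lemma map_act {F : Type*} [AddCommGroup F] [Module R F] (φ : E →ₗ[R] F) (c : PowerSeries R) :
    φ (act c x p) = act c (fun n => φ (x n)) p := by
  obtain ⟨N, hN⟩ := (eventually_forall_add_natCast_le hx p).exists
  rw [act_eq_sum c hN, act_eq_sum c (N := N) fun n hn => by rw [hN n hn, map_zero], map_sum]
  simp only [map_smul]

end Action

section Expansion

variable {R E : Type*} [CommRing R] [BinomialRing R] [AddCommGroup E] [Module R E]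
  {x y : ℤ → E}

lemma act_negBinomialSeries_eq_sub (hx : ∀ᶠ n in atTop, x n = 0) (j p : ℤ) :
    act (negBinomialSeries (j : R)) x p =
      act (negBinomialSeries ((j + 1 : ℤ) : R)) x p -
        act (negBinomialSeries ((j + 1 : ℤ) : R)) x (p + 1) := by
  have hseries : negBinomialSeries (j : R) = negBinomialSeries ((j + 1 : ℤ) : R) -
      X ^ 1 * negBinomialSeries ((j + 1 : ℤ) : R) := by
    rw [show (j : R) = -1 + (j + 1 : ℤ) by push_cast; ring, negBinomialSeries_add,
      negBinomialSeries_neg_one]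
    ring
  rw [hseries, act_sub_left hx, act_X_pow_mul hx, Nat.cast_one]

lemma act_negBinomialSeries_neg_act (hx : ∀ᶠ n in atTop, x n = 0) (j : R) (p : ℤ) :
    act (negBinomialSeries (-j)) (act (negBinomialSeries j) x) p = x p := by
  rw [← act_mul hx, ← negBinomialSeries_add, neg_add_cancel, negBinomialSeries_zero, act_one hx]

variable (R)

lemma eq_of_act_negBinomialSeries_eq (hx : ∀ᶠ n in atTop, x n = 0) (hy : ∀ᶠ n in atTop, y n = 0)
    (N : ℤ) (h : ∀ p j : ℤ, N ≤ j - p →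
      act (negBinomialSeries (j : R)) x p = act (negBinomialSeries (j : R)) y p) : x = y := by
  obtain ⟨P, hP⟩ := eventually_atTop.mp (hx.and hy)
  have hact : act (negBinomialSeries ((N + P : ℤ) : R)) x =
      act (negBinomialSeries ((N + P : ℤ) : R)) y := by
    funext p
    by_cases hp : p ≤ P
    · exact h p _ (by lia)
    · rw [act_eq_zero _ fun n hn => (hP n (by lia)).1,
        act_eq_zero _ fun n hn => (hP n (by lia)).2]
  funext p
  rw [← act_negBinomialSeries_neg_act hx ((N + P : ℤ) : R) p, hact,
    act_negBinomialSeries_neg_act hy]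

omit R [CommRing R] [BinomialRing R] [Module R E] in
lemma eq_of_eq_sub_of_eq_add_one {μ ν : ℤ → ℤ → E} {J p j₀ : ℤ}
    (hμ : ∀ j, μ p j = μ p (j + 1) - μ (p + 1) (j + 1))
    (hν : ∀ j, ν p j = ν p (j + 1) - ν (p + 1) (j + 1))
    (hsucc : ∀ j, J ≤ j → μ (p + 1) (j + 1) = ν (p + 1) (j + 1))
    (hj₀ : J ≤ j₀) (heq : μ p j₀ = ν p j₀) {j : ℤ} (hj : J ≤ j) : μ p j = ν p j := by
  have hconst : ∀ j, J ≤ j → μ p j - ν p j = μ p J - ν p J := by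
    intro j hj
    induction j, hj using Int.leInduction with
    | base => rfl
    | succ j hj ih =>
      rw [← ih, hμ j, hν j, hsucc j hj]
      abel
  rw [← sub_eq_zero, hconst j hj, ← hconst j₀ hj₀, heq, sub_self]

/-- A family `μ p j` that behaves like the residues of `y^p (1-y)^(-j)` against a form which is
regular at the boundary points comes from the expansion of that form at `y = 0`. -/
lemma exists_expansion (μ : ℤ → ℤ → E) (hμ : ∀ p j, μ p j = μ p (j + 1) - μ (p + 1) (j + 1))
    (P J : ℤ) (hzero : ∀ p j, P ≤ p → J ≤ j - p → μ p j = 0) :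
    ∃ e : ℤ → E, (∀ k, P ≤ k → e k = 0) ∧
      ∀ p j : ℤ, J ≤ j - p → μ p j = act (negBinomialSeries (j : R)) e p := by
  let x : ℤ → E := fun p => if p < P then μ p (J + P) else 0
  have hxP : ∀ k, P ≤ k → x k = 0 := fun k hk => if_neg (not_lt.mpr hk)
  have hx : ∀ᶠ n in atTop, x n = 0 := (eventually_ge_atTop P).mono hxP
  let e : ℤ → E := act (negBinomialSeries (-((J + P : ℤ) : R))) x
  have heP : ∀ k, P ≤ k → e k = 0 := fun k hk => act_eq_zero _ fun m hm => hxP m (hk.trans hm)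
  have he : ∀ᶠ n in atTop, e n = 0 := (eventually_ge_atTop P).mono heP
  have hex : ∀ p, act (negBinomialSeries ((J + P : ℤ) : R)) e p = x p := fun p => by
    simpa only [neg_neg] using act_negBinomialSeries_neg_act hx (-((J + P : ℤ) : R)) p
  have hge : ∀ p, P ≤ p → ∀ j : ℤ, J ≤ j - p →
      μ p j = act (negBinomialSeries (j : R)) e p := fun p hp j hj => by
    rw [hzero p j hp hj, act_eq_zero _ fun m hm => heP m (hp.trans hm)]
  have hle : ∀ p, p ≤ P → ∀ j : ℤ, J ≤ j - p →
      μ p j = act (negBinomialSeries (j : R)) e p := fun p hp => by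
    induction p, hp using Int.leInductionDown with
    | base => exact hge P le_rfl
    | pred p hp ih =>
      intro j hj
      refine eq_of_eq_sub_of_eq_add_one (μ := μ) (J := p - 1 + J) (j₀ := J + P)
        (ν := fun p j => act (negBinomialSeries (j : R)) e p) (hμ _)
        (fun j => act_negBinomialSeries_eq_sub he j _) (fun j hj => ?_) (by lia) ?_ (by lia)
      · simpa only [sub_add_cancel] using ih (j + 1) (by lia)
      · exact ((hex (p - 1)).trans (if_pos (by lia))).symm
  exact ⟨e, heP, fun p j hj => (le_total P p).elim (hge p · j hj) (hle p · j hj)⟩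

end Expansion

section DoubleSequence

variable {E : Type*} [AddCommGroup E]

/-- The double sequence `x` has only finitely many nonzero terms in each quadrant
`{(k, l) | m ≤ k, n ≤ l}`. -/
def IsQuadrantFinite (x : ℤ → ℤ → E) : Prop :=
  (∀ n, ∀ᶠ k in atTop, ∀ l, n ≤ l → x k l = 0) ∧ ∀ m, ∀ᶠ l in atTop, ∀ k, m ≤ k → x k l = 0

namespace IsQuadrantFinite

variable {x y : ℤ → ℤ → E}

lemma swap (hx : IsQuadrantFinite x) : IsQuadrantFinite fun k l => x l k := ⟨hx.2, hx.1⟩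

lemma sub (hx : IsQuadrantFinite x) (hy : IsQuadrantFinite y) :
    IsQuadrantFinite fun k l => x k l - y k l := by
  refine ⟨fun n => ?_, fun m => ?_⟩
  · filter_upwards [hx.1 n, hy.1 n] with k hxk hyk l hl
    rw [hxk l hl, hyk l hl, sub_zero]
  · filter_upwards [hx.2 m, hy.2 m] with l hxl hyl k hk
    rw [hxl k hk, hyl k hk, sub_zero]

lemma sum {ι : Type*} {s : Finset ι} {x : ι → ℤ → ℤ → E}
    (hx : ∀ i ∈ s, IsQuadrantFinite (x i)) : IsQuadrantFinite fun k l => ∑ i ∈ s, x i k l := by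
  refine ⟨fun n => ?_, fun m => ?_⟩
  · filter_upwards [(eventually_all_finset s).mpr fun i hi => (hx i hi).1 n] with k hk l hl
    exact sum_eq_zero fun i hi => hk i hi l hl
  · filter_upwards [(eventually_all_finset s).mpr fun i hi => (hx i hi).2 m] with l hl k hk
    exact sum_eq_zero fun i hi => hl i hi k hk

lemma smul {R : Type*} [CommRing R] [Module R E] (hx : IsQuadrantFinite x) (r : ℤ → R) :
    IsQuadrantFinite fun k l => r k • x k l := by
  refine ⟨fun n => (hx.1 n).mono fun k hk l hl => ?_, fun m => (hx.2 m).mono fun l hl k hk => ?_⟩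
  · simp only [hk l hl, smul_zero]
  · simp only [hl k hk, smul_zero]

lemma translate (hx : IsQuadrantFinite x) (a b : ℤ) :
    IsQuadrantFinite fun k l => x (k + a) (l + b) := by
  refine ⟨fun n => ?_, fun m => ?_⟩
  · filter_upwards [(tendsto_atTop_add_const_right atTop a tendsto_id).eventually (hx.1 (n + b))]
      with k hk l hl
    exact hk _ (by lia)
  · filter_upwards [(tendsto_atTop_add_const_right atTop b tendsto_id).eventually (hx.2 (m + a))]
      with l hl k hk
    exact hl _ (by lia)

lemma congr_of_forall_ge
    (h : ∀ m n, ∃ z : ℤ → ℤ → E, IsQuadrantFinite z ∧ ∀ k l, m ≤ k → n ≤ l → x k l = z k l) :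
    IsQuadrantFinite x := by
  refine ⟨fun n => ?_, fun m => ?_⟩
  · obtain ⟨z, hz, hxz⟩ := h 0 n
    filter_upwards [hz.1 n, eventually_ge_atTop 0] with k hk hk0 l hl
    rw [hxz k l hk0 hl, hk l hl]
  · obtain ⟨z, hz, hxz⟩ := h m 0
    filter_upwards [hz.2 m, eventually_ge_atTop 0] with l hl hl0 k hk
    rw [hxz k l hk hl0, hl k hk]

lemma of_add {u : ℤ → E} (hu : ∀ᶠ n in atTop, u n = 0) :
    IsQuadrantFinite fun k l => u (k + l) := by
  obtain ⟨P, hP⟩ := eventually_atTop.mp hu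
  refine ⟨fun n => ?_, fun m => ?_⟩
  · filter_upwards [eventually_ge_atTop (P - n)] with k hk l hl
    exact hP _ (by lia)
  · filter_upwards [eventually_ge_atTop (P - m)] with l hl k hk
    exact hP _ (by lia)

end IsQuadrantFinite

/-- The double sequence `x` consists of the coefficients of an iterated Laurent series, an
element of `E((z₁))((z₂))`: the second index is bounded above, and so is the first one for each
value of the second. -/
def IsIteratedLaurent (x : ℤ → ℤ → E) : Prop :=
  (∀ᶠ n in atTop, ∀ k, x k n = 0) ∧ ∀ n, ∀ᶠ k in atTop, x k n = 0

lemma IsIteratedLaurent.isQuadrantFinite {x : ℤ → ℤ → E} (hx : IsIteratedLaurent x) :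
    IsQuadrantFinite x :=
  ⟨eventually_forall_ge_of_eventually (P := fun q n => x n q = 0) hx.2 hx.1,
    fun _ => hx.1.mono fun _ hn k _ => hn k⟩

end DoubleSequence

section DoubleAction

variable {R E : Type*} [CommRing R] [AddCommGroup E] [Module R E]

lemma act_translate (c : PowerSeries R) (x : ℤ → E) (a p : ℤ) :
    act c (fun n => x (n + a)) p = act c x (p + a) :=
  finsum_congr fun i => by rw [add_right_comm]

/-- The action of a pair of power series on a double sequence, `c` acting on the first index and
`d` on the second. -/
def act₂ (c d : PowerSeries R) (x : ℤ → ℤ → E) (m n : ℤ) : E := act c (fun k => act d (x k) n) m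

lemma act₂_congr (c d : PowerSeries R) {x y : ℤ → ℤ → E} {m n : ℤ}
    (h : ∀ k l, m ≤ k → n ≤ l → x k l = y k l) : act₂ c d x m n = act₂ c d y m n :=
  finsum_congr fun i => congrArg _ <| finsum_congr fun j => by
    rw [h _ _ (by lia) (by lia)]

lemma act₂_eq_zero (c d : PowerSeries R) {x : ℤ → ℤ → E} {m n : ℤ}
    (h : ∀ k l, m ≤ k → n ≤ l → x k l = 0) : act₂ c d x m n = 0 :=
  act_eq_zero c fun k hk => act_eq_zero d fun l hl => h k l hk hl

lemma act₂_translate (c d : PowerSeries R) (x : ℤ → ℤ → E) (a b m n : ℤ) :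
    act₂ c d (fun k l => x (k + a) (l + b)) m n = act₂ c d x (m + a) (n + b) := by
  simp only [act₂, act_translate d (x _) b]
  exact act_translate c (fun k => act d (x k) (n + b)) a m

lemma act₂_smul_add (c d : PowerSeries R) {u : ℤ → E} (hu : ∀ᶠ n in atTop, u n = 0)
    (r : ℤ → R) (a m n : ℤ) :
    act₂ c d (fun k l => r k • u (k + l + a)) m n =
      act (PowerSeries.mk (fun k : ℕ => coeff k c * r (m + k)) * d) u (m + n + a) := by
  rw [act_mul hu]
  refine finsum_congr fun k => ?_
  have htranslate : (fun l => u (m + k + l + a)) = fun l => u (l + (m + k + a)) := by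
    funext l
    rw [add_comm (m + (k : ℤ)) l, add_assoc]
  have hu' : ∀ᶠ l in atTop, (fun l => u (m + k + l + a)) l = 0 := by
    rw [htranslate]
    exact (tendsto_atTop_add_const_right atTop _ tendsto_id).eventually hu
  rw [coeff_mk, mul_smul]
  congr 1
  rw [show m + n + a + (k : ℤ) = n + (m + k + a) by ring, ← act_translate, ← htranslate]
  exact (map_act hu' n (LinearMap.lsmul R E (r (m + k))) d).symm

variable {x y : ℤ → ℤ → E}

lemma eventually_act₂_eq_sum (hx : IsQuadrantFinite x) (m n : ℤ) : ∀ᶠ M : ℕ in atTop,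
    ∀ c d : PowerSeries R, act₂ c d x m n =
      ∑ i ∈ range M, ∑ k ∈ range M, (coeff i c * coeff k d) • x (m + i) (n + k) := by
  filter_upwards [eventually_forall_add_natCast_le (hx.1 n) m,
    eventually_forall_add_natCast_le (hx.2 m) n] with M hfst hsnd c d
  rw [act₂, act_eq_sum c fun k hk => act_eq_zero d (hfst k hk)]
  refine sum_congr rfl fun i _ => ?_
  rw [act_eq_sum d fun l hl => hsnd l hl (m + i) (by lia), smul_sum]
  simp only [smul_smul]

lemma act₂_swap (c d : PowerSeries R) (hx : IsQuadrantFinite x) (m n : ℤ) :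
    act₂ c d x m n = act₂ d c (fun k l => x l k) n m := by
  obtain ⟨M, hM, hMswap⟩ := ((eventually_act₂_eq_sum (R := R) hx m n).and
    (eventually_act₂_eq_sum (R := R) hx.swap n m)).exists
  rw [hM, hMswap, sum_comm]
  simp only [mul_comm]

lemma act₂_sub (c d : PowerSeries R) (hx : IsQuadrantFinite x) (hy : IsQuadrantFinite y)
    (m n : ℤ) :
    act₂ c d (fun k l => x k l - y k l) m n = act₂ c d x m n - act₂ c d y m n := by
  obtain ⟨M, hMx, hMy, hMxy⟩ := ((eventually_act₂_eq_sum (R := R) hx m n).and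
    ((eventually_act₂_eq_sum (R := R) hy m n).and
      (eventually_act₂_eq_sum (R := R) (hx.sub hy) m n))).exists
  simp only [hMx, hMy, hMxy, smul_sub, sum_sub_distrib]

lemma act₂_smul (c d : PowerSeries R) (hx : IsQuadrantFinite x) (r : R) (m n : ℤ) :
    act₂ c d (fun k l => r • x k l) m n = r • act₂ c d x m n := by
  obtain ⟨M, hM, hMsmul⟩ := ((eventually_act₂_eq_sum (R := R) hx m n).and
    (eventually_act₂_eq_sum (R := R) (hx.smul fun _ => r) m n)).exists
  simp only [hM, hMsmul, smul_sum, smul_comm r]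

lemma act₂_sum {ι : Type*} (c d : PowerSeries R) {s : Finset ι} {x : ι → ℤ → ℤ → E}
    (hx : ∀ i ∈ s, IsQuadrantFinite (x i)) (m n : ℤ) :
    act₂ c d (fun k l => ∑ i ∈ s, x i k l) m n = ∑ i ∈ s, act₂ c d (x i) m n := by
  obtain ⟨M, hM, hMsum⟩ := (((eventually_all_finset s).mpr fun i hi =>
    eventually_act₂_eq_sum (R := R) (hx i hi) m n).and
      (eventually_act₂_eq_sum (R := R) (IsQuadrantFinite.sum hx) m n)).exists
  rw [hMsum, sum_congr rfl fun i hi => hM i hi c d, sum_comm (s := s)]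
  refine sum_congr rfl fun a _ => ?_
  rw [sum_comm (s := s)]
  simp only [smul_sum]

lemma eq_zero_of_act₂_eq_zero (hx : IsQuadrantFinite x)
    (h : ∀ m n, ∃ c d : PowerSeries R, coeff 0 c = 1 ∧ coeff 0 d = 1 ∧ act₂ c d x m n = 0)
    (m n : ℤ) : x m n = 0 := by
  obtain ⟨A, hA⟩ := (eventually_forall_ge_atTop.mpr (hx.1 n)).exists
  obtain ⟨B, hB⟩ := (eventually_forall_ge_atTop.mpr (hx.2 m)).exists
  have hlarge : ∀ s : ℕ, ∀ k l, m ≤ k → n ≤ l → A + B - s ≤ k + l → x k l = 0 := by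
    intro s
    induction s with
    | zero =>
      intro k l hk hl hkl
      rcases le_or_gt A k with hAk | hkA
      · exact hA k hAk l hl
      · exact hB l (by lia) k hk
    | succ s ih =>
      intro k l hk hl hkl
      obtain ⟨c, d, hc, hd, hcd⟩ := h k l
      have hbeyond : ∀ k' l', k ≤ k' → l ≤ l' → k + l < k' + l' → x k' l' = 0 :=
        fun k' l' hk' hl' hlt => ih k' l' (by lia) (by lia) (by lia)
      rw [act₂, act_eq_sum (N := 1) c fun k' hk' => act_eq_zero d fun l' hl' =>
          hbeyond k' l' (by lia) hl' (by lia), sum_range_one,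
        act_eq_sum (N := 1) d fun l' hl' => hbeyond _ l' (by lia) (by lia) (by lia),
        sum_range_one, hc, hd, one_smul, one_smul, Nat.cast_zero, add_zero, add_zero] at hcd
      exact hcd
  exact hlarge (A + B - (m + n)).toNat m n le_rfl le_rfl (by lia)

end DoubleAction

section JacobiSums

variable {E : Type*} [AddCommGroup E] [Module ℂ E]

/-- The coefficients of `(z₁ - z₂)^l x(z₁, z₂)`, with the binomial expanded in nonnegative powers
of `z₂`. The indices of `x` follow the mode convention: `x k n` is the coefficient of
`z₁^(-k-1) z₂^(-n-1)`. -/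
def jacobiSum (l : ℤ) (x : ℤ → ℤ → E) (m n : ℤ) : E :=
  ∑ᶠ i : ℕ, ((-1 : ℂ) ^ i * Ring.choose (l : ℂ) i) • x (m + l - i) (n + i)

/-- The shape of the right-hand side of the Jacobi identity: `w i` is the sequence of modes of
`u_(l+i) v`, and `α` is the shift of the index `m` caused by the twist. -/
def iterateSum (α : ℂ) (w : ℕ → ℤ → E) (m n : ℤ) : E :=
  ∑ᶠ i : ℕ, Ring.choose (α + m) i • w i (m + n - i)

section JacobiSum

variable {x : ℤ → ℤ → E} (hx : IsIteratedLaurent x) (l : ℤ)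
include hx

lemma eventually_jacobiSum_eq_sum (n : ℤ) : ∀ᶠ K : ℕ in atTop, ∀ k q, n ≤ q →
    jacobiSum l x k q =
      ∑ i ∈ range K, ((-1 : ℂ) ^ i * Ring.choose (l : ℂ) i) • x (k + (l - i)) (q + i) := by
  filter_upwards [eventually_forall_add_natCast_le hx.1 n] with K hK k q hq
  simp only [← add_sub_assoc]
  exact finsum_eq_sum_range fun i hi => by rw [hK (q + i) (by lia), smul_zero]

lemma isQuadrantFinite_jacobiSum : IsQuadrantFinite (jacobiSum l x) :=
  .congr_of_forall_ge fun _ n =>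
    have ⟨_, hK⟩ := (eventually_jacobiSum_eq_sum hx l n).exists
    ⟨_, .sum fun _ _ => (hx.isQuadrantFinite.translate _ _).smul _, fun k q _ hq => hK k q hq⟩

lemma act₂_jacobiSum (c d : PowerSeries ℂ) (m n : ℤ) :
    act₂ c d (jacobiSum l x) m n = jacobiSum l (act₂ c d x) m n := by
  obtain ⟨K, hK, hxK⟩ := ((eventually_jacobiSum_eq_sum hx l n).and
    (eventually_forall_add_natCast_le hx.1 n)).exists
  have hfinite := hx.isQuadrantFinite
  rw [act₂_congr c d fun k q _ hq => hK k q hq,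
    act₂_sum c d fun i _ => (hfinite.translate _ _).smul fun _ => _, jacobiSum,
    finsum_eq_sum_range (N := K) fun i hi => by
      rw [act₂_eq_zero c d fun k q _ hq => hxK q (by lia) k, smul_zero]]
  refine sum_congr rfl fun i _ => ?_
  rw [act₂_smul c d (hfinite.translate _ _), act₂_translate, add_sub_assoc]

end JacobiSum

section IterateSum

variable {w : ℕ → ℤ → E} (hw : ∀ᶠ i in atTop, ∀ k, w i k = 0) (hwi : ∀ i, ∀ᶠ k in atTop, w i k = 0)
  (α : ℂ)

include hw in
lemma iterateSum_eq_sum : ∃ I : ℕ, (∀ i, I ≤ i → ∀ k, w i k = 0) ∧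
    iterateSum α w = fun m n : ℤ =>
      ∑ i ∈ range I, Ring.choose (α + m) i • w i (m + n + -i) := by
  obtain ⟨I, hI⟩ := eventually_atTop.mp hw
  refine ⟨I, hI, funext₂ fun m n => ?_⟩
  exact finsum_eq_sum_range fun i hi => by rw [hI i hi, smul_zero]

include hwi in
lemma isQuadrantFinite_choose_smul (i : ℕ) :
    IsQuadrantFinite fun m n : ℤ => Ring.choose (α + m) i • w i (m + n + -i) := by
  have htranslate : ∀ᶠ k in atTop, w i (k + -i) = 0 :=
    (tendsto_atTop_add_const_right atTop _ tendsto_id).eventually (hwi i)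
  exact (IsQuadrantFinite.of_add htranslate).smul fun m => Ring.choose (α + m) i

include hw hwi

lemma isQuadrantFinite_iterateSum : IsQuadrantFinite (iterateSum α w) := by
  obtain ⟨I, -, hI⟩ := iterateSum_eq_sum hw α
  exact hI ▸ .sum fun i _ => isQuadrantFinite_choose_smul hwi α i

lemma act₂_iterateSum (c d : PowerSeries ℂ) (m n : ℤ) :
    act₂ c d (iterateSum α w) m n = ∑ᶠ i : ℕ,
      act (PowerSeries.mk (fun k : ℕ => coeff k c * Ring.choose (α + m + k) i) * d) (w i)
        (m + n - i) := by
  obtain ⟨I, hzero, hI⟩ := iterateSum_eq_sum hw α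
  rw [hI, act₂_sum c d fun i _ => isQuadrantFinite_choose_smul hwi α i,
    finsum_eq_sum_range (N := I) fun i hi => act_eq_zero _ fun k _ => hzero i hi k]
  refine sum_congr rfl fun i _ => ?_
  rw [act₂_smul_add c d (hwi i) fun m => Ring.choose (α + m) i]
  simp only [Int.cast_add, Int.cast_natCast, add_assoc, sub_eq_add_neg]

lemma act₂_binomialSeries_iterateSum (β γ : ℂ) (m n : ℤ) :
    act₂ (binomialSeries ℂ β) (binomialSeries ℂ γ) (iterateSum α w) m n =
      ∑ᶠ i : ℕ, ∑ x ∈ antidiagonal i, (Ring.choose β x.1 * Ring.choose (α + m) x.2) •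
        act (binomialSeries ℂ (β + γ - x.1)) (w i) (m + n - x.2) := by
  rw [act₂_iterateSum hw hwi]
  refine finsum_congr fun i => ?_
  simp only [binomialSeries_coeff, smul_eq_mul, mul_one]
  rw [mk_choose_mul_choose, sum_mul, act_sum_left (hwi i)]
  refine sum_congr rfl fun x hx => ?_
  have hx' := mem_antidiagonal.mp hx
  rw [mul_assoc, act_C_mul (hwi i), mul_assoc, act_X_pow_mul (hwi i), ← binomialSeries_add,
    sub_add_eq_add_sub, show m + n - (i : ℤ) + x.1 = m + n - x.2 by lia]

lemma act₂_negBinomialSeries_iterateSum (j j' : ℂ) (m n : ℤ) :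
    act₂ (negBinomialSeries j) (negBinomialSeries j') (iterateSum α w) m n =
      ∑ᶠ i : ℕ, ∑ x ∈ antidiagonal i,
        (Ring.choose (α + m) x.1 * Ring.choose (-j) x.2 * (-1) ^ x.2) •
          act (negBinomialSeries (j + j' + x.2)) (w i) (m + n - x.1) := by
  rw [act₂_iterateSum hw hwi]
  refine finsum_congr fun i => ?_
  rw [mk_negBinomialSeries_mul_choose, sum_mul, act_sum_left (hwi i)]
  refine sum_congr rfl fun x hx => ?_
  have hx' := mem_antidiagonal.mp hx
  rw [mul_assoc, act_C_mul (hwi i), mul_assoc (X ^ x.2), act_X_pow_mul (hwi i),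
    ← negBinomialSeries_add, add_right_comm j, show m + n - (i : ℤ) + x.2 = m + n - x.1 by lia]

end IterateSum

lemma choose_mul_choose_sub {R : Type*} [CommRing R] [BinomialRing R] (α : R) (i p : ℕ) :
    Ring.choose α i * Ring.choose (α - i) p = Ring.choose α p * Ring.choose (α - p) i := by
  have hi := Ring.choose_smul_choose α (n := i + p) (k := i) (Nat.le_add_right _ _)
  have hp := Ring.choose_smul_choose α (n := i + p) (k := p) (Nat.le_add_left _ _)
  rw [Nat.add_sub_cancel_left] at hi
  rw [Nat.add_sub_cancel] at hp
  rw [← hi, ← hp, Nat.choose_symm_add]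

/-- The two expansions of a factor `(z₁ - z₂)^l`, in terms of `1 - z₁ / z₂` on one side and of
`z₂ / z₁` on the other, agree once they are paired with sequences truncated from above. -/
lemma finsum_choose_smul_act_apply {F G : Type*} [AddCommGroup F] [Module ℂ F] [AddCommGroup G]
    [Module ℂ G] {h : ℤ → F →ₗ[ℂ] G} {u : ℤ → F} (hh : ∀ᶠ n in atTop, h n = 0)
    (hu : ∀ᶠ n in atTop, u n = 0) (l : ℂ) (n p : ℤ) :
    ∑ᶠ i : ℕ, Ring.choose l i • act (negBinomialSeries (i - l)) h n (u (p + i)) =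
      ∑ᶠ r : ℕ, ((-1) ^ r * Ring.choose l r) • h (n + r) (act (binomialSeries ℂ (l - r)) u p) := by
  obtain ⟨K, hK⟩ := (eventually_forall_add_natCast_le hh n).exists
  obtain ⟨I, hI⟩ := (eventually_forall_add_natCast_le hu p).exists
  rw [finsum_eq_sum_range (N := I) fun i hi => by rw [hI _ (by lia), map_zero, smul_zero],
    finsum_eq_sum_range (N := K) fun r hr => by
      rw [hK _ (by lia), LinearMap.zero_apply, smul_zero]]
  simp only [act_eq_sum _ hK, act_eq_sum _ hI, LinearMap.sum_apply, map_sum, map_smul,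
    LinearMap.smul_apply, smul_sum, smul_smul]
  rw [sum_comm]
  refine sum_congr rfl fun r _ => sum_congr rfl fun i _ => ?_
  rw [coeff_negBinomialSeries, neg_sub, binomialSeries_coeff, smul_eq_mul, mul_one,
    mul_left_comm, choose_mul_choose_sub, mul_assoc]

end JacobiSums

section Modes

variable {V : Type*} [AddCommGroup V] [Module ℂ V] [VertexOperatorAlgebra V]

lemma mode_add_left (a b : V) (n : ℤ) : mode (a + b) n = mode a n + mode b n := by
  simp [mode]

lemma mode_smul_left (c : ℂ) (a : V) (n : ℤ) : mode (c • a) n = c • mode a n := by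
  simp [mode]

lemma mode_zero_left (n : ℤ) : mode (0 : V) n = 0 := by
  simpa using mode_smul_left (0 : ℂ) (0 : V) n

lemma eventually_mode_eq_zero (a v : V) : ∀ᶠ n in atTop, mode a n v = 0 := by
  filter_upwards [eventually_ge_atTop (-HahnSeries.order ((HahnModule.of ℂ).symm (Y a v)))]
    with n hn
  exact VertexOperator.ncoeff_eq_zero_of_lt_order _ _ _ (by lia)

lemma isIteratedLaurent_mode (a b v : V) :
    IsIteratedLaurent fun m n => mode a m (mode b n v) :=
  ⟨(eventually_mode_eq_zero b v).mono fun n hn m => by simp only [hn, map_zero],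
    fun n => eventually_mode_eq_zero a (mode b n v)⟩

lemma intCast_choose (l : ℤ) (i : ℕ) : ((Ring.choose l i : ℤ) : ℂ) = Ring.choose (l : ℂ) i :=
  Ring.map_choose (Int.castRingHom ℂ) l i

lemma neg_one_zpow_smul_jacobiSum {E : Type*} [AddCommGroup E] [Module ℂ E] (l : ℤ)
    (x : ℤ → ℤ → E) (m n : ℤ) :
    (-1 : ℂ) ^ l • jacobiSum l x m n =
      ∑ᶠ i : ℕ, ((-1 : ℂ) ^ (l + i) * Ring.choose (l : ℂ) i) • x (m + l - i) (n + i) := by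
  rw [jacobiSum, smul_finsum]
  refine finsum_congr fun i => ?_
  rw [smul_smul, zpow_add₀ (neg_ne_zero.mpr one_ne_zero), zpow_natCast, mul_assoc]

lemma jacobiSum_mode_sub (a b v : V) (l m n : ℤ) :
    jacobiSum l (fun m n => mode a m (mode b n v)) m n -
        (-1 : ℂ) ^ l • jacobiSum l (fun n m => mode b n (mode a m v)) n m =
      iterateSum 0 (fun i k => mode (mode a (l + i) b) k v) m n := by
  have h := jacobi a b v l m n
  simp only [intCast_choose] at h
  rw [neg_one_zpow_smul_jacobiSum, iterateSum, jacobiSum]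
  simpa only [zero_add, mode] using h

/-- `Res_z (1+z)^α z^q Y(a,z)`. -/
def residue (α : ℂ) (q : ℤ) : V →ₗ[ℂ] Module.End ℂ V :=
  LinearMap.mk₂ ℂ (fun a v => act (binomialSeries ℂ α) (fun n => mode a n v) q)
    (fun a b v => by
      simp only [mode_add_left, LinearMap.add_apply]
      exact act_add_right (eventually_mode_eq_zero a v) q _ (eventually_mode_eq_zero b v))
    (fun c a v => by
      simp only [mode_smul_left, LinearMap.smul_apply]
      exact (map_act (eventually_mode_eq_zero a v) q (LinearMap.lsmul ℂ V c) _).symm)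
    (fun a v w => by
      simp only [map_add]
      exact act_add_right (eventually_mode_eq_zero a v) q _ (eventually_mode_eq_zero a w))
    (fun c a v => by
      simp only [map_smul]
      exact (map_act (eventually_mode_eq_zero a v) q (LinearMap.lsmul ℂ V c) _).symm)

lemma residue_apply (α : ℂ) (q : ℤ) (a v : V) :
    residue α q a v = act (binomialSeries ℂ α) (fun n => mode a n v) q := rfl

lemma residue_eq_zero {a v : V} {q : ℤ} (h : ∀ n, q ≤ n → mode a n v = 0) (α : ℂ) :
    residue α q a v = 0 :=
  act_eq_zero _ h

lemma eventually_residue_eq_zero (α : ℂ) (a v : V) : ∀ᶠ q in atTop, residue α q a v = 0 :=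
  eventually_act_eq_zero _ (eventually_mode_eq_zero a v)

lemma residue_add_exponent (β α : ℂ) (q : ℤ) (a v : V) :
    residue (β + α) q a v = act (binomialSeries ℂ β) (fun n => residue α n a v) q := by
  simp only [residue_apply]
  rw [binomialSeries_add, act_mul (eventually_mode_eq_zero a v)]

lemma residue_one_add_exponent (α : ℂ) (q : ℤ) (a : V) :
    residue (1 + α) q a = residue α q a + residue α (q + 1) a := by
  ext v
  have hseries : PowerSeries.binomialSeries ℂ (1 : ℂ) = 1 + X ^ 1 * 1 := by
    simpa using binomialSeries_nat (R := ℂ) (A := ℂ) 1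
  have htrunc := eventually_residue_eq_zero α a v
  rw [residue_add_exponent, hseries, act_add_left htrunc, act_X_pow_mul htrunc, act_one htrunc,
    act_one htrunc, Nat.cast_one, LinearMap.add_apply]

lemma act₂_mode (α β : ℂ) (a b v : V) :
    act₂ (binomialSeries ℂ α) (binomialSeries ℂ β) (fun m n => mode a m (mode b n v)) =
      fun p q => residue α p a (residue β q b v) :=
  funext₂ fun p q => congrArg (act _ · p) <| funext fun k =>
    (map_act (eventually_mode_eq_zero b v) q (mode a k) _).symm

/-- The Jacobi identity, paired with the functions `(1+z₁)^α z₁^p` and `(1+z₂)^β z₂^q`. -/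
lemma jacobiSum_residue_sub (a b v : V) (l p q : ℤ) (α β : ℂ) :
    jacobiSum l (fun p q => residue α p a (residue β q b v)) p q -
        (-1 : ℂ) ^ l • jacobiSum l (fun q p => residue β q b (residue α p a v)) q p =
      ∑ᶠ i : ℕ, ∑ x ∈ antidiagonal i, (Ring.choose α x.1 * Ring.choose (p : ℂ) x.2) •
        residue (α + β - x.1) (p + q - x.2) (mode a (l + i) b) v := by
  have hab := isIteratedLaurent_mode a b v
  have hba := isIteratedLaurent_mode b a v
  have hba' := (isQuadrantFinite_jacobiSum hba l).swap
  have hiter : ∀ᶠ i : ℕ in atTop, ∀ k, mode (mode a (l + i) b) k v = 0 := by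
    filter_upwards [eventually_forall_add_natCast_le (eventually_mode_eq_zero a b) l] with i hi k
    rw [hi _ le_rfl, mode_zero_left, LinearMap.zero_apply]
  have h := act₂_binomialSeries_iterateSum hiter
    (fun i => eventually_mode_eq_zero (mode a (l + i) b) v) 0 α β p q
  rw [← funext₂ (jacobiSum_mode_sub a b v l), act₂_sub _ _ (isQuadrantFinite_jacobiSum hab l)
    (hba'.smul fun _ => _), act₂_smul _ _ hba', act₂_jacobiSum hab, act₂_swap _ _ hba',
    act₂_jacobiSum hba, act₂_mode, act₂_mode] at h
  simpa only [zero_add, residue_apply] using h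

end Modes

section UnitRoot

/-- The number `e^{2πin}`. -/
def unitRoot (n : ℚ) : ℂ := Complex.exp (2 * Real.pi * Complex.I * n)

lemma unitRoot_add (m n : ℚ) : unitRoot (m + n) = unitRoot m * unitRoot n := by
  rw [unitRoot, unitRoot, unitRoot, ← Complex.exp_add, Rat.cast_add, mul_add]

lemma unitRoot_pow (n : ℚ) (k : ℕ) : unitRoot n ^ k = unitRoot (n * k) := by
  rw [unitRoot, unitRoot, ← Complex.exp_nat_mul, Rat.cast_mul, Rat.cast_natCast]
  ring_nf

lemma unitRoot_eq_one_iff {n : ℚ} : unitRoot n = 1 ↔ ∃ k : ℤ, n = k := by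
  rw [unitRoot, Complex.exp_eq_one_iff]
  refine exists_congr fun k => ?_
  rw [mul_comm, mul_left_inj' Complex.two_pi_I_ne_zero]
  exact_mod_cast Iff.rfl

lemma unitRoot_intCast (k : ℤ) : unitRoot k = 1 := unitRoot_eq_one_iff.mpr ⟨k, rfl⟩

lemma unitRoot_zero : unitRoot 0 = 1 := by simpa using unitRoot_intCast 0

lemma unitRoot_add_intCast (n : ℚ) (k : ℤ) : unitRoot (n + k) = unitRoot n := by
  rw [unitRoot_add, unitRoot_intCast, mul_one]

lemma geom_sum_unitRoot_eq_zero {n : ℚ} {T : ℕ} (hn : ∀ k : ℤ, n ≠ k)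
    (hT : ∃ k : ℤ, n * T = k) : ∑ j ∈ range T, unitRoot n ^ j = 0 := by
  have hne : unitRoot n ≠ 1 := fun h =>
    have ⟨k, hk⟩ := unitRoot_eq_one_iff.mp h
    hn k hk
  rw [geom_sum_eq hne, unitRoot_pow, unitRoot_eq_one_iff.mpr hT, sub_self, zero_div]

end UnitRoot

section Sectors

variable {V : Type*} [AddCommGroup V] [Module ℂ V]

/-- The eigenspace of `g` for the eigenvalue `e^{2πin}`. -/
def sector (g : V ≃ₗ[ℂ] V) (n : ℚ) : Submodule ℂ V :=
  Module.End.eigenspace (g : Module.End ℂ V) (unitRoot n)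

/-- The exponents in `T⁻¹ℤ`, where `T` is the order of `g`. -/
def IsSectorIndex (g : V ≃ₗ[ℂ] V) (n : ℚ) : Prop := ∃ k : ℤ, n * orderOf g = k

variable {g : V ≃ₗ[ℂ] V} {m n : ℚ} {a : V}

lemma mem_sector : a ∈ sector g n ↔ g a = unitRoot n • a := Module.End.mem_eigenspace_iff

lemma sector_add_intCast (n : ℚ) (k : ℤ) : sector g (n + k) = sector g n := by
  rw [sector, sector, unitRoot_add_intCast]

lemma pow_apply_of_mem_sector (ha : a ∈ sector g n) (j : ℕ) :
    (g ^ j) a = unitRoot (n * j) • a := by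
  induction j with
  | zero => rw [pow_zero, Nat.cast_zero, mul_zero, unitRoot_zero, one_smul, LinearEquiv.coe_one, id]
  | succ j ih =>
    rw [pow_succ', LinearEquiv.mul_apply, ih, map_smul, mem_sector.mp ha, smul_smul,
      ← unitRoot_add, Nat.cast_succ, mul_add_one]

lemma isSectorIndex_of_mem_sector (ha : a ∈ sector g n) (h0 : a ≠ 0) : IsSectorIndex g n := by
  have h := pow_apply_of_mem_sector ha (orderOf g)
  rw [pow_orderOf_eq_one, LinearEquiv.coe_one, id] at h
  exact unitRoot_eq_one_iff.mp (smul_left_injective ℂ h0 (h.symm.trans (one_smul ℂ a).symm))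

lemma isSectorIndex_add_intCast (k : ℤ) : IsSectorIndex g (n + k) ↔ IsSectorIndex g n := by
  constructor
  · rintro ⟨l, hl⟩
    exact ⟨l - k * orderOf g, by push_cast; linear_combination hl⟩
  · rintro ⟨l, hl⟩
    exact ⟨l + k * orderOf g, by push_cast; linear_combination hl⟩

lemma isSectorIndex_div (hT : IsOfFinOrder g) (k : ℤ) :
    IsSectorIndex g ((k : ℚ) / orderOf g) :=
  ⟨k, div_mul_cancel₀ _ (Nat.cast_ne_zero.mpr hT.orderOf_pos.ne')⟩

lemma IsSectorIndex.exists_eq_div_add (hT : IsOfFinOrder g) (hn : IsSectorIndex g n) :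
    ∃ (r : ℕ) (k : ℤ), r < orderOf g ∧ n = (r : ℚ) / orderOf g + k := by
  obtain ⟨l, hl⟩ := hn
  have hpos : (0 : ℤ) < orderOf g := Int.natCast_pos.mpr hT.orderOf_pos
  have hne : (orderOf g : ℚ) ≠ 0 := Nat.cast_ne_zero.mpr hT.orderOf_pos.ne'
  have hnonneg := Int.emod_nonneg l hpos.ne'
  have hlt := Int.emod_lt_of_pos l hpos
  have hdivmod : (((l % orderOf g).toNat : ℤ) : ℚ) + orderOf g * (l / orderOf g : ℤ) = l := by
    rw [Int.toNat_of_nonneg hnonneg]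
    exact_mod_cast Int.emod_add_mul_ediv l (orderOf g)
  refine ⟨(l % orderOf g).toNat, l / orderOf g, by lia, ?_⟩
  rw [eq_div_of_mul_eq hne hl, ← hdivmod, Int.cast_natCast]
  field_simp

lemma twistedSector_eq_sector (r : ℕ) : twistedSector g r = sector g ((r : ℚ) / orderOf g) := by
  rw [twistedSector, sector, unitRoot, Rat.cast_div, Rat.cast_natCast, Rat.cast_natCast,
    mul_div_assoc]

lemma exists_mem_twistedSector (hT : IsOfFinOrder g) (ha : a ∈ sector g n) (h0 : a ≠ 0) :
    ∃ (r : ℕ) (k : ℤ), r < orderOf g ∧ a ∈ twistedSector g r ∧ n = (r : ℚ) / orderOf g + k := by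
  obtain ⟨r, k, hr, rfl⟩ := (isSectorIndex_of_mem_sector ha h0).exists_eq_div_add hT
  exact ⟨r, k, hr, by rwa [twistedSector_eq_sector, ← sector_add_intCast _ k], rfl⟩

open Classical in
/-- The projection of `V` onto the eigenspace of `g` for `e^{2πin}`. For `n ∉ T⁻¹ℤ` this
eigenspace is zero, but the average over the powers of `g` need not be. -/
def sectorProj (g : V ≃ₗ[ℂ] V) (n : ℚ) : Module.End ℂ V :=
  if IsSectorIndex g n then
    (orderOf g : ℂ)⁻¹ • ∑ j ∈ range (orderOf g), unitRoot (-(n * j)) •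
      ((g ^ j : V ≃ₗ[ℂ] V) : Module.End ℂ V)
  else 0

lemma sectorProj_apply (hn : IsSectorIndex g n) (a : V) : sectorProj g n a =
    (orderOf g : ℂ)⁻¹ • ∑ j ∈ range (orderOf g), unitRoot (-(n * j)) • (g ^ j) a := by
  rw [sectorProj, if_pos hn, LinearMap.smul_apply, LinearMap.sum_apply]
  rfl

lemma sectorProj_eq_zero (hn : ¬IsSectorIndex g n) : sectorProj g n = 0 := if_neg hn

lemma sectorProj_mem (n : ℚ) (a : V) : sectorProj g n a ∈ sector g n := by
  by_cases hn : IsSectorIndex g n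
  · let x : ℕ → V := fun j => unitRoot (-(n * j)) • (g ^ j) a
    have hstep : ∀ j, g (x j) = unitRoot n • x (j + 1) := fun j => by
      rw [map_smul, smul_smul, ← unitRoot_add, pow_succ', LinearEquiv.mul_apply]
      congr 2
      push_cast
      ring
    have hperiod : x (orderOf g) = x 0 := by
      obtain ⟨k, hk⟩ := hn
      simp only [x, pow_orderOf_eq_one, hk, pow_zero, Nat.cast_zero, mul_zero, neg_zero,
        unitRoot_zero, ← Int.cast_neg, unitRoot_intCast]
    have hshift : ∑ j ∈ range (orderOf g), x (j + 1) = ∑ j ∈ range (orderOf g), x j := by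
      have h := (sum_range_succ' x (orderOf g)).symm.trans (sum_range_succ x (orderOf g))
      rwa [hperiod, add_left_inj] at h
    rw [mem_sector, sectorProj_apply hn, map_smul, map_sum, sum_congr rfl fun j _ => hstep j,
      ← smul_sum, hshift, smul_comm]
  · rw [sectorProj_eq_zero hn]
    exact zero_mem _

lemma sectorProj_add_intCast (n : ℚ) (k : ℤ) : sectorProj g (n + k) = sectorProj g n := by
  by_cases hn : IsSectorIndex g n
  · ext a
    rw [sectorProj_apply hn, sectorProj_apply ((isSectorIndex_add_intCast k).mpr hn)]
    refine congrArg _ <| sum_congr rfl fun j _ => ?_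
    rw [show -((n + k) * (j : ℚ)) = -(n * j) + ((-k * j : ℤ) : ℚ) by push_cast; ring,
      unitRoot_add_intCast]
  · rw [sectorProj_eq_zero hn, sectorProj_eq_zero ((isSectorIndex_add_intCast k).not.mpr hn)]

lemma sectorProj_of_mem (hT : IsOfFinOrder g) (ha : a ∈ sector g n) : sectorProj g n a = a := by
  rcases eq_or_ne a 0 with rfl | h0
  · rw [map_zero]
  · have hterm : ∀ j ∈ range (orderOf g), unitRoot (-(n * j)) • (g ^ j) a = a := fun j _ => by
      rw [pow_apply_of_mem_sector ha, smul_smul, ← unitRoot_add, neg_add_cancel, unitRoot_zero,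
        one_smul]
    rw [sectorProj_apply (isSectorIndex_of_mem_sector ha h0), sum_congr rfl hterm, sum_const,
      card_range, ← Nat.cast_smul_eq_nsmul ℂ,
      inv_smul_smul₀ (Nat.cast_ne_zero.mpr hT.orderOf_pos.ne')]

lemma sectorProj_of_mem_of_ne (ha : a ∈ sector g m) (h : ∀ k : ℤ, n ≠ m + k) :
    sectorProj g n a = 0 := by
  by_cases hn : IsSectorIndex g n
  · rcases eq_or_ne a 0 with rfl | h0
    · rw [map_zero]
    obtain ⟨l, hl⟩ := isSectorIndex_of_mem_sector ha h0
    have ⟨k, hk⟩ := hn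
    have hterm : ∀ j ∈ range (orderOf g),
        unitRoot (-(n * j)) • (g ^ j) a = unitRoot (m - n) ^ j • a := fun j _ => by
      rw [pow_apply_of_mem_sector ha, smul_smul, ← unitRoot_add, unitRoot_pow]
      ring_nf
    rw [sectorProj_apply hn, sum_congr rfl hterm, ← Finset.sum_smul,
      geom_sum_unitRoot_eq_zero (fun i hi => h (-i) (by push_cast; linear_combination -hi))
        ⟨l - k, by push_cast; linear_combination hl - hk⟩, zero_smul, smul_zero]
  · rw [sectorProj_eq_zero hn, LinearMap.zero_apply]

lemma sum_sectorProj (hT : IsOfFinOrder g) (a : V) :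
    ∑ r ∈ range (orderOf g), sectorProj g ((r : ℚ) / orderOf g) a = a := by
  have hne : (orderOf g : ℚ) ≠ 0 := Nat.cast_ne_zero.mpr hT.orderOf_pos.ne'
  have horth : ∀ j ∈ range (orderOf g), j ≠ 0 →
      ∑ r ∈ range (orderOf g), unitRoot (-((r : ℚ) / orderOf g * j)) • (g ^ j) a = 0 := by
    intro j hj hj0
    have hterm : ∀ r ∈ range (orderOf g),
        unitRoot (-((r : ℚ) / orderOf g * j)) = unitRoot (-(j / orderOf g)) ^ r := fun r _ => by
      rw [unitRoot_pow]
      ring_nf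
    rw [← Finset.sum_smul, sum_congr rfl hterm, geom_sum_unitRoot_eq_zero _
      ⟨-j, by push_cast; field_simp⟩, zero_smul]
    intro k hk
    have hdvd : (orderOf g : ℤ) ∣ j := by
      refine ⟨-k, ?_⟩
      have : (j : ℚ) = orderOf g * -k := by rw [← hk]; field_simp
      exact_mod_cast this
    exact hj0 (Nat.eq_zero_of_dvd_of_lt (Int.natCast_dvd_natCast.mp hdvd) (mem_range.mp hj))
  calc
    ∑ r ∈ range (orderOf g), sectorProj g ((r : ℚ) / orderOf g) a
      = (orderOf g : ℂ)⁻¹ • ∑ r ∈ range (orderOf g), ∑ j ∈ range (orderOf g),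
          unitRoot (-((r : ℚ) / orderOf g * j)) • (g ^ j) a := by
        rw [smul_sum]
        exact sum_congr rfl fun r _ => sectorProj_apply (isSectorIndex_div hT r) a
    _ = (orderOf g : ℂ)⁻¹ • ∑ _r ∈ range (orderOf g), a := by
        rw [sum_comm, sum_eq_single_of_mem 0 (mem_range.mpr hT.orderOf_pos) horth]
        simp only [Nat.cast_zero, mul_zero, neg_zero, unitRoot_zero, one_smul, pow_zero,
          LinearEquiv.coe_one, id]
    _ = a := by
        rw [sum_const, card_range, ← Nat.cast_smul_eq_nsmul ℂ,
          inv_smul_smul₀ (Nat.cast_ne_zero.mpr hT.orderOf_pos.ne')]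

lemma mem_of_forall_sector_le (hT : IsOfFinOrder g) {P : Submodule ℂ V}
    (h : ∀ n, sector g n ≤ P) (a : V) : a ∈ P := by
  rw [← sum_sectorProj hT a]
  exact sum_mem fun r _ => h _ (sectorProj_mem _ _)

lemma mode_mem_sector [VertexOperatorAlgebra V] (hg : IsAutomorphism g) {b : V}
    (ha : a ∈ sector g m) (hb : b ∈ sector g n) (i : ℤ) : mode a i b ∈ sector g (m + n) := by
  rw [mem_sector] at *
  rw [hg.map_mode, ha, hb, mode_smul_left, map_smul, LinearMap.smul_apply, smul_smul,
    unitRoot_add, mul_comm]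

lemma sectorProj_mode [VertexOperatorAlgebra V] (hg : IsAutomorphism g) (hT : IsOfFinOrder g)
    (ha : a ∈ sector g m) (b : V) (i : ℤ) (n : ℚ) :
    sectorProj g (m + n) (mode a i b) = mode a i (sectorProj g n b) := by
  refine mem_of_forall_sector_le hT (P := LinearMap.eqLocus (sectorProj g (m + n) ∘ₗ mode a i)
    (mode a i ∘ₗ sectorProj g n)) (fun n' b hb => LinearMap.mem_eqLocus.mpr ?_) b
  have hab := mode_mem_sector hg ha hb i
  rw [LinearMap.comp_apply, LinearMap.comp_apply]
  by_cases h : ∃ k : ℤ, n = n' + k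
  · obtain ⟨k, rfl⟩ := h
    rw [← add_assoc, sectorProj_add_intCast, sectorProj_add_intCast, sectorProj_of_mem hT hb,
      sectorProj_of_mem hT hab]
  · push Not at h
    rw [sectorProj_of_mem_of_ne hb h, map_zero,
      sectorProj_of_mem_of_ne hab fun k hk => h k (by linarith)]

end Sectors

section RegularDual

variable {V : Type*} [AddCommGroup V] [Module ℂ V] [VertexOperatorAlgebra V]
  {g : V ≃ₗ[ℂ] V} {f : Module.Dual ℂ V} {a : V} {n : ℚ} {P J P' J' : ℤ}

/-- The functional `v ↦ f (Res_z (1+z)^{n+p} z^{-j} Y(a,z)v)`. -/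
def residueForm (n : ℚ) (p j : ℤ) : V →ₗ[ℂ] Module.Dual ℂ V →ₗ[ℂ] Module.Dual ℂ V :=
  Module.Dual.transpose ∘ₗ residue ((n : ℂ) + p) (-j)

lemma residueForm_apply (n : ℚ) (p j : ℤ) (a v : V) (f : Module.Dual ℂ V) :
    residueForm n p j a f v = f (residue ((n : ℂ) + p) (-j) a v) := rfl

lemma residueForm_add_intCast (n : ℚ) (l p j : ℤ) :
    residueForm (V := V) (n + l) p j = residueForm n (l + p) j := by
  simp only [residueForm]
  push_cast
  rw [add_assoc]

lemma residueForm_add_one (n : ℚ) (p j : ℤ) (a : V) (f : Module.Dual ℂ V) :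
    residueForm n (p + 1) (j + 1) a f =
      residueForm n p (j + 1) a f + residueForm n p j a f := by
  have h := residue_one_add_exponent ((n : ℂ) + p) (-(j + 1)) a
  rw [show 1 + ((n : ℂ) + p) = n + (p + 1 : ℤ) by push_cast; ring, neg_add, neg_add_cancel_right,
    ← neg_add] at h
  ext v
  rw [LinearMap.add_apply, residueForm_apply, residueForm_apply, residueForm_apply, ← map_add, h,
    LinearMap.add_apply]

/-- The form `f(Y(a,z)v)dz`, with exponents in `n + ℤ`, has bounded poles at `z = -1` and at
infinity, uniformly in `v`: the bounds are `P` and `J`. -/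
def IsBounded (f : Module.Dual ℂ V) (a : V) (n : ℚ) (P J : ℤ) : Prop :=
  ∀ p j : ℤ, P ≤ p → J ≤ j - p → residueForm n p j a f = 0

lemma IsBounded.mono (h : IsBounded f a n P J) (hP : P ≤ P') (hJ : J ≤ J') :
    IsBounded f a n P' J' :=
  fun p j hp hj => h p j (hP.trans hp) (hJ.trans hj)

lemma IsBounded.eventually (h : IsBounded f a n P J) : ∀ᶠ B in atTop, IsBounded f a n B B := by
  filter_upwards [eventually_ge_atTop P, eventually_ge_atTop J] with B hP hJ using h.mono hP hJ

/-- The functionals `f` on `V` for which all the forms `f(Y(a,z)v)dz` have bounded poles at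
`z = -1` and at infinity, uniformly in `v`. -/
def regularDual (g : V ≃ₗ[ℂ] V) : Submodule ℂ (Module.Dual ℂ V) where
  carrier := {f | ∀ n, ∀ a ∈ sector g n, ∀ᶠ B in atTop, IsBounded f a n B B}
  zero_mem' := fun _ _ _ => .of_forall fun _ _ _ _ _ => map_zero _
  add_mem' := fun hf hf' n a ha => by
    filter_upwards [hf n a ha, hf' n a ha] with B h h' p j hp hj
    rw [map_add, h p j hp hj, h' p j hp hj, add_zero]
  smul_mem' := fun c f hf n a ha => by
    filter_upwards [hf n a ha] with B h p j hp hj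
    rw [map_smul, h p j hp hj, smul_zero]

lemma jacobiSum_zero {E : Type*} [AddCommGroup E] [Module ℂ E] (x : ℤ → ℤ → E) (m n : ℤ) :
    jacobiSum 0 x m n = x m n := by
  rw [jacobiSum, finsum_eq_single _ 0 fun i hi => ?_]
  · simp
  · simp [Ring.choose_zero_pos ℂ (Nat.pos_of_ne_zero hi)]

lemma residue_commutator (a b v : V) (p q : ℤ) (α β : ℂ) :
    residue α p a (residue β q b v) - residue β q b (residue α p a v) =
      ∑ᶠ i : ℕ, ∑ x ∈ antidiagonal i, (Ring.choose α x.1 * Ring.choose (p : ℂ) x.2) •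
        residue (α + β - x.1) (p + q - x.2) (mode a i b) v := by
  simpa only [jacobiSum_zero, zpow_zero, one_smul, zero_add]
    using jacobiSum_residue_sub a b v 0 p q α β

lemma residueForm_mem_regularDual (hg : IsAutomorphism g) (hf : f ∈ regularDual g) {m : ℚ}
    (ha : a ∈ sector g m) (s k : ℤ) : residueForm m s k a f ∈ regularDual g := by
  intro n b hb
  obtain ⟨I, hI⟩ := eventually_atTop.mp
    (eventually_forall_add_natCast_le (eventually_mode_eq_zero a b) 0)
  have hmodes := (eventually_all_finset (range I)).mpr fun i _ =>
    hf (m + n) _ (mode_mem_sector hg ha hb i)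
  obtain ⟨B, hB, hBI⟩ := ((hf n b hb).and hmodes).exists
  refine IsBounded.eventually (P := max B (B - s + I)) (J := max B (B - k + s)) fun p j hp hj => ?_
  ext v
  have hcomm : residueForm n p j b (residueForm m s k a f) v -
      residueForm n p j b f (residue (m + s) (-k) a v) = f _ :=
    (map_sub f _ _).symm.trans
      (congrArg f (residue_commutator a b v (-k) (-j) ((m : ℂ) + s) ((n : ℂ) + p)))
  have hterm : ∀ i ∈ range I, ∀ x ∈ antidiagonal i,
      f (residue ((m : ℂ) + s + (n + p) - x.1) (-k + -j - x.2) (mode a i b) v) = 0 := by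
    intro i hi x hx
    have hi' := mem_range.mp hi
    have hx' := mem_antidiagonal.mp hx
    have h := LinearMap.congr_fun (hBI i hi (s + p - x.1) (k + j + x.2) (by lia) (by lia)) v
    rw [residueForm_apply, LinearMap.zero_apply] at h
    convert h using 5
    · push_cast
      ring
    · ring
  have hzero := LinearMap.congr_fun (hB p j (by lia) (by lia)) (residue ((m : ℂ) + s) (-k) a v)
  rw [hzero, LinearMap.zero_apply, sub_zero, finsum_eq_sum_range (N := I) fun i hi => sum_eq_zero
      fun x _ => by rw [hI i hi _ (by lia), map_zero, LinearMap.zero_apply, smul_zero],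
    map_sum] at hcomm
  refine hcomm.trans <| sum_eq_zero fun i hi => ?_
  rw [map_sum]
  exact sum_eq_zero fun x hx => by rw [map_smul, hterm i hi x hx, smul_zero]

end RegularDual

section Expansions

variable {E : Type*} [AddCommGroup E] [Module ℂ E] {μ μ' : ℤ → ℤ → E} {e e' : ℤ → E}

/-- For large `j - p`, the residues `μ p j` of a form against `(1+z)^p z^{-j}` are obtained by
expanding the form as `-∑ₖ eₖ y^{-k-1}` in powers of `y = 1 + z`, with finitely many negative
powers. -/
def IsExpansion (μ : ℤ → ℤ → E) (e : ℤ → E) : Prop :=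
  (∀ᶠ k in atTop, e k = 0) ∧ ∀ᶠ N : ℤ in atTop, ∀ p j : ℤ, N ≤ j - p →
    μ p j = (-(-1 : ℂ) ^ j) • act (negBinomialSeries (j : ℂ)) e p

lemma neg_neg_one_zpow_mul_self (j : ℤ) : (-(-1 : ℂ) ^ j) * (-(-1 : ℂ) ^ j) = 1 := by
  rw [neg_mul_neg, ← mul_zpow, neg_mul_neg, one_mul, one_zpow]

lemma neg_neg_one_zpow_ne_zero (j : ℤ) : (-(-1 : ℂ) ^ j) ≠ 0 :=
  left_ne_zero_of_mul_eq_one (neg_neg_one_zpow_mul_self j)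

lemma IsExpansion.unique (h : IsExpansion μ e) (h' : IsExpansion μ e') : e = e' := by
  obtain ⟨N, hN, hN'⟩ := (h.2.and h'.2).exists
  exact eq_of_act_negBinomialSeries_eq ℂ h.1 h'.1 N fun p j hj =>
    smul_right_injective E (neg_neg_one_zpow_ne_zero j) ((hN p j hj).symm.trans (hN' p j hj))

lemma isExpansion_zero : IsExpansion (fun _ _ => (0 : E)) fun _ => 0 :=
  ⟨.of_forall fun _ => rfl, .of_forall fun _ p j _ => by
    rw [act_eq_zero _ fun _ _ => rfl, smul_zero]⟩

lemma IsExpansion.add (h : IsExpansion μ e) (h' : IsExpansion μ' e') :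
    IsExpansion (fun p j => μ p j + μ' p j) fun k => e k + e' k := by
  refine ⟨?_, ?_⟩
  · filter_upwards [h.1, h'.1] with k hk hk'
    rw [hk, hk', add_zero]
  · filter_upwards [h.2, h'.2] with N hN hN' p j hj
    rw [hN p j hj, hN' p j hj, act_add_right h.1 p _ h'.1, smul_add]

lemma IsExpansion.smul (c : ℂ) (h : IsExpansion μ e) :
    IsExpansion (fun p j => c • μ p j) fun k => c • e k := by
  refine ⟨?_, ?_⟩
  · filter_upwards [h.1] with k hk
    rw [hk, smul_zero]
  · filter_upwards [h.2] with N hN p j hj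
    rw [hN p j hj, smul_comm]
    exact congrArg _ (map_act h.1 p (LinearMap.lsmul ℂ E c) _)

lemma IsExpansion.translate (h : IsExpansion μ e) (l : ℤ) :
    IsExpansion (fun p j => μ (p + l) j) fun k => e (k + l) := by
  refine ⟨tendsto_atTop_add_const_right _ l tendsto_id |>.eventually h.1, ?_⟩
  filter_upwards [tendsto_atTop_add_const_right _ (-l) tendsto_id |>.eventually h.2]
    with N hN p j hj
  rw [hN (p + l) j (by rw [id]; lia), act_translate]

end Expansions

section DualModes

variable {V : Type*} [AddCommGroup V] [Module ℂ V] [VertexOperatorAlgebra V]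
  {g : V ≃ₗ[ℂ] V} {f f' : Module.Dual ℂ V} {a : V} {m n : ℚ} {P J : ℤ}
  {e : ℤ → Module.Dual ℂ V}

lemma IsBounded.exists_expansion (h : IsBounded f a n P J) :
    ∃ e : ℤ → Module.Dual ℂ V, (∀ k, P ≤ k → e k = 0) ∧ ∀ p j : ℤ, J ≤ j - p →
      residueForm n p j a f = (-(-1 : ℂ) ^ j) • act (negBinomialSeries (j : ℂ)) e p := by
  have hrec : ∀ p j : ℤ, (-(-1 : ℂ) ^ j) • residueForm n p j a f =
      (-(-1 : ℂ) ^ (j + 1)) • residueForm n p (j + 1) a f -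
        (-(-1 : ℂ) ^ (j + 1)) • residueForm n (p + 1) (j + 1) a f := fun p j => by
    rw [residueForm_add_one, zpow_add_one₀ (by norm_num : (-1 : ℂ) ≠ 0)]
    module
  obtain ⟨e, he, hexp⟩ := VertexOperatorAlgebra.exists_expansion ℂ _ hrec P J
    fun p j hp hj => by rw [h p j hp hj, smul_zero]
  refine ⟨e, he, fun p j hj => ?_⟩
  rw [← hexp p j hj, smul_smul, neg_neg_one_zpow_mul_self, one_smul]

open Classical in
/-- The functional `aₙ f`, where `∑ₙ (aₙ f)(v) y^{-n-1}` is the expansion of `-f(Y(a,z)v)` in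
powers of `y = 1 + z`. It is the junk value `0` when there is no such expansion. -/
def dualMode (g : V ≃ₗ[ℂ] V) (a : V) (n : ℚ) (f : Module.Dual ℂ V) : Module.Dual ℂ V :=
  if h : ∃ e, IsExpansion (residueForm n · · (sectorProj g n a) f) e then h.choose 0 else 0

lemma IsExpansion.dualMode_add_intCast_eq
    (h : IsExpansion (residueForm n · · (sectorProj g n a) f) e) (k : ℤ) :
    dualMode g a (n + k) f = e k := by
  have htranslate := h.translate k
  simp only [← sectorProj_add_intCast n k, add_comm _ k, ← residueForm_add_intCast] at htranslate
  have hex : ∃ e, IsExpansion (residueForm (n + k) · · (sectorProj g (n + k) a) f) e :=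
    ⟨_, htranslate⟩
  rw [dualMode, dif_pos hex, hex.choose_spec.unique htranslate]
  exact congrArg e (add_zero k)

lemma IsExpansion.dualMode_eq (h : IsExpansion (residueForm n · · (sectorProj g n a) f) e) :
    dualMode g a n f = e 0 := by
  simpa using h.dualMode_add_intCast_eq 0

lemma IsBounded.dualMode_expansion (h : IsBounded f (sectorProj g n a) n P J) :
    (∀ k : ℤ, P ≤ k → dualMode g a (n + k) f = 0) ∧ ∀ p j : ℤ, J ≤ j - p →
      residueForm n p j (sectorProj g n a) f =
        (-(-1 : ℂ) ^ j) • act (negBinomialSeries (j : ℂ)) (fun k => dualMode g a (n + k) f) p := by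
  obtain ⟨e, he, hexp⟩ := h.exists_expansion
  have hexpansion : IsExpansion (residueForm n · · (sectorProj g n a) f) e :=
    ⟨eventually_atTop.mpr ⟨P, he⟩,
      eventually_atTop.mpr ⟨J, fun N hN p j hj => hexp p j (hN.trans hj)⟩⟩
  simpa only [hexpansion.dualMode_add_intCast_eq] using And.intro he hexp

lemma isExpansion_dualMode (hf : f ∈ regularDual g) (a : V) (n : ℚ) :
    IsExpansion (residueForm n · · (sectorProj g n a) f) fun k => dualMode g a (n + k) f := by
  obtain ⟨B, hB⟩ := (hf n _ (sectorProj_mem n a)).exists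
  have ⟨hzero, hexp⟩ := hB.dualMode_expansion
  exact ⟨eventually_atTop.mpr ⟨B, hzero⟩,
    eventually_atTop.mpr ⟨B, fun N hN p j hj => hexp p j (hN.trans hj)⟩⟩

lemma eventually_dualMode_eq_zero (hf : f ∈ regularDual g) (a : V) (n : ℚ) :
    ∀ᶠ k : ℤ in atTop, dualMode g a (n + k) f = 0 :=
  (isExpansion_dualMode hf a n).1

lemma dualMode_add (hf : f ∈ regularDual g) (hf' : f' ∈ regularDual g) (a : V) (n : ℚ) :
    dualMode g a n (f + f') = dualMode g a n f + dualMode g a n f' := by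
  have h := (isExpansion_dualMode hf a n).add (isExpansion_dualMode hf' a n)
  simp only [← map_add] at h
  simpa using h.dualMode_eq

lemma dualMode_smul (hf : f ∈ regularDual g) (c : ℂ) (a : V) (n : ℚ) :
    dualMode g a n (c • f) = c • dualMode g a n f := by
  have h := (isExpansion_dualMode hf a n).smul c
  simp only [← map_smul] at h
  simpa using h.dualMode_eq

lemma dualMode_add_left (hf : f ∈ regularDual g) (a b : V) (n : ℚ) :
    dualMode g (a + b) n f = dualMode g a n f + dualMode g b n f := by
  have h := (isExpansion_dualMode hf a n).add (isExpansion_dualMode hf b n)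
  simp only [← LinearMap.add_apply, ← map_add] at h
  simpa using h.dualMode_eq

lemma dualMode_smul_left (hf : f ∈ regularDual g) (c : ℂ) (a : V) (n : ℚ) :
    dualMode g (c • a) n f = c • dualMode g a n f := by
  have h := (isExpansion_dualMode hf a n).smul c
  simp only [← LinearMap.smul_apply, ← map_smul (residueForm _ _ _), ← map_smul (sectorProj _ _)]
    at h
  simpa using h.dualMode_eq

lemma dualMode_eq_zero (ha : a ∈ sector g m) (h : ∀ k : ℤ, n ≠ m + k) (f : Module.Dual ℂ V) :
    dualMode g a n f = 0 := by
  have hzero : IsExpansion (residueForm n · · (sectorProj g n a) f) fun _ => 0 := by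
    simpa only [sectorProj_of_mem_of_ne ha h, map_zero, LinearMap.zero_apply]
      using isExpansion_zero (E := Module.Dual ℂ V)
  exact hzero.dualMode_eq

lemma dualMode_mem (hg : IsAutomorphism g) (hf : f ∈ regularDual g) (a : V) (n : ℚ) :
    dualMode g a n f ∈ regularDual g := by
  obtain ⟨P, hP⟩ := eventually_atTop.mp (eventually_dualMode_eq_zero hf a n)
  obtain ⟨N, hN⟩ := (isExpansion_dualMode hf a n).2.exists
  -- Modulo the higher modes, the mode `n + p` is a residue.
  have hdown : ∀ k : ℕ, ∀ p, P - k ≤ p → dualMode g a (n + p) f ∈ regularDual g := by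
    intro k
    induction k with
    | zero =>
      intro p hp
      rw [hP p (by lia)]
      exact zero_mem _
    | succ k ih =>
      intro p hp
      have hact : act (negBinomialSeries ((p + N : ℤ) : ℂ)) (fun k : ℤ => dualMode g a (n + k) f) p
          ∈ regularDual g := by
        rw [← Submodule.smul_mem_iff _ (neg_neg_one_zpow_ne_zero (p + N)), ← hN p _ (by lia)]
        exact residueForm_mem_regularDual hg hf (sectorProj_mem n a) p _
      rw [act_eq_sum _ (N := k + 1) fun m hm => hP m (by lia), sum_range_succ',
        Submodule.add_mem_iff_right _ (sum_mem fun i _ => Submodule.smul_mem _ _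
          (ih (p + (i + 1 : ℕ)) (by lia)))] at hact
      simpa using hact
  simpa using hdown P.toNat 0 (by lia)

end DualModes

section DualJacobi

lemma map_finsum_of_eventually {E F : Type*} [AddCommGroup E] [Module ℂ E] [AddCommGroup F]
    [Module ℂ F] (φ : E →ₗ[ℂ] F) {x : ℕ → E} (h : ∀ᶠ i in atTop, x i = 0) :
    φ (∑ᶠ i, x i) = ∑ᶠ i, φ (x i) :=
  map_finsum φ (by rwa [← Nat.cofinite_eq_atTop] at h)

lemma finsum_apply_of_eventually {E F : Type*} [AddCommGroup E] [Module ℂ E] [AddCommGroup F]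
    [Module ℂ F] {φ : ℕ → E →ₗ[ℂ] F} (h : ∀ᶠ i in atTop, φ i = 0) (v : E) :
    (∑ᶠ i, φ i) v = ∑ᶠ i, φ i v :=
  map_finsum_of_eventually (LinearMap.applyₗ v) h

variable {V : Type*} [AddCommGroup V] [Module ℂ V] [VertexOperatorAlgebra V]
  {g : V ≃ₗ[ℂ] V} {f : Module.Dual ℂ V} {a b : V} {m₀ n₀ : ℚ}

lemma isExpansion_of_mem_sector (hT : IsOfFinOrder g) (hf : f ∈ regularDual g)
    (ha : a ∈ sector g n₀) :
    IsExpansion (residueForm n₀ · · a f) fun k => dualMode g a (n₀ + k) f := by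
  simpa only [sectorProj_of_mem hT ha] using isExpansion_dualMode hf a n₀

lemma dualMode_zero (a : V) (n : ℚ) : dualMode g a n 0 = 0 := by
  simpa only [zero_smul] using dualMode_smul (zero_mem (regularDual g)) 0 a n

lemma dualMode_zero_left (hf : f ∈ regularDual g) (n : ℚ) : dualMode g 0 n f = 0 := by
  simpa only [zero_smul] using dualMode_smul_left hf 0 0 n

lemma isIteratedLaurent_dualMode (hg : IsAutomorphism g) (hf : f ∈ regularDual g) (a b : V)
    (m₀ n₀ : ℚ) : IsIteratedLaurent fun k q : ℤ =>
      dualMode g a (m₀ + k) (dualMode g b (n₀ + q) f) :=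
  ⟨(eventually_dualMode_eq_zero hf b n₀).mono fun q hq k => by simp only [hq, dualMode_zero],
    fun q => eventually_dualMode_eq_zero (dualMode_mem hg hf b _) a m₀⟩

lemma eventually_residueForm_dualMode (hg : IsAutomorphism g) (hT : IsOfFinOrder g)
    (hf : f ∈ regularDual g) (ha : a ∈ sector g m₀) (b : V) (n₀ : ℚ) (n : ℤ) :
    ∀ᶠ N : ℤ in atTop, ∀ q, n ≤ q → ∀ p j : ℤ, N ≤ j - p →
      residueForm m₀ p j a (dualMode g b (n₀ + q) f) = (-(-1 : ℂ) ^ j) •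
        act (negBinomialSeries (j : ℂ))
          (fun k => dualMode g a (m₀ + k) (dualMode g b (n₀ + q) f)) p := by
  refine eventually_forall_ge_of_eventually
    (fun q => (isExpansion_of_mem_sector hT (dualMode_mem hg hf b _) ha).2) ?_ n
  filter_upwards [eventually_dualMode_eq_zero hf b n₀] with q hq N p j _
  simp only [hq, dualMode_zero, map_zero]
  rw [act_eq_zero _ fun _ _ => rfl, smul_zero]

lemma apply_finsum_smul_residue (hT : IsOfFinOrder g) (hf : f ∈ regularDual g)
    (hb : b ∈ sector g n₀) (l n : ℤ) : ∀ᶠ J in atTop, ∀ j', J ≤ j' →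
      ∀ (u : ℤ → V) (_ : ∀ᶠ p in atTop, u p = 0) (p : ℤ),
      f (∑ᶠ i : ℕ, ((-1 : ℂ) ^ (l + i) * Ring.choose (l : ℂ) i) •
        residue (n₀ + n) (-j' + l - i) b (u (p + i))) =
      (-(-1 : ℂ) ^ j') • ∑ᶠ r : ℕ, ((-1) ^ r * Ring.choose (l : ℂ) r) •
        act (negBinomialSeries (j' : ℂ)) (fun q => dualMode g b (n₀ + q) f) (n + r)
          (act (binomialSeries ℂ ((l : ℂ) - r)) u p) := by
  obtain ⟨N, hN⟩ := (isExpansion_of_mem_sector hT hf hb).2.exists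
  have hD := eventually_dualMode_eq_zero hf b n₀
  filter_upwards [eventually_ge_atTop (N + l + n)] with J hJ j' hj' u hu p
  have hfin : ∀ᶠ i : ℕ in atTop, u (p + i) = 0 := by
    filter_upwards [eventually_forall_add_natCast_le hu p] with i hi using hi _ le_rfl
  rw [← finsum_choose_smul_act_apply (eventually_act_eq_zero _ hD) hu, smul_finsum]
  rw [map_finsum_of_eventually f (hfin.mono fun i hi => by rw [hi, map_zero, smul_zero])]
  refine finsum_congr fun i => ?_
  have hres := LinearMap.congr_fun (hN n (j' - l + i) (by lia)) (u (p + i))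
  have hsign : (-1 : ℂ) ^ (l + i) * -(-1) ^ (j' - l + i) = -(-1) ^ j' := by
    rw [mul_neg, ← zpow_add₀ (by norm_num), show l + i + (j' - l + i) = j' + (i + i) by ring,
      zpow_add₀ (by norm_num), Even.neg_one_zpow (n := i + i) ⟨i, rfl⟩, mul_one]
  rw [← act_mul hD, ← negBinomialSeries_add, map_smul, show -j' + l - i = -(j' - l + i) by ring,
    ← residueForm_apply, hres, show ((j' - l + i : ℤ) : ℂ) = i - l + j' by push_cast; ring,
    LinearMap.smul_apply, smul_smul, smul_smul, ← hsign]
  congr 1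
  ring

lemma act_dualMode_act_residue (hg : IsAutomorphism g) (hT : IsOfFinOrder g)
    (hf : f ∈ regularDual g) (ha : a ∈ sector g m₀) (b : V) (n₀ : ℚ) (l m n : ℤ) :
    ∀ᶠ J : ℤ in atTop, ∀ j, J ≤ j → ∀ (d : ℂ⟦X⟧) (r : ℕ) (v : V),
      act d (fun q => dualMode g b (n₀ + q) f) (n + r)
        (act (binomialSeries ℂ ((l : ℂ) - r)) (fun p => residue (m₀ + m) p a v) (-j)) =
      (-(-1 : ℂ) ^ j) • act₂ (negBinomialSeries (j : ℂ)) d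
        (fun k q => dualMode g a (m₀ + k) (dualMode g b (n₀ + q) f)) (m + l - r) (n + r) v := by
  obtain ⟨N, hN⟩ := (eventually_residueForm_dualMode hg hT hf ha b n₀ n).exists
  have hx := isIteratedLaurent_dualMode hg hf a b m₀ n₀
  filter_upwards [eventually_ge_atTop (N + m + l)] with J hJ j hj d r v
  rw [← residue_add_exponent, show (l : ℂ) - r + (m₀ + m) = m₀ + (m + l - r : ℤ) by
    push_cast; ring, ← residueForm_apply, map_act (eventually_dualMode_eq_zero hf b n₀),
    act₂_swap _ _ hx.isQuadrantFinite,
    act_congr _ fun q hq => hN q (by lia) (m + l - r) j (by lia)]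
  exact LinearMap.congr_fun (map_act (hx.1.mono fun q hq => act_eq_zero _ fun k _ => hq k) _
    (LinearMap.lsmul ℂ _ (-(-1 : ℂ) ^ j)) _).symm v

lemma apply_jacobiSum_residue (hg : IsAutomorphism g) (hT : IsOfFinOrder g)
    (hf : f ∈ regularDual g) (ha : a ∈ sector g m₀) (hb : b ∈ sector g n₀) (l m n : ℤ) :
    ∀ᶠ J in atTop, ∀ j j' : ℤ, J ≤ j → J ≤ j' → ∀ v,
      (-1 : ℂ) ^ l * f (jacobiSum l (fun q p =>
        residue (n₀ + n) q b (residue (m₀ + m) p a v)) (-j') (-j)) =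
      (-1 : ℂ) ^ (j + j') * act₂ (negBinomialSeries (j : ℂ)) (negBinomialSeries (j' : ℂ))
        (jacobiSum l fun k q => dualMode g a (m₀ + k) (dualMode g b (n₀ + q) f)) m n v := by
  have hx := isIteratedLaurent_dualMode hg hf a b m₀ n₀
  filter_upwards [apply_finsum_smul_residue hT hf hb l n,
    act_dualMode_act_residue hg hT hf ha b n₀ l m n] with J hJ hterm j j' hj hj' v
  have hfin : ∀ᶠ r : ℕ in atTop, act₂ (negBinomialSeries (j : ℂ)) (negBinomialSeries (j' : ℂ))
        (fun k q => dualMode g a (m₀ + k) (dualMode g b (n₀ + q) f)) (m + l - r) (n + r) = 0 := by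
    filter_upwards [eventually_forall_add_natCast_le hx.1 n] with r hr
    exact act₂_eq_zero _ _ fun k q _ hq => hr q hq k
  rw [← smul_eq_mul, ← map_smul, neg_one_zpow_smul_jacobiSum,
    hJ j' hj' _ (eventually_residue_eq_zero _ a v), finsum_congr fun r => by rw [hterm j hj],
    act₂_jacobiSum hx, jacobiSum,
    finsum_apply_of_eventually (hfin.mono fun r hr => by rw [hr, smul_zero]), ← smul_eq_mul,
    smul_finsum, smul_finsum]
  refine finsum_congr fun r => ?_
  rw [LinearMap.smul_apply, smul_comm _ (-(-1 : ℂ) ^ j), smul_smul, zpow_add₀ (by norm_num),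
    neg_mul_neg, mul_comm ((-1 : ℂ) ^ j')]

lemma eventually_forall_dualMode_mode_eq_zero (hf : f ∈ regularDual g) (a b : V) (l : ℤ) :
    ∀ᶠ i : ℕ in atTop, ∀ n, dualMode g (mode a (l + i) b) n f = 0 := by
  filter_upwards [eventually_forall_add_natCast_le (eventually_mode_eq_zero a b) l] with i hi n
  rw [hi _ le_rfl, dualMode_zero_left hf]

lemma eventually_residueForm_mode (hg : IsAutomorphism g) (hT : IsOfFinOrder g)
    (hf : f ∈ regularDual g) (ha : a ∈ sector g m₀) (hb : b ∈ sector g n₀) (l : ℤ) :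
    ∀ᶠ N : ℤ in atTop, ∀ q, l ≤ q → ∀ p j : ℤ, N ≤ j - p →
      residueForm (m₀ + n₀) p j (mode a q b) f = (-(-1 : ℂ) ^ j) •
        act (negBinomialSeries (j : ℂ))
          (fun k => dualMode g (mode a q b) (m₀ + n₀ + k) f) p := by
  refine eventually_forall_ge_of_eventually
    (fun q => (isExpansion_of_mem_sector hT hf (mode_mem_sector hg ha hb q)).2) ?_ l
  filter_upwards [eventually_mode_eq_zero a b] with q hq N p j _
  simp only [hq, dualMode_zero_left hf, map_zero, LinearMap.zero_apply]
  rw [act_eq_zero _ fun _ _ => rfl, smul_zero]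

lemma apply_residue_mode (hg : IsAutomorphism g) (hT : IsOfFinOrder g)
    (hf : f ∈ regularDual g) (ha : a ∈ sector g m₀) (hb : b ∈ sector g n₀) (l m n : ℤ) :
    ∀ᶠ J in atTop, ∀ j j' : ℤ, J ≤ j → J ≤ j' → ∀ v,
      f (∑ᶠ i : ℕ, ∑ x ∈ antidiagonal i,
        (Ring.choose ((m₀ : ℂ) + m) x.1 * Ring.choose ((-j : ℤ) : ℂ) x.2) •
          residue (m₀ + m + (n₀ + n) - x.1) (-j + -j' - x.2) (mode a (l + i) b) v) =
      -(-1 : ℂ) ^ (j + j') * act₂ (negBinomialSeries (j : ℂ)) (negBinomialSeries (j' : ℂ))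
        (iterateSum m₀ fun i k => dualMode g (mode a (l + i) b) (m₀ + n₀ + k) f) m n v := by
  obtain ⟨N, hN⟩ := (eventually_residueForm_mode hg hT hf ha hb l).exists
  have hmode := eventually_forall_add_natCast_le (eventually_mode_eq_zero a b) l
  have hdual := eventually_forall_dualMode_mode_eq_zero hf a b l
  filter_upwards [eventually_ge_atTop (max 0 (N + m + n))] with J hJ j j' hj hj' v
  have hres (i x y : ℕ) : f (residue (m₀ + m + (n₀ + n) - x) (-j + -j' - y)
      (mode a (l + i) b) v) = (-(-1 : ℂ) ^ (j + j' + y)) *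
        act (negBinomialSeries ((j : ℂ) + j' + y))
          (fun k => dualMode g (mode a (l + i) b) (m₀ + n₀ + k) f) (m + n - x) v := by
    have h := LinearMap.congr_fun (hN (l + i) (by lia) (m + n - x) (j + j' + y) (by lia)) v
    rw [residueForm_apply, LinearMap.smul_apply, smul_eq_mul] at h
    convert h using 4 <;> push_cast <;> ring_nf
  rw [map_finsum_of_eventually f (hmode.mono fun i hi => sum_eq_zero fun x _ => by
      rw [hi _ le_rfl, map_zero, LinearMap.zero_apply, smul_zero]),
    act₂_negBinomialSeries_iterateSum (hdual.mono fun i hi k => hi _)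
      (fun i => eventually_dualMode_eq_zero hf _ _),
    finsum_apply_of_eventually (hdual.mono fun i hi => sum_eq_zero fun x _ => by
      rw [act_eq_zero _ fun k _ => hi _, smul_zero]), ← smul_eq_mul, smul_finsum]
  refine finsum_congr fun i => ?_
  rw [map_sum, LinearMap.sum_apply, smul_sum]
  refine sum_congr rfl fun x _ => ?_
  rw [map_smul, hres, LinearMap.smul_apply, zpow_add₀ (by norm_num) (j + j'), zpow_natCast]
  push_cast
  simp only [smul_eq_mul]
  ring

lemma dual_jacobi (hg : IsAutomorphism g) (hT : IsOfFinOrder g)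
    (hf : f ∈ regularDual g) (ha : a ∈ sector g m₀) (hb : b ∈ sector g n₀) (l m n : ℤ) :
    jacobiSum l (fun k q => dualMode g a (m₀ + k) (dualMode g b (n₀ + q) f)) m n -
      (-1 : ℂ) ^ l • jacobiSum l (fun q k => dualMode g b (n₀ + q) (dualMode g a (m₀ + k) f)) n m =
    iterateSum m₀ (fun i k => dualMode g (mode a (l + i) b) (m₀ + n₀ + k) f) m n := by
  have hab := isQuadrantFinite_jacobiSum (isIteratedLaurent_dualMode hg hf a b m₀ n₀) l
  have hba := isQuadrantFinite_jacobiSum (isIteratedLaurent_dualMode hg hf b a n₀ m₀) l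
  have hba' := hba.swap.smul fun _ => (-1 : ℂ) ^ l
  have hiter : IsQuadrantFinite
      (iterateSum (m₀ : ℂ) fun i k => dualMode g (mode a (l + i) b) (m₀ + n₀ + k) f) :=
    isQuadrantFinite_iterateSum
      ((eventually_forall_dualMode_mode_eq_zero hf a b l).mono fun i hi k => hi _)
      (fun i => eventually_dualMode_eq_zero hf _ _) m₀
  rw [← sub_eq_zero]
  refine eq_zero_of_act₂_eq_zero (R := ℂ) ((hab.sub hba').sub hiter) (fun m n => ?_) m n
  obtain ⟨j, hjab, hjba, hjmode⟩ := ((apply_jacobiSum_residue hg hT hf ha hb l m n).and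
    ((apply_jacobiSum_residue hg hT hf hb ha l n m).and
      (apply_residue_mode hg hT hf ha hb l m n))).exists
  refine ⟨negBinomialSeries (j : ℂ), negBinomialSeries (j : ℂ), by simp, by simp, ?_⟩
  rw [act₂_sub _ _ (hab.sub hba') hiter, act₂_sub _ _ hab hba', act₂_smul _ _ hba.swap,
    act₂_swap _ _ hba.swap]
  ext v
  have hjacobi := congrArg f (jacobiSum_residue_sub a b v l (-j) (-j) (m₀ + m) (n₀ + n))
  rw [map_sub, hjmode j j le_rfl le_rfl, map_smul, smul_eq_mul, hjab j j le_rfl le_rfl] at hjacobi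
  have hswap := hjba j j le_rfl le_rfl v
  refine mul_left_cancel₀ (zpow_ne_zero (j + j) (neg_ne_zero.mpr one_ne_zero) :
    (-1 : ℂ) ^ (j + j) ≠ 0) ?_
  simp only [LinearMap.sub_apply, LinearMap.smul_apply, LinearMap.zero_apply, smul_eq_mul]
  have hsq : (-1 : ℂ) ^ l * (-1) ^ l = 1 := by rw [← mul_zpow, neg_mul_neg, one_mul, one_zpow]
  linear_combination (-1 : ℂ) * hjacobi + (-1 : ℂ) ^ l * hswap -
    f (jacobiSum l (fun p q => residue (m₀ + m) p a (residue (n₀ + n) q b v)) (-j) (-j)) * hsq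

end DualJacobi

section RegularModule

variable {V : Type*} [AddCommGroup V] [Module ℂ V] [VertexOperatorAlgebra V]
  {g : V ≃ₗ[ℂ] V} {f : Module.Dual ℂ V} {a : V} {m n : ℚ}

lemma vacuum_mem_sector (hg : IsAutomorphism g) : (vacuum : V) ∈ sector g 0 := by
  rw [mem_sector, hg.map_vacuum, unitRoot_zero, one_smul]

lemma mode_vacuum (n : ℤ) : mode (vacuum : V) n = if n = -1 then 1 else 0 := vacuum_mode n

lemma residue_vacuum (α : ℂ) (i : ℕ) (v : V) :
    residue α (-1 - i) vacuum v = Ring.choose α i • v := by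
  have hsum := act_eq_sum (binomialSeries ℂ α) (x := fun n => mode vacuum n v) (p := -1 - i)
    (N := i + 1) fun n hn => by rw [mode_vacuum, if_neg (by lia), LinearMap.zero_apply]
  rw [residue_apply, hsum, sum_range_succ, sum_eq_zero fun k hk => ?_, zero_add,
    PowerSeries.binomialSeries_coeff, mode_vacuum, if_pos (by ring), smul_eq_mul, mul_one,
    Module.End.one_apply]
  rw [mode_vacuum, if_neg (by rw [mem_range] at hk; lia), LinearMap.zero_apply, smul_zero]

lemma residueForm_vacuum_of_nonpos (f : Module.Dual ℂ V) (n : ℚ) (p : ℤ) {j : ℤ} (hj : j ≤ 0) :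
    residueForm n p j vacuum f = 0 := by
  ext v
  rw [residueForm_apply, residue_eq_zero fun k hk => by
    rw [mode_vacuum, if_neg (by lia), LinearMap.zero_apply], map_zero, LinearMap.zero_apply]

lemma residueForm_vacuum (f : Module.Dual ℂ V) (n : ℚ) (p : ℤ) (i : ℕ) :
    residueForm n p (1 + i) vacuum f = Ring.choose ((n : ℂ) + p) i • f := by
  ext v
  rw [residueForm_apply, neg_add', residue_vacuum, map_smul, LinearMap.smul_apply]

lemma isBounded_vacuum (f : Module.Dual ℂ V) : IsBounded f vacuum 0 0 2 := by
  intro p j hp hj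
  lift p to ℕ using hp
  obtain ⟨i, rfl⟩ : ∃ i : ℕ, j = 1 + i := ⟨(j - 1).toNat, by lia⟩
  rw [residueForm_vacuum, Rat.cast_zero, zero_add, Int.cast_natCast, Ring.choose_natCast,
    Nat.choose_eq_zero_of_lt (by lia), Nat.cast_zero, zero_smul]

lemma dualMode_vacuum (hg : IsAutomorphism g) (hT : IsOfFinOrder g) (f : Module.Dual ℂ V) (n : ℚ) :
    dualMode g vacuum n f = if n = -1 then f else 0 := by
  by_cases hn : ∃ k : ℤ, n = 0 + k
  · obtain ⟨k, rfl⟩ := hn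
    have hbounded := isBounded_vacuum f
    rw [← sectorProj_of_mem hT (vacuum_mem_sector hg)] at hbounded
    obtain ⟨hzero, hexp⟩ := hbounded.dualMode_expansion
    rw [sectorProj_of_mem hT (vacuum_mem_sector hg)] at hexp
    rcases lt_trichotomy k (-1) with hk | rfl | hk
    · have h := hexp k 0 (by lia)
      rw [residueForm_vacuum_of_nonpos _ _ _ le_rfl, Int.cast_zero, negBinomialSeries_zero,
        act_one (eventually_atTop.mpr ⟨0, hzero⟩), zpow_zero, neg_one_smul, zero_eq_neg] at h
      rw [h, zero_add, if_neg (by exact_mod_cast hk.ne)]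
    · have h := hexp (-1) 1 (by lia)
      rw [act_eq_sum _ (N := 1) fun m hm => hzero m (by lia), sum_range_one] at h
      have hvac := residueForm_vacuum f 0 (-1) 0
      rw [Nat.cast_zero, add_zero, h] at hvac
      simpa using hvac
    · rw [hzero k (by lia), zero_add, if_neg (by exact_mod_cast hk.ne')]
  · push Not at hn
    rw [dualMode_eq_zero (vacuum_mem_sector hg) hn, if_neg]
    rintro rfl
    exact hn (-1) (by norm_num)

lemma dualMode_sectorProj (hT : IsOfFinOrder g) (a : V) (n : ℚ) (f : Module.Dual ℂ V) (k : ℤ) :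
    dualMode g (sectorProj g n a) (n + k) f = dualMode g a (n + k) f := by
  rw [dualMode, dualMode, sectorProj_add_intCast, sectorProj_of_mem hT (sectorProj_mem n a)]

lemma dualMode_eq_zero_of_not_isSectorIndex (hT : IsOfFinOrder g) (hf : f ∈ regularDual g)
    (a : V) (hn : ¬IsSectorIndex g n) : dualMode g a n f = 0 := by
  have h := dualMode_sectorProj hT a n f 0
  rwa [sectorProj_eq_zero hn, LinearMap.zero_apply, dualMode_zero_left hf, Int.cast_zero,
    add_zero, eq_comm] at h

lemma eventually_dualMode_rat_eq_zero (hT : IsOfFinOrder g) (hf : f ∈ regularDual g) (a : V) :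
    ∀ᶠ l : ℚ in atTop, dualMode g a l f = 0 := by
  obtain ⟨K, hK⟩ := ((eventually_all_finset (range (orderOf g))).mpr fun r _ =>
    eventually_forall_ge_atTop.mpr
      (eventually_dualMode_eq_zero hf a ((r : ℚ) / orderOf g))).exists
  filter_upwards [eventually_ge_atTop ((K : ℚ) + 1)] with l hl
  by_cases hl' : IsSectorIndex g l
  · obtain ⟨r, k, hr, rfl⟩ := hl'.exists_eq_div_add hT
    have hlt : (r : ℚ) / orderOf g < 1 :=
      (div_lt_one (Nat.cast_pos.mpr hT.orderOf_pos)).mpr (Nat.cast_lt.mpr hr)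
    exact hK r (mem_range.mpr hr) k (by exact_mod_cast (by linarith : (K : ℚ) ≤ k))
  · exact dualMode_eq_zero_of_not_isSectorIndex hT hf a hl'

lemma dualMode_jacobi (hg : IsAutomorphism g) (hT : IsOfFinOrder g) (hf : f ∈ regularDual g)
    (ha : a ∈ sector g m) (l : ℤ) (n : ℚ) (b : V) :
    (∑ᶠ i : ℕ, ((-1 : ℂ) ^ i * Ring.choose (l : ℂ) i) •
        dualMode g a (m + l - i) (dualMode g b (n + i) f))
      - (∑ᶠ i : ℕ, ((-1 : ℂ) ^ (l + i) * Ring.choose (l : ℂ) i) •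
        dualMode g b (n + l - i) (dualMode g a (m + i) f))
      = ∑ᶠ i : ℕ, Ring.choose (m : ℂ) i • dualMode g (mode a (l + i) b) (m + n - i) f := by
  have h := dual_jacobi hg hT hf ha (sectorProj_mem n b) l 0 0
  rw [neg_one_zpow_smul_jacobiSum, jacobiSum, iterateSum] at h
  simp only [dualMode_sectorProj hT, ← sectorProj_mode hg hT ha] at h
  push_cast at h
  simpa only [zero_add, add_zero, add_sub_assoc, zero_sub, ← sub_eq_add_neg] using h

/-- The mode `aₙ` acting on the regular dual. -/
def regularMode (hg : IsAutomorphism g) : V →ₗ[ℂ] (ℚ → Module.End ℂ (regularDual g)) where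
  toFun a n :=
    { toFun f := ⟨dualMode g a n f, dualMode_mem hg f.2 a n⟩
      map_add' f f' := Subtype.ext (dualMode_add f.2 f'.2 a n)
      map_smul' c f := Subtype.ext (dualMode_smul f.2 c a n) }
  map_add' a b := funext fun n => LinearMap.ext fun f => Subtype.ext (dualMode_add_left f.2 a b n)
  map_smul' c a := funext fun n => LinearMap.ext fun f => Subtype.ext (dualMode_smul_left f.2 c a n)

lemma coe_regularMode (hg : IsAutomorphism g) (a : V) (n : ℚ) (f : regularDual g) :
    (regularMode hg a n f : Module.Dual ℂ V) = dualMode g a n f := rfl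

lemma coe_finsum {E : Type*} [AddCommGroup E] [Module ℂ E] {W : Submodule ℂ E} (x : ℕ → W) :
    ((∑ᶠ i, x i : W) : E) = ∑ᶠ i, (x i : E) :=
  AddMonoidHom.map_finsum_of_injective W.subtype.toAddMonoidHom W.subtype_injective x

/-- The weak `g`-twisted module structure on the regular dual. -/
def regularModule (hg : IsAutomorphism g) (hT : IsOfFinOrder g) :
    WeakTwistedModule g (regularDual g) where
  mode := regularMode hg
  mode_eq_zero r _ a ha n hn := by
    rw [twistedSector_eq_sector] at ha
    exact LinearMap.ext fun f => Subtype.ext (dualMode_eq_zero ha hn f)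
  truncation a f := by
    obtain ⟨N, hN⟩ := eventually_atTop.mp (eventually_dualMode_rat_eq_zero hT f.2 a)
    exact ⟨N, fun l hl => Subtype.ext (hN l hl)⟩
  vacuum_mode n := by
    refine LinearMap.ext fun f => Subtype.ext ?_
    rw [coe_regularMode, dualMode_vacuum hg hT]
    split_ifs <;> rfl
  jacobi r _ a ha b f l k m n hm := by
    have ham : a ∈ sector g m := by rwa [hm, sector_add_intCast, ← twistedSector_eq_sector]
    refine Subtype.ext ?_
    simp only [Submodule.coe_sub, coe_finsum, Submodule.coe_smul, coe_regularMode, intCast_choose]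
    exact dualMode_jacobi hg hT f.2 ham l n b

end RegularModule

section Weights

lemma finsum_mul_choose_zero_smul {E : Type*} [AddCommGroup E] [Module ℂ E] (c : ℕ → ℂ)
    (x : ℕ → E) : ∑ᶠ i, (c i * Ring.choose ((0 : ℤ) : ℂ) i) • x i = c 0 • x 0 := by
  rw [finsum_eq_single _ 0 fun i hi => ?_, Ring.choose_zero_right, mul_one]
  rw [Int.cast_zero, Ring.choose_zero_pos ℂ (Nat.pos_of_ne_zero hi), mul_zero, zero_smul]

lemma finsum_choose_one_smul {E : Type*} [AddCommGroup E] [Module ℂ E] (x : ℕ → E) :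
    ∑ᶠ i, Ring.choose (1 : ℂ) i • x i = x 0 + x 1 := by
  have hzero : ∀ i, 2 ≤ i → Ring.choose (1 : ℂ) i = 0 := fun i hi => by
    rw [← Nat.cast_one, Ring.choose_natCast, Nat.choose_eq_zero_of_lt hi, Nat.cast_zero]
  rw [finsum_eq_sum_range (N := 2) fun i hi => by rw [hzero i hi, zero_smul], sum_range_succ,
    sum_range_one, Ring.choose_zero_right, Ring.choose_one_right, one_smul, one_smul]

variable {V : Type*} [AddCommGroup V] [Module ℂ V] [VertexOperatorAlgebra V] {u v : V} {d e : ℤ}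

lemma mem_weightSpace : u ∈ weightSpace V d ↔ mode omega 1 u = (d : ℂ) • u :=
  Module.End.mem_eigenspace_iff

lemma mode_omega_zero (u : V) (n : ℤ) :
    mode (mode omega 0 u) n = (-(n : ℂ)) • mode u (n - 1) := derivative u n

lemma mode_neg_one_vacuum (u : V) : mode u (-1) vacuum = u := creation u

lemma mode_vacuum_of_nonneg (u : V) {n : ℤ} (hn : 0 ≤ n) : mode u n vacuum = 0 :=
  creation_of_nonneg u n hn

lemma mode_neg_two_vacuum (u : V) : mode u (-2) vacuum = mode omega 0 u := by
  have h := LinearMap.congr_fun (mode_omega_zero u (-1)) vacuum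
  rwa [mode_neg_one_vacuum, Int.cast_neg, Int.cast_one, neg_neg, one_smul, eq_comm] at h

lemma mode_commutator (u v w : V) (m n : ℤ) : mode u m (mode v n w) - mode v n (mode u m w) =
    ∑ᶠ i : ℕ, Ring.choose (m : ℂ) i • mode (mode u i v) (m + n - i) w := by
  have h := jacobi u v w 0 m n
  simp only [intCast_choose, finsum_mul_choose_zero_smul] at h
  simpa only [mode, pow_zero, Nat.cast_zero, zpow_zero, add_zero, sub_zero, zero_add,
    one_smul] using h

lemma mode_mem_weightSpace (hu : u ∈ weightSpace V d) (hv : v ∈ weightSpace V e) (n : ℤ) :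
    mode u n v ∈ weightSpace V (d + e - n - 1) := by
  rw [mem_weightSpace] at *
  have h := mode_commutator omega u v 1 n
  rw [Int.cast_one, finsum_choose_one_smul, hv, Nat.cast_zero, Nat.cast_one, hu, mode_omega_zero,
    mode_smul_left, sub_zero, add_sub_cancel_left, sub_eq_iff_eq_add] at h
  rw [h]
  simp only [LinearMap.smul_apply, map_smul]
  push_cast
  module

lemma vacuum_mem_weightSpace : (vacuum : V) ∈ weightSpace V 0 := by
  rw [mem_weightSpace, mode_vacuum_of_nonneg _ zero_le_one, Int.cast_zero, zero_smul]

lemma omega_mem_weightSpace : (omega : V) ∈ weightSpace V 2 := by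
  have h := virasoro 0 (-2) (vacuum : V)
  change mode omega (0 + 1) (mode omega (-2 + 1) vacuum) -
    mode omega (-2 + 1) (mode omega (0 + 1) vacuum) = _ • mode omega (0 + -2 + 1) vacuum + _ at h
  norm_num at h
  rw [mode_neg_one_vacuum, mode_vacuum_of_nonneg _ zero_le_one, map_zero, sub_zero] at h
  rw [mem_weightSpace, h, Int.cast_ofNat]

lemma omega_mem_sector {g : V ≃ₗ[ℂ] V} (hg : IsAutomorphism g) (k : ℤ) :
    (omega : V) ∈ sector g k := by
  rw [← zero_add (k : ℚ), sector_add_intCast, mem_sector, hg.map_omega, unitRoot_zero, one_smul]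

end Weights

section Finsum

variable {E : Type*} [AddCommGroup E] [Module ℂ E] {W : Submodule ℂ E} {x : ℕ → E}

lemma finsum_mem_submodule (h : ∀ i, x i ∈ W) : ∑ᶠ i, x i ∈ W :=
  finsum_induction (· ∈ W) W.zero_mem (fun _ _ => W.add_mem) h

lemma apply_zero_mem_of_finsum_mem (hx : ∀ᶠ i in atTop, x i = 0) (htail : ∀ i, 0 < i → x i ∈ W)
    (hsum : ∑ᶠ i, x i ∈ W) : x 0 ∈ W := by
  rw [← W.ker_mkQ, LinearMap.mem_ker] at hsum ⊢
  rwa [map_finsum_of_eventually _ hx, finsum_eq_single _ 0 fun i hi => ?_] at hsum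
  rw [← LinearMap.mem_ker, W.ker_mkQ]
  exact htail i (Nat.pos_of_ne_zero hi)

lemma forall_of_eventually_of_forall_gt {P : ℕ → Prop} (hP : ∀ᶠ i in atTop, P i)
    (h : ∀ i, (∀ j, i < j → P j) → P i) (i : ℕ) : P i := by
  obtain ⟨N, hN⟩ := eventually_atTop.mp hP
  have key : ∀ s i, N ≤ i + s → P i := fun s => by
    induction s with
    | zero => exact hN
    | succ s ih => exact fun i hi => h i fun j hj => ih j (by lia)
  exact key N i (by lia)

lemma tendsto_const_add_natCast {R : Type*} [Ring R] [LinearOrder R] [IsStrictOrderedRing R]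
    [Archimedean R] (n : R) : Tendsto (fun i : ℕ => n + i) atTop atTop :=
  tendsto_atTop_add_const_left _ n tendsto_natCast_atTop_atTop

lemma tendsto_const_sub_natCast {R : Type*} [Ring R] [LinearOrder R] [IsStrictOrderedRing R]
    [Archimedean R] (n : R) : Tendsto (fun i : ℕ => n - i) atTop atBot := by
  simpa only [sub_eq_add_neg] using tendsto_atBot_add_const_left _ n
    (tendsto_neg_atBot_iff.mpr tendsto_natCast_atTop_atTop)

end Finsum

namespace WeakTwistedModule

variable {V : Type u} [AddCommGroup V] [Module ℂ V] [VertexOperatorAlgebra V]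
  {g : V ≃ₗ[ℂ] V} {M : Type u} [AddCommGroup M] [Module ℂ M] (X : WeakTwistedModule g M)
  {a u : V} {m n : ℚ}

lemma mode_zero_left (n : ℚ) : X.mode 0 n = 0 := by rw [map_zero, Pi.zero_apply]

lemma mode_smul_left (c : ℂ) (u : V) (n : ℚ) : X.mode (c • u) n = c • X.mode u n := by
  rw [map_smul, Pi.smul_apply]

lemma mode_eq_zero_of_mem_sector (hT : IsOfFinOrder g) (hu : u ∈ sector g m)
    (hn : ∀ k : ℤ, n ≠ m + k) : X.mode u n = 0 := by
  rcases eq_or_ne u 0 with rfl | h0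
  · exact X.mode_zero_left n
  · obtain ⟨r, k, hr, hur, rfl⟩ := exists_mem_twistedSector hT hu h0
    exact X.mode_eq_zero r hr u hur n fun l hl => hn (l - k) (by rw [hl]; push_cast; ring)

lemma eventually_mode_eq_zero (v : V) (w : M) : ∀ᶠ n in atTop, X.mode v n w = 0 :=
  eventually_atTop.mpr (X.truncation v w)

lemma eventually_mode_add_natCast_eq_zero (v : V) (w : M) (n : ℚ) :
    ∀ᶠ i : ℕ in atTop, X.mode v (n + i) w = 0 :=
  (tendsto_const_add_natCast n).eventually (X.eventually_mode_eq_zero v w)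

lemma eventually_mode_mode_eq_zero (a b : V) (l : ℤ) :
    ∀ᶠ i : ℕ in atTop, ∀ n, X.mode (VertexOperatorAlgebra.mode a (l + i) b) n = 0 := by
  filter_upwards [(tendsto_const_add_natCast l).eventually
    (VertexOperatorAlgebra.eventually_mode_eq_zero a b)] with i hi n
  rw [hi, mode_zero_left]

lemma jacobi_of_mem_sector (hT : IsOfFinOrder g) (hu : u ∈ sector g m) (v : V) (w : M) (l : ℤ)
    (n : ℚ) :
    (∑ᶠ i : ℕ, ((-1 : ℂ) ^ i * Ring.choose (l : ℂ) i) •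
        X.mode u (m + l - i) (X.mode v (n + i) w))
      - (∑ᶠ i : ℕ, ((-1 : ℂ) ^ (l + i) * Ring.choose (l : ℂ) i) •
        X.mode v (n + l - i) (X.mode u (m + i) w))
      = ∑ᶠ i : ℕ, Ring.choose (m : ℂ) i •
        X.mode (VertexOperatorAlgebra.mode u (l + i) v) (m + n - i) w := by
  rcases eq_or_ne u 0 with rfl | h0
  · simp only [mode_zero_left, VertexOperatorAlgebra.mode_zero_left, LinearMap.zero_apply,
      map_zero, smul_zero, finsum_zero, sub_zero]
  · obtain ⟨r, k, hr, hur, hm⟩ := exists_mem_twistedSector hT hu h0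
    simpa only [intCast_choose] using X.jacobi r hr u hur v w l k m n hm

lemma mode_commutator (hT : IsOfFinOrder g) (hu : u ∈ sector g m) (v : V) (w : M) (n : ℚ) :
    X.mode u m (X.mode v n w) - X.mode v n (X.mode u m w) = ∑ᶠ i : ℕ, Ring.choose (m : ℂ) i •
      X.mode (VertexOperatorAlgebra.mode u i v) (m + n - i) w := by
  have h := X.jacobi_of_mem_sector hT hu v w 0 n
  simp only [finsum_mul_choose_zero_smul] at h
  simpa only [pow_zero, Nat.cast_zero, Int.cast_zero, zpow_zero, add_zero, sub_zero, zero_add,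
    one_smul] using h

lemma mode_omega_zero_of_mem_sector (hT : IsOfFinOrder g) (hu : u ∈ sector g m) :
    X.mode (VertexOperatorAlgebra.mode omega 0 u) m = (-(m : ℂ)) • X.mode u (m - 1) := by
  ext w
  have hvac : ∀ i : ℕ, X.mode vacuum (0 + i) = 0 := fun i => by
    rw [X.vacuum_mode, if_neg (by linarith [i.cast_nonneg (α := ℚ)])]
  have hvac' : ∀ i : ℕ, X.mode vacuum (0 + (-2 : ℤ) - i) = 0 := fun i => by
    rw [X.vacuum_mode, if_neg fun h => by
      have : (i : ℚ) = ((-1 : ℤ) : ℚ) := by push_cast at h ⊢; linarith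
      have : (i : ℤ) = -1 := by exact_mod_cast this
      lia]
  have h := X.jacobi_of_mem_sector hT hu vacuum w (-2) 0
  simp only [hvac, hvac', LinearMap.zero_apply, map_zero, smul_zero, finsum_zero, sub_zero] at h
  rw [finsum_eq_sum_range (N := 2) fun i hi => by
      rw [mode_vacuum_of_nonneg _ (by lia), mode_zero_left, LinearMap.zero_apply, smul_zero],
    sum_range_succ, sum_range_one] at h
  norm_num at h
  rw [mode_neg_two_vacuum, mode_neg_one_vacuum] at h
  rw [LinearMap.smul_apply, neg_smul, eq_neg_iff_add_eq_zero, h]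

lemma mode_omega_zero (hg : IsAutomorphism g) (hT : IsOfFinOrder g) (u : V) (n : ℚ) :
    X.mode (VertexOperatorAlgebra.mode omega 0 u) n = (-(n : ℂ)) • X.mode u (n - 1) := by
  refine mem_of_forall_sector_le hT (P := LinearMap.eqLocus
    (LinearMap.proj n ∘ₗ X.mode ∘ₗ VertexOperatorAlgebra.mode omega 0)
    ((-(n : ℂ)) • (LinearMap.proj (n - 1) ∘ₗ X.mode))) (fun m u hu => ?_) u
  change X.mode (VertexOperatorAlgebra.mode omega 0 u) n = (-(n : ℂ)) • X.mode u (n - 1)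
  by_cases hn : ∃ k : ℤ, n = m + k
  · obtain ⟨k, rfl⟩ := hn
    exact X.mode_omega_zero_of_mem_sector hT (by rwa [sector_add_intCast])
  · push Not at hn
    have hu' : VertexOperatorAlgebra.mode omega 0 u ∈ sector g m := by
      simpa only [Int.cast_zero, zero_add] using mode_mem_sector hg (omega_mem_sector hg 0) hu 0
    rw [X.mode_eq_zero_of_mem_sector hT hu' hn, X.mode_eq_zero_of_mem_sector hT hu fun k hk =>
      hn (k + 1) (by push_cast; linarith), smul_zero]

lemma mem_weightSpace {c : ℂ} {w : M} : w ∈ X.weightSpace c ↔ X.mode omega 1 w = c • w :=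
  Module.End.mem_eigenspace_iff

lemma mode_mem_weightSpace (hg : IsAutomorphism g) (hT : IsOfFinOrder g) {d : ℤ}
    (hu : u ∈ VertexOperatorAlgebra.weightSpace V d) {c : ℂ} {w : M} (hw : w ∈ X.weightSpace c)
    (n : ℚ) : X.mode u n w ∈ X.weightSpace (c + d - n - 1) := by
  rw [X.mem_weightSpace] at hw ⊢
  rw [VertexOperatorAlgebra.mem_weightSpace] at hu
  have h := X.mode_commutator hT (omega_mem_sector hg 1) u w n
  rw [Int.cast_one, Rat.cast_one, finsum_choose_one_smul, Nat.cast_zero, Nat.cast_one,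
    Nat.cast_zero, Nat.cast_one, X.mode_omega_zero hg hT, hu, hw, mode_smul_left, sub_zero,
    add_sub_cancel_left, sub_eq_iff_eq_add] at h
  rw [h]
  simp only [LinearMap.smul_apply, map_smul]
  push_cast
  module

/-- The span of all `uₙ w`, for fixed `w`. -/
def orbit (w : M) : Submodule ℂ M := Submodule.span ℂ {y | ∃ (u : V) (n : ℚ), y = X.mode u n w}

lemma mode_mem_orbit (w : M) (u : V) (n : ℚ) : X.mode u n w ∈ X.orbit w :=
  Submodule.subset_span ⟨u, n, rfl⟩

lemma self_mem_orbit (w : M) : w ∈ X.orbit w := by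
  simpa only [X.vacuum_mode, if_pos, Module.End.one_apply] using X.mode_mem_orbit w vacuum (-1)

lemma mode_mode_mem_orbit_of_mem_sector (hT : IsOfFinOrder g) (ha : a ∈ sector g m) (k : ℤ)
    (b : V) (q : ℚ) (w : M) : X.mode a (m + k) (X.mode b q w) ∈ X.orbit w := by
  obtain ⟨K, hK⟩ := eventually_atTop.mp (X.eventually_mode_add_natCast_eq_zero a w m)
  have ha' : a ∈ sector g (m + (K : ℤ)) := by rwa [sector_add_intCast]
  suffices h : ∀ (i : ℕ) (k : ℤ), X.mode a (m + k) (X.mode b (q + i) w) ∈ X.orbit w by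
    simpa only [Nat.cast_zero, add_zero] using h 0 k
  refine forall_of_eventually_of_forall_gt ?_ fun i ih k => ?_
  · filter_upwards [X.eventually_mode_add_natCast_eq_zero b w q] with i hi k
    rw [hi, map_zero]
    exact zero_mem _
  -- Since `a` kills `w` from index `m + K` on, the Jacobi identity starting there expresses
  -- `aₘ₊ₖ b_{q+i} w` through iterates and terms with larger `i`.
  have h := X.jacobi_of_mem_sector hT ha' b w (k - K) (q + i)
  have hkill : ∀ j : ℕ, X.mode a (m + (K : ℤ) + j) w = 0 := fun j => by
    simpa only [Nat.cast_add, Int.cast_natCast, add_assoc] using hK (K + j) (by lia)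
  simp only [hkill, map_zero, smul_zero, finsum_zero, sub_zero] at h
  have hmem := apply_zero_mem_of_finsum_mem (W := X.orbit w) ?_ (fun j hj => ?_)
    (h ▸ finsum_mem_submodule fun j => (X.orbit w).smul_mem _ (X.mode_mem_orbit _ _ _))
  · simpa using hmem
  · filter_upwards [X.eventually_mode_add_natCast_eq_zero b w (q + i)] with j hj
    rw [hj, map_zero, smul_zero]
  · have := ih (i + j) (by lia) (k - j)
    push_cast at this ⊢
    rw [← add_assoc, show m + ((k : ℚ) - j) = m + K + (k - K) - j by ring] at this
    exact Submodule.smul_mem _ _ this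

lemma mode_mem_orbit_of_mem_orbit (hT : IsOfFinOrder g) (v : V) (n : ℚ) {w x : M}
    (hx : x ∈ X.orbit w) : X.mode v n x ∈ X.orbit w := by
  refine Submodule.span_le (p := (X.orbit w).comap (X.mode v n)) |>.mpr ?_ hx
  rintro _ ⟨b, q, rfl⟩
  refine mem_of_forall_sector_le hT (P := (X.orbit w).comap
    (LinearMap.applyₗ (X.mode b q w) ∘ₗ LinearMap.proj n ∘ₗ X.mode)) (fun m a ha => ?_) v
  change X.mode a n (X.mode b q w) ∈ X.orbit w
  by_cases hn : ∃ k : ℤ, n = m + k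
  · obtain ⟨k, rfl⟩ := hn
    exact X.mode_mode_mem_orbit_of_mem_sector hT ha k b q w
  · push Not at hn
    rw [X.mode_eq_zero_of_mem_sector hT ha hn]
    exact zero_mem _

/-- The span of all `φ ∘ uₙ`, for a fixed functional `φ`. -/
def dualOrbit (φ : Module.Dual ℂ M) : Submodule ℂ (Module.Dual ℂ M) :=
  Submodule.span ℂ {y | ∃ (u : V) (n : ℚ), y = φ ∘ₗ X.mode u n}

lemma comp_mode_mem_dualOrbit (φ : Module.Dual ℂ M) (u : V) (n : ℚ) :
    φ ∘ₗ X.mode u n ∈ X.dualOrbit φ := Submodule.subset_span ⟨u, n, rfl⟩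

section DualOrbit

variable {φ : Module.Dual ℂ M} (hφ : ∀ u : V, ∀ᶠ n in atBot, φ ∘ₗ X.mode u n = 0)

include hφ

lemma eventually_comp_mode_comp_eq_zero (b : V) (n : ℚ) :
    ∀ᶠ i : ℕ in atTop, ∀ A : Module.End ℂ M, φ ∘ₗ X.mode b (n - i) ∘ₗ A = 0 := by
  filter_upwards [(tendsto_const_sub_natCast n).eventually (hφ b)] with i hi A
  rw [← LinearMap.comp_assoc, hi, LinearMap.zero_comp]

lemma comp_jacobi (hT : IsOfFinOrder g) (ha : a ∈ sector g m) (b : V) {l : ℤ} (n : ℚ)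
    (hl : ∀ i : ℕ, φ ∘ₗ X.mode a (m + l - i) = 0) :
    -(∑ᶠ i : ℕ, ((-1 : ℂ) ^ (l + i) * Ring.choose (l : ℂ) i) •
        (φ ∘ₗ X.mode b (n + l - i) ∘ₗ X.mode a (m + i))) =
      ∑ᶠ i : ℕ, Ring.choose (m : ℂ) i •
        (φ ∘ₗ X.mode (VertexOperatorAlgebra.mode a (l + i) b) (m + n - i)) := by
  ext w
  have h := congrArg φ (X.jacobi_of_mem_sector hT ha b w l n)
  rw [map_sub, map_finsum_of_eventually φ (by
      filter_upwards [X.eventually_mode_add_natCast_eq_zero b w n] with i hi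
      rw [hi, map_zero, smul_zero]),
    finsum_eq_zero_of_forall_eq_zero fun i => by
      rw [map_smul, ← LinearMap.comp_apply, hl, LinearMap.zero_apply, smul_zero],
    zero_sub, map_finsum_of_eventually φ (by
      filter_upwards [X.eventually_mode_add_natCast_eq_zero a w m] with i hi
      rw [hi, map_zero, smul_zero]),
    map_finsum_of_eventually φ (by
      filter_upwards [X.eventually_mode_mode_eq_zero a b l] with i hi
      rw [hi, LinearMap.zero_apply, smul_zero])] at h
  rw [LinearMap.neg_apply, finsum_apply_of_eventually (by
      filter_upwards [X.eventually_comp_mode_comp_eq_zero hφ b (n + l)] with i hi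
      rw [hi, smul_zero]),
    finsum_apply_of_eventually (by
      filter_upwards [X.eventually_mode_mode_eq_zero a b l] with i hi
      rw [hi, LinearMap.comp_zero, smul_zero])]
  simpa only [LinearMap.smul_apply, LinearMap.comp_apply, map_smul] using h

lemma comp_mode_mode_mem_dualOrbit_of_mem_sector (hT : IsOfFinOrder g) (ha : a ∈ sector g m)
    (k : ℤ) (b : V) (q : ℚ) : φ ∘ₗ X.mode b q ∘ₗ X.mode a (m + k) ∈ X.dualOrbit φ := by
  suffices h : ∀ (i : ℕ) (k : ℤ), φ ∘ₗ X.mode b (q - i) ∘ₗ X.mode a (m + k) ∈ X.dualOrbit φ by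
    simpa only [Nat.cast_zero, sub_zero] using h 0 k
  refine forall_of_eventually_of_forall_gt ?_ fun i ih k => ?_
  · filter_upwards [X.eventually_comp_mode_comp_eq_zero hφ b q] with i hi k
    rw [hi]
    exact zero_mem _
  obtain ⟨L, hL⟩ := eventually_atTop.mp ((tendsto_const_sub_natCast (m + k)).eventually (hφ a))
  have hkill : ∀ j : ℕ, φ ∘ₗ X.mode a (m + k + (-L : ℤ) - j) = 0 := fun j => by
    have := hL (L + j) (by lia)
    push_cast at this ⊢
    rwa [show m + (k : ℚ) - (L + j) = m + k + -L - j by ring] at this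
  have h := X.comp_jacobi hφ hT (m := m + k) (by rwa [sector_add_intCast]) b (q - i + L) hkill
  rw [neg_eq_iff_eq_neg] at h
  have hmem := apply_zero_mem_of_finsum_mem (W := X.dualOrbit φ) ?_ (fun j hj => ?_)
    (h ▸ neg_mem (finsum_mem_submodule fun j =>
      Submodule.smul_mem _ _ (X.comp_mode_mem_dualOrbit _ _ _)))
  · rw [Ring.choose_zero_right, mul_one,
      Submodule.smul_mem_iff _ (zpow_ne_zero _ (neg_ne_zero.mpr one_ne_zero))] at hmem
    simpa using hmem
  · filter_upwards [X.eventually_comp_mode_comp_eq_zero hφ b (q - i + L + (-L : ℤ))] with j hj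
    rw [hj, smul_zero]
  · have := ih (i + j) (by lia) (k + j)
    push_cast at this ⊢
    rw [← add_assoc, show q - ((i : ℚ) + j) = q - i + L + -L - j by ring] at this
    exact Submodule.smul_mem _ _ this

lemma comp_mode_mem_dualOrbit_of_mem_dualOrbit (hT : IsOfFinOrder g) (v : V) (n : ℚ)
    {ψ : Module.Dual ℂ M} (hψ : ψ ∈ X.dualOrbit φ) : ψ ∘ₗ X.mode v n ∈ X.dualOrbit φ := by
  refine Submodule.span_le (p := (X.dualOrbit φ).comap
    (LinearMap.lcomp ℂ ℂ (X.mode v n))) |>.mpr ?_ hψ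
  rintro _ ⟨b, q, rfl⟩
  refine mem_of_forall_sector_le hT (P := (X.dualOrbit φ).comap
    (LinearMap.llcomp ℂ M M ℂ (φ ∘ₗ X.mode b q) ∘ₗ LinearMap.proj n ∘ₗ X.mode))
    (fun m a ha => ?_) v
  change φ ∘ₗ X.mode b q ∘ₗ X.mode a n ∈ X.dualOrbit φ
  by_cases hn : ∃ k : ℤ, n = m + k
  · obtain ⟨k, rfl⟩ := hn
    exact X.comp_mode_mode_mem_dualOrbit_of_mem_sector hφ hT ha k b q
  · push Not at hn
    rw [X.mode_eq_zero_of_mem_sector hT ha hn, LinearMap.comp_zero, LinearMap.comp_zero]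
    exact zero_mem _

end DualOrbit

end WeakTwistedModule

namespace WeakTwistedModule

variable {V : Type u} [AddCommGroup V] [Module ℂ V] [VertexOperatorAlgebra V]
  {g : V ≃ₗ[ℂ] V} {M : Type u} [AddCommGroup M] [Module ℂ M] (X : WeakTwistedModule g M)
  {K W : Submodule ℂ M} {w : M}

/-- A subspace stable under all modes, i.e. a submodule of a weak twisted module. -/
def IsStable (W : Submodule ℂ M) : Prop := ∀ (v : V) (n : ℚ), ∀ w ∈ W, X.mode v n w ∈ W

lemma isStable_orbit (hT : IsOfFinOrder g) (w : M) : X.IsStable (X.orbit w) :=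
  fun v n _ => X.mode_mem_orbit_of_mem_orbit hT v n

lemma isStable_bot : X.IsStable ⊥ := fun v n w hw => by
  rw [Submodule.mem_bot] at hw ⊢
  rw [hw, map_zero]

variable {X}

lemma IsStable.orbit_le (hW : X.IsStable W) (hw : w ∈ W) : X.orbit w ≤ W := by
  refine Submodule.span_le.mpr ?_
  rintro _ ⟨u, n, rfl⟩
  exact hW u n w hw

lemma IsStable.sSup {c : Set (Submodule ℂ M)} (hne : c.Nonempty) (hc : IsChain (· ≤ ·) c)
    (h : ∀ K ∈ c, X.IsStable K) : X.IsStable (sSup c) := by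
  intro v n x hx
  obtain ⟨K, hKc, hxK⟩ := (Submodule.mem_sSup_of_directed hne hc.directedOn).mp hx
  exact le_sSup hKc (h K hKc v n x hxK)

/-- The weak twisted module induced on a stable subspace. -/
def restrict (X : WeakTwistedModule g M) (hW : X.IsStable W) : WeakTwistedModule g W where
  mode :=
    { toFun v n := (X.mode v n).restrict (hW v n)
      map_add' a b := funext fun n => by ext; simp
      map_smul' c a := funext fun n => by ext; simp }
  mode_eq_zero r hr u hu n hn := LinearMap.ext fun w => Subtype.ext <|
    LinearMap.congr_fun (X.mode_eq_zero r hr u hu n hn) w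
  truncation v w := by
    obtain ⟨N, hN⟩ := X.truncation v w
    exact ⟨N, fun l hl => Subtype.ext (hN l hl)⟩
  vacuum_mode n := LinearMap.ext fun w => Subtype.ext <| by
    refine (LinearMap.congr_fun (X.vacuum_mode n) w).trans ?_
    split_ifs <;> rfl
  jacobi r hr u hu v w l k m n hm := Subtype.ext <| by
    simp only [Submodule.coe_sub, coe_finsum, Submodule.coe_smul]
    exact X.jacobi r hr u hu v w l k m n hm

lemma coe_restrict_mode (hW : X.IsStable W) (v : V) (n : ℚ) (w : W) :
    ((X.restrict hW).mode v n w : M) = X.mode v n w := rfl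

/-- The weak twisted module induced on the quotient by a stable subspace. -/
def quotient (X : WeakTwistedModule g M) (hK : X.IsStable K) : WeakTwistedModule g (M ⧸ K) where
  mode :=
    { toFun v n := K.mapQ K (X.mode v n) (hK v n)
      map_add' a b := funext fun n => by ext; simp
      map_smul' c a := funext fun n => by ext; simp }
  mode_eq_zero r hr u hu n hn := by
    ext w
    exact congrArg K.mkQ (LinearMap.congr_fun (X.mode_eq_zero r hr u hu n hn) w)
  truncation v w := by
    obtain ⟨w, rfl⟩ := K.mkQ_surjective w
    obtain ⟨N, hN⟩ := X.truncation v w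
    exact ⟨N, fun l hl => congrArg K.mkQ (hN l hl)⟩
  vacuum_mode n := by
    ext w
    refine (congrArg K.mkQ (LinearMap.congr_fun (X.vacuum_mode n) w)).trans ?_
    split_ifs <;> rfl
  jacobi r hr u hu v w l k m n hm := by
    obtain ⟨w, rfl⟩ := K.mkQ_surjective w
    have h := congrArg K.mkQ (X.jacobi r hr u hu v w l k m n hm)
    rw [map_sub, map_finsum_of_eventually K.mkQ (by
        filter_upwards [X.eventually_mode_add_natCast_eq_zero v w n] with i hi
        rw [hi, map_zero, smul_zero]),
      map_finsum_of_eventually K.mkQ (by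
        filter_upwards [X.eventually_mode_add_natCast_eq_zero u w m] with i hi
        rw [hi, map_zero, smul_zero]),
      map_finsum_of_eventually K.mkQ (by
        filter_upwards [X.eventually_mode_mode_eq_zero u v l] with i hi
        rw [hi, LinearMap.zero_apply, smul_zero])] at h
    simp only [map_smul] at h
    exact h

lemma quotient_mode_mkQ (hK : X.IsStable K) (v : V) (n : ℚ) (x : M) :
    (X.quotient hK).mode v n (K.mkQ x) = K.mkQ (X.mode v n x) := rfl

lemma isStable_map_subtype {hW : X.IsStable W} {U : Submodule ℂ W}
    (hU : (X.restrict hW).IsStable U) : X.IsStable (U.map W.subtype) := by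
  rintro v n _ ⟨y, hy, rfl⟩
  exact ⟨_, hU v n y hy, rfl⟩

lemma isStable_comap_mkQ {hK : X.IsStable K} {U : Submodule ℂ (M ⧸ K)}
    (hU : (X.quotient hK).IsStable U) : X.IsStable (U.comap K.mkQ) :=
  fun v n _ hx => hU v n _ hx

lemma exists_maximal_isStable_notMem (X : WeakTwistedModule g M) (hw : w ≠ 0) :
    ∃ K, Maximal (fun K => X.IsStable K ∧ w ∉ K) K := by
  refine (zorn_le_nonempty₀ {K | X.IsStable K ∧ w ∉ K} (fun c hc hchain K₀ hK₀ =>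
    ⟨sSup c, ⟨.sSup ⟨K₀, hK₀⟩ hchain fun K hK => (hc hK).1, fun hmem => ?_⟩,
      fun K hK => le_sSup hK⟩) ⊥ ⟨X.isStable_bot, hw⟩).imp fun K hK => hK.2
  obtain ⟨K, hKc, hwK⟩ := (Submodule.mem_sSup_of_directed ⟨K₀, hK₀⟩ hchain.directedOn).mp hmem
  exact (hc hKc).2 hwK

lemma mkQ_mem_of_maximal (hmax : Maximal (fun K => X.IsStable K ∧ w ∉ K) K)
    {U : Submodule ℂ (M ⧸ K)} (hU : (X.quotient hmax.prop.1).IsStable U) (hne : U ≠ ⊥) :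
    K.mkQ w ∈ U := by
  by_contra hwU
  have hle : U.comap K.mkQ ≤ K := hmax.le_of_ge ⟨isStable_comap_mkQ hU, hwU⟩ (K.le_comap_mkQ U)
  refine hne (Submodule.comap_injective_of_surjective K.mkQ_surjective ?_)
  rw [Submodule.comap_bot, K.ker_mkQ]
  exact hle.antisymm (K.le_comap_mkQ U)

lemma isSimple_restrict_orbit (hT : IsOfFinOrder g) (hw : w ≠ 0)
    (h : ∀ W, X.IsStable W → W ≠ ⊥ → w ∈ W) :
    (X.restrict (X.isStable_orbit hT w)).IsSimple where
  nontrivial := ⟨⟨w, X.self_mem_orbit w⟩, 0, fun h0 => hw (congrArg Subtype.val h0)⟩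
  eq_bot_or_eq_top U hU := by
    have hstable : X.IsStable (U.map (X.orbit w).subtype) := isStable_map_subtype hU
    refine or_iff_not_imp_left.mpr fun hne => ?_
    have hwU := h _ hstable fun h0 => hne <|
      Submodule.map_injective_of_injective (X.orbit w).subtype_injective (h0.trans (by simp))
    rw [← Submodule.comap_map_eq_of_injective (X.orbit w).subtype_injective U,
      Submodule.comap_subtype_eq_top]
    exact hstable.orbit_le hwU

lemma exists_simple_subquotient (X : WeakTwistedModule g M) (hT : IsOfFinOrder g) (hw : w ≠ 0) :
    ∃ (S : Type u) (_ : AddCommGroup S) (_ : Module ℂ S) (Z : WeakTwistedModule g S) (s : S),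
      s ≠ 0 ∧ Z.IsSimple ∧ ∀ (v : V) (n : ℚ) (c : ℂ), X.mode v n w = c • w →
        Z.mode v n s = c • s := by
  obtain ⟨K, hmax⟩ := X.exists_maximal_isStable_notMem hw
  have hs : K.mkQ w ≠ 0 := fun h => hmax.prop.2 ((Submodule.Quotient.mk_eq_zero K).mp h)
  let Q := X.quotient hmax.prop.1
  refine ⟨Q.orbit (K.mkQ w), inferInstance, inferInstance, Q.restrict (Q.isStable_orbit hT _),
    ⟨_, Q.self_mem_orbit _⟩, fun h0 => hs (congrArg Subtype.val h0),
    isSimple_restrict_orbit hT hs fun U => mkQ_mem_of_maximal hmax, fun v n c h => ?_⟩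
  refine Subtype.ext ?_
  rw [coe_restrict_mode, quotient_mode_mkQ, h, map_smul, Submodule.coe_smul]

end WeakTwistedModule

section ZhuDual

variable {V : Type*} [AddCommGroup V] [Module ℂ V] [VertexOperatorAlgebra V]
  {g : V ≃ₗ[ℂ] V} {f : Module.Dual ℂ V} {r : ℕ} {d : ℤ} {a u : V} {n : ℚ}

lemma residue_omega_zero (α : ℂ) (q : ℤ) (u : V) :
    residue α q (mode omega 0 u) =
      (-α) • residue (α - 1) q u + (-(q : ℂ)) • residue α (q - 1) u := by
  ext v
  obtain ⟨N, hN⟩ := eventually_atTop.mp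
    (eventually_forall_add_natCast_le (eventually_mode_eq_zero u v) (q - 1))
  have h0 := hN N le_rfl
  simp only [LinearMap.add_apply, LinearMap.smul_apply, residue_apply]
  rw [act_eq_sum _ (N := N + 1) fun n hn => by
      rw [mode_omega_zero, LinearMap.smul_apply, h0 _ (by lia), smul_zero],
    act_eq_sum _ (N := N) (p := q) fun n hn => h0 _ (by lia),
    act_eq_sum _ (N := N + 1) (p := q - 1) fun n hn => h0 _ (by lia)]
  simp only [PowerSeries.binomialSeries_coeff, smul_eq_mul, mul_one, mode_omega_zero,
    LinearMap.smul_apply]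
  have hterm : ∀ i : ℕ,
      Ring.choose α i • (-((q + i : ℤ) : ℂ)) • mode u (q + i - 1) v =
        (-((i : ℂ) * Ring.choose α i)) • mode u (q + i - 1) v +
          (-(q : ℂ)) • Ring.choose α i • mode u (q - 1 + i) v := fun i => by
    rw [show q - 1 + (i : ℤ) = q + i - 1 by ring]
    push_cast
    module
  have habsorb : ∀ i : ℕ, ((i + 1 : ℕ) : ℂ) * Ring.choose α (i + 1) = α * Ring.choose (α - 1) i :=
    fun i => by
      have h := Ring.choose_smul_choose α (n := i + 1) (k := 1) (by lia)
      rwa [Nat.choose_one_right, nsmul_eq_mul, Ring.choose_one_right, Nat.add_sub_cancel,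
        Nat.cast_one] at h
  rw [sum_congr rfl fun i _ => hterm i, sum_add_distrib, ← smul_sum]
  congr 1
  rw [sum_range_succ', smul_sum, Nat.cast_zero, zero_mul, neg_zero, zero_smul, add_zero]
  refine sum_congr rfl fun i _ => ?_
  rw [habsorb, smul_smul, neg_mul, Nat.cast_succ, ← add_assoc, add_sub_cancel_right]

lemma residueForm_omega_zero (n : ℚ) (p j : ℤ) (u : V) (f : Module.Dual ℂ V) :
    residueForm n p j (mode omega 0 u) f =
      (-((n : ℂ) + p)) • residueForm n (p - 1) j u f + (j : ℂ) • residueForm n p (j + 1) u f := by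
  ext v
  rw [residueForm_apply, residue_omega_zero, ← neg_add', Int.cast_neg, neg_neg, add_sub_assoc]
  simp only [LinearMap.add_apply, LinearMap.smul_apply, map_add, map_smul, residueForm_apply,
    Int.cast_sub, Int.cast_one]

lemma IsBounded.add_intCast {P J : ℤ} (h : IsBounded f a n P J) (k : ℤ) :
    IsBounded f a (n + k) (P - k) (J + k) := fun p j hp hj => by
  rw [residueForm_add_intCast]
  exact h (k + p) j (by lia) (by lia)

/-- The number `δ_r` in the definition of `u ∘_g v`. -/
def delta (r : ℕ) : ℤ := if r = 0 then 1 else 0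

lemma delta_nonneg (r : ℕ) : 0 ≤ delta r := by
  unfold delta
  split_ifs <;> norm_num

lemma circ_eq_residue (g : V ≃ₗ[ℂ] V) (d : ℤ) (r : ℕ) (u v : V) : circ g d r u v =
    residue ((((r : ℚ) / orderOf g : ℚ) : ℂ) + ((d - 1 + delta r : ℤ) : ℂ)) (-(1 + delta r))
      u v := by
  rw [circ, residue_apply, act]
  refine finsum_congr fun i => ?_
  rw [PowerSeries.binomialSeries_coeff, smul_eq_mul, mul_one, delta]
  congr 2
  · split_ifs <;> push_cast <;> ring
  · split_ifs <;> ring_nf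

lemma twistedO_le_iff {P : Submodule ℂ V} : twistedO g ≤ P ↔
    ∀ r < orderOf g, ∀ (d : ℤ), ∀ u ∈ twistedSector g r, u ∈ weightSpace V d → ∀ v,
      residue ((((r : ℚ) / orderOf g : ℚ) : ℂ) + ((d - 1 + delta r : ℤ) : ℂ)) (-(1 + delta r)) u v
        ∈ P := by
  rw [twistedO, Submodule.span_le]
  constructor
  · intro h r hr d u hu hd v
    rw [← circ_eq_residue]
    exact h ⟨r, d, u, v, hr, hu, hd, rfl⟩
  · rintro h _ ⟨r, d, u, v, hr, hu, hd, rfl⟩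
    rw [circ_eq_residue]
    exact h r hr d u hu hd v

lemma mem_dualAnnihilator_twistedO : f ∈ (twistedO g).dualAnnihilator ↔
    ∀ r < orderOf g, ∀ (d : ℤ), ∀ u ∈ twistedSector g r, u ∈ weightSpace V d →
      residueForm ((r : ℚ) / orderOf g) (d - 1 + delta r) (1 + delta r) u f = 0 := by
  rw [Submodule.mem_dualAnnihilator]
  change twistedO g ≤ LinearMap.ker f ↔ _
  simp only [twistedO_le_iff, LinearMap.mem_ker, LinearMap.ext_iff, residueForm_apply,
    LinearMap.zero_apply]

lemma mode_omega_mem_twistedSector (hg : IsAutomorphism g) (hu : u ∈ twistedSector g r) (i : ℤ) :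
    mode omega i u ∈ twistedSector g r := by
  rw [twistedSector_eq_sector] at *
  have h := mode_mem_sector hg (omega_mem_sector hg 0) hu i
  rwa [Int.cast_zero, zero_add] at h

-- Applying the defining relations of `O_g(V)` to `L(-1)u` raises the order of the pole at `z = 0`.
lemma residueForm_eq_zero_of_le (hg : IsAutomorphism g) (hf : f ∈ (twistedO g).dualAnnihilator)
    (hr : r < orderOf g) (hu : u ∈ twistedSector g r) (hd : u ∈ weightSpace V d) {j : ℤ}
    (hj : 1 + delta r ≤ j) :
    residueForm ((r : ℚ) / orderOf g) (d - 1 + delta r) j u f = 0 := by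
  induction j, hj using Int.leInduction generalizing u d with
  | base => exact mem_dualAnnihilator_twistedO.mp hf r hr d u hu hd
  | succ j hj ih =>
    have hderiv := ih (mode_omega_mem_twistedSector hg hu 0)
      (mode_mem_weightSpace omega_mem_weightSpace hd 0)
    rw [show 2 + d - 0 - 1 - 1 + delta r = d - 1 + delta r + 1 by ring, residueForm_omega_zero,
      add_sub_cancel_right, residueForm_add_one, ih hu hd, smul_zero, zero_add, add_zero] at hderiv
    refine (smul_eq_zero.mp hderiv).resolve_left (Int.cast_ne_zero.mpr ?_)
    have := delta_nonneg r
    lia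

lemma isBounded_of_mem_dualAnnihilator (hg : IsAutomorphism g)
    (hf : f ∈ (twistedO g).dualAnnihilator) (hr : r < orderOf g) (hu : u ∈ twistedSector g r)
    (hd : u ∈ weightSpace V d) :
    IsBounded f u ((r : ℚ) / orderOf g) (d - 1 + delta r) (2 - d) := by
  intro p j hp
  induction p, hp using Int.leInduction generalizing j with
  | base => exact fun hj => residueForm_eq_zero_of_le hg hf hr hu hd (by lia)
  | succ p _ ih =>
    intro hj
    have hstep := residueForm_add_one ((r : ℚ) / orderOf g) p (j - 1) u f
    rwa [sub_add_cancel, ih j (by lia), ih (j - 1) (by lia), add_zero] at hstep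

lemma sectorProj_mem_weightSpace (hg : IsAutomorphism g) (hu : u ∈ weightSpace V d) (n : ℚ) :
    sectorProj g n u ∈ weightSpace V d := by
  by_cases hn : IsSectorIndex g n
  · have hpow : ∀ j : ℕ, (g ^ j) u ∈ weightSpace V d := fun j => by
      induction j with
      | zero => exact hu
      | succ j ih =>
        rw [pow_succ', LinearEquiv.mul_apply, mem_weightSpace]
        have h := congrArg g (mem_weightSpace.mp ih)
        rwa [hg.map_mode, hg.map_omega, map_smul] at h
    rw [sectorProj_apply hn]
    exact Submodule.smul_mem _ _ (sum_mem fun j _ => Submodule.smul_mem _ _ (hpow j))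
  · rw [sectorProj_eq_zero hn]
    exact zero_mem _

lemma mem_of_forall_weightSpace_le {P : Submodule ℂ V} (h : ∀ d, weightSpace V d ≤ P) (a : V) :
    a ∈ P := by
  have htop : ⨆ d, weightSpace V d = ⊤ := grading.submodule_iSup_eq_top
  exact (htop ▸ iSup_le h : ⊤ ≤ P) trivial

lemma exists_isBounded_sectorProj (hg : IsAutomorphism g) (hT : IsOfFinOrder g)
    (hf : f ∈ (twistedO g).dualAnnihilator) (hu : u ∈ weightSpace V d) (n : ℚ) :
    sectorProj g n u = 0 ∨ ∃ r k, r < orderOf g ∧ n = (r : ℚ) / orderOf g + (k : ℤ) ∧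
      IsBounded f (sectorProj g n u) n (d - 1 + delta r - k) (2 - d + k) := by
  rcases eq_or_ne (sectorProj g n u) 0 with h0 | h0
  · exact Or.inl h0
  · obtain ⟨r, k, hr, hur, hn⟩ := exists_mem_twistedSector hT (sectorProj_mem n u) h0
    have h := (isBounded_of_mem_dualAnnihilator hg hf hr hur
      (sectorProj_mem_weightSpace hg hu n)).add_intCast k
    rw [← hn] at h
    exact Or.inr ⟨r, k, hr, hn, h⟩

lemma dualAnnihilator_le_regularDual (hg : IsAutomorphism g) (hT : IsOfFinOrder g) :
    (twistedO g).dualAnnihilator ≤ regularDual g := by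
  intro f hf n a ha
  let P : Submodule ℂ V :=
    { carrier := {a | ∀ᶠ B in atTop, IsBounded f (sectorProj g n a) n B B}
      zero_mem' := .of_forall fun B p j _ _ => by rw [map_zero, map_zero, LinearMap.zero_apply]
      add_mem' := fun h h' => by
        filter_upwards [h, h'] with B hB hB' p j hp hj
        rw [map_add, map_add, LinearMap.add_apply, hB p j hp hj, hB' p j hp hj, add_zero]
      smul_mem' := fun c a h => by
        filter_upwards [h] with B hB p j hp hj
        rw [map_smul, map_smul, LinearMap.smul_apply, hB p j hp hj, smul_zero] }
  have hP : a ∈ P := mem_of_forall_weightSpace_le (fun d u hu => by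
    rcases exists_isBounded_sectorProj hg hT hf hu n with h0 | ⟨r, k, -, -, h⟩
    · refine .of_forall fun B p j _ _ => ?_
      rw [h0, map_zero, LinearMap.zero_apply]
    · exact h.eventually) a
  rw [← sectorProj_of_mem hT ha]
  exact hP

lemma dualMode_eq_zero_of_lt (hg : IsAutomorphism g) (hT : IsOfFinOrder g)
    (hf : f ∈ (twistedO g).dualAnnihilator) (hu : u ∈ weightSpace V d) (hn : (d : ℚ) - 1 < n) :
    dualMode g u n f = 0 := by
  have hproj := dualMode_sectorProj hT u n f 0
  rw [Int.cast_zero, add_zero] at hproj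
  rcases exists_isBounded_sectorProj hg hT hf hu n with h0 | ⟨r, k, hr, rfl, h⟩
  · rw [← hproj, h0, dualMode_zero_left (dualAnnihilator_le_regularDual hg hT hf)]
  · have hzero := h.dualMode_expansion.1 0 ?_
    · rwa [Int.cast_zero, add_zero] at hzero
    unfold delta
    split_ifs with h0
    · rw [h0, Nat.cast_zero, zero_div, zero_add] at hn
      have : d - 1 < k := by exact_mod_cast hn
      lia
    · have hlt : (r : ℚ) / orderOf g < 1 := by
        rw [div_lt_one (by exact_mod_cast hT.orderOf_pos)]
        exact_mod_cast hr
      have : d - 2 < k := by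
        have h : (d : ℚ) - 2 < k := by linarith
        exact_mod_cast h
      lia

lemma dualMode_omega (hg : IsAutomorphism g) (hT : IsOfFinOrder g)
    (hf : f ∈ (twistedO g).dualAnnihilator) :
    dualMode g omega 1 f = residueForm 0 1 1 omega f := by
  have homega : (omega : V) ∈ sector g 0 := by simpa using omega_mem_sector hg 0
  have hbounded : IsBounded f (omega : V) 0 2 0 := by
    have h := isBounded_of_mem_dualAnnihilator (r := 0) hg hf hT.orderOf_pos
      (by rwa [twistedSector_eq_sector, Nat.cast_zero, zero_div]) omega_mem_weightSpace
    simpa [delta] using h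
  rw [← sectorProj_of_mem hT homega] at hbounded
  obtain ⟨hzero, hexp⟩ := hbounded.dualMode_expansion
  have h := hexp 1 1 (by norm_num)
  rw [act_eq_sum _ (N := 1) fun n hn => hzero n (by lia), sectorProj_of_mem hT homega] at h
  simpa using h.symm

lemma residueForm_omega_mem_dualAnnihilator (hg : IsAutomorphism g)
    (hf : f ∈ (twistedO g).dualAnnihilator) :
    residueForm 0 1 1 omega f ∈ (twistedO g).dualAnnihilator := by
  refine mem_dualAnnihilator_twistedO.mpr fun r hr d u hu hd => LinearMap.ext fun v => ?_
  rw [residueForm_apply, residueForm_apply]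
  set α : ℂ := ((0 : ℚ) : ℂ) + (1 : ℤ)
  set β : ℂ := (((r : ℚ) / orderOf g : ℚ) : ℂ) + ((d - 1 + delta r : ℤ) : ℂ)
  have hcomm := congrArg f (residue_commutator omega u v (-1) (-(1 + delta r)) α β)
  have hzero : f (residue β (-(1 + delta r)) u (residue α (-1) omega v)) = 0 := by
    rw [← residueForm_apply, mem_dualAnnihilator_twistedO.mp hf r hr d u hu hd,
      LinearMap.zero_apply]
  have hterm : ∀ i : ℕ, ∀ x ∈ antidiagonal i,
      f (residue (α + β - x.1) (-1 + -(1 + delta r) - x.2) (mode omega i u) v) = 0 := by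
    intro i x hx
    rw [HasAntidiagonal.mem_antidiagonal] at hx
    have h := isBounded_of_mem_dualAnnihilator hg hf hr (mode_omega_mem_twistedSector hg hu i)
      (mode_mem_weightSpace omega_mem_weightSpace hd i) (d + delta r - x.1) (2 + delta r + x.2)
      (by lia) (by lia)
    rw [← LinearMap.zero_apply (M₂ := ℂ) (σ₁₂ := RingHom.id ℂ) v, ← h, residueForm_apply]
    simp only [α, β]
    push_cast
    ring_nf
  have hlarge : ∀ᶠ i : ℕ in atTop, mode omega i u = 0 :=
    tendsto_natCast_atTop_atTop.eventually (eventually_mode_eq_zero omega u)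
  have hfin : ∀ᶠ i : ℕ in atTop, ∑ x ∈ antidiagonal i,
      (Ring.choose α x.1 * Ring.choose ((-1 : ℤ) : ℂ) x.2) •
        residue (α + β - x.1) (-1 + -(1 + delta r) - x.2) (mode omega i u) v = 0 := by
    filter_upwards [hlarge] with i hi
    exact sum_eq_zero fun x _ => by rw [hi, map_zero, LinearMap.zero_apply, smul_zero]
  rw [map_sub, hzero, sub_zero, map_finsum_of_eventually f hfin] at hcomm
  rw [hcomm, LinearMap.zero_apply]
  refine finsum_eq_zero_of_forall_eq_zero fun i => ?_
  rw [map_sum]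
  exact sum_eq_zero fun x hx => by rw [map_smul, hterm i x hx, smul_zero]

/-- The transpose of the endomorphism `v ↦ Res_z (1+z) z⁻¹ Y(ω,z)v` of `A_g(V)`. -/
def zhuOmega (hg : IsAutomorphism g) : Module.End ℂ (twistedO g).dualAnnihilator :=
  (residueForm 0 1 1 (omega : V)).restrict fun _ hf => residueForm_omega_mem_dualAnnihilator hg hf

lemma exists_extremal_eigenvector (hg : IsAutomorphism g)
    (hfin : FiniteDimensional ℂ (TwistedZhu g)) (hne : Nontrivial (TwistedZhu g)) :
    ∃ c : ℂ, ∃ f ∈ (twistedO g).dualAnnihilator, f ≠ 0 ∧ residueForm 0 1 1 omega f = c • f ∧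
      ∀ x : ℝ, 0 < x → ∀ F ∈ (twistedO g).dualAnnihilator,
        residueForm 0 1 1 omega F = (c + x) • F → F = 0 := by
  have e := (twistedO g).dualQuotEquivDualAnnihilator
  have : FiniteDimensional ℂ (twistedO g).dualAnnihilator := e.finiteDimensional
  have : Nontrivial (twistedO g).dualAnnihilator := e.symm.toEquiv.nontrivial
  obtain ⟨c₀, hc₀⟩ := Module.End.exists_eigenvalue (zhuOmega hg)
  obtain ⟨c, hc, hmax⟩ := Set.exists_max_image {c | (zhuOmega hg).HasEigenvalue c} Complex.re
    (Module.End.finite_hasEigenvalue _) ⟨c₀, hc₀⟩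
  obtain ⟨f, hf⟩ := hc.exists_hasEigenvector
  refine ⟨c, f, f.2, fun h => hf.2 (Subtype.ext h),
    congrArg Subtype.val hf.apply_eq_smul, fun x hx F hF h => ?_⟩
  by_contra hF0
  have heigen : (zhuOmega hg).HasEigenvalue (c + x) :=
    Module.End.hasEigenvalue_of_hasEigenvector (x := ⟨F, hF⟩)
      ⟨Module.End.mem_eigenspace_iff.mpr (Subtype.ext h), fun h' => hF0 (congrArg Subtype.val h')⟩
  have hre := hmax _ heigen
  rw [Complex.add_re, Complex.ofReal_re] at hre
  linarith

end ZhuDual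

lemma eventually_eq_zero_of_homogeneous {V N : Type*} [AddCommGroup V] [Module ℂ V]
    [VertexOperatorAlgebra V] [AddCommGroup N] [Module ℂ N] {l : Filter ℚ}
    (F : V →ₗ[ℂ] ℚ → N) (h : ∀ d, ∀ u ∈ weightSpace V d, ∀ᶠ n in l, F u n = 0) (u : V) :
    ∀ᶠ n in l, F u n = 0 := by
  let P : Submodule ℂ V :=
    { carrier := {u | ∀ᶠ n in l, F u n = 0}
      zero_mem' := Eventually.of_forall fun n => by rw [map_zero, Pi.zero_apply]
      add_mem' := fun {a b} ha hb => by
        filter_upwards [ha, hb] with n han hbn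
        rw [map_add, Pi.add_apply, han, hbn, add_zero]
      smul_mem' := fun c a ha => by
        filter_upwards [ha] with n han
        rw [map_smul, Pi.smul_apply, han, smul_zero] }
  exact mem_of_forall_weightSpace_le (P := P) h u

namespace WeakTwistedModule

section ZeroMode

variable {V : Type u} [AddCommGroup V] [Module ℂ V] [VertexOperatorAlgebra V]
  {g : V ≃ₗ[ℂ] V} {M : Type u} [AddCommGroup M] [Module ℂ M] (X : WeakTwistedModule g M)
  {d e : ℤ} {u v : V} {m : ℚ}

/-- The zero mode `o(v)`: the weight-preserving mode `v_{d-1}` for `v` of weight `d`, extended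
linearly to all of `V`. -/
def zeroMode : V →ₗ[ℂ] Module.End ℂ M :=
  DirectSum.toModule ℂ ℤ (Module.End ℂ M)
      (fun d => LinearMap.proj ((d : ℚ) - 1) ∘ₗ X.mode ∘ₗ
        (VertexOperatorAlgebra.weightSpace V d).subtype) ∘ₗ
    (LinearEquiv.ofBijective
      (DirectSum.coeLinearMap (VertexOperatorAlgebra.weightSpace V)) grading).symm

lemma zeroMode_of_mem (hv : v ∈ VertexOperatorAlgebra.weightSpace V d) :
    X.zeroMode v = X.mode v ((d : ℚ) - 1) := by
  have h : (LinearEquiv.ofBijective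
      (DirectSum.coeLinearMap (VertexOperatorAlgebra.weightSpace V)) grading).symm v =
      DirectSum.lof ℂ ℤ (fun d => VertexOperatorAlgebra.weightSpace V d) d ⟨v, hv⟩ := by
    rw [LinearEquiv.symm_apply_eq]
    exact (DirectSum.coeLinearMap_lof (VertexOperatorAlgebra.weightSpace V) d ⟨v, hv⟩).symm
  rw [zeroMode, LinearMap.comp_apply, LinearEquiv.coe_coe, h, DirectSum.toModule_lof]
  rfl

lemma zeroMode_vacuum : X.zeroMode vacuum = 1 := by
  rw [X.zeroMode_of_mem vacuum_mem_weightSpace, X.vacuum_mode, if_pos (by norm_num)]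

variable {E N : Type*} [AddCommGroup E] [Module ℂ E] [AddCommGroup N] [Module ℂ N]
  {ι : E →ₗ[ℂ] M} {Φ : (E →ₗ[ℂ] M) →ₗ[ℂ] N}

section Truncated

variable (hι : ∀ v, ∀ᶠ k in atTop, X.mode v k ∘ₗ ι = 0)

include hι

lemma eventually_comp_mode_comp_eq_zero_of_truncated (v : V) (n : ℚ) :
    ∀ᶠ i : ℕ in atTop, ∀ A : Module.End ℂ M, A ∘ₗ X.mode v (n + i) ∘ₗ ι = 0 := by
  filter_upwards [(tendsto_const_add_natCast n).eventually (hι v)] with i hi A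
  rw [hi, LinearMap.comp_zero]

lemma jacobi_comp (hT : IsOfFinOrder g) (hu : u ∈ sector g m) (v : V) (l : ℤ) (n : ℚ) :
    (∑ᶠ i : ℕ, ((-1 : ℂ) ^ i * Ring.choose (l : ℂ) i) •
        (X.mode u (m + l - i) ∘ₗ X.mode v (n + i) ∘ₗ ι))
      - (∑ᶠ i : ℕ, ((-1 : ℂ) ^ (l + i) * Ring.choose (l : ℂ) i) •
        (X.mode v (n + l - i) ∘ₗ X.mode u (m + i) ∘ₗ ι))
      = ∑ᶠ i : ℕ, Ring.choose (m : ℂ) i •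
        (X.mode (VertexOperatorAlgebra.mode u (l + i) v) (m + n - i) ∘ₗ ι) := by
  ext w
  rw [LinearMap.sub_apply, finsum_apply_of_eventually (by
      filter_upwards [X.eventually_comp_mode_comp_eq_zero_of_truncated hι v n] with i hi
      rw [hi, smul_zero]),
    finsum_apply_of_eventually (by
      filter_upwards [X.eventually_comp_mode_comp_eq_zero_of_truncated hι u m] with i hi
      rw [hi, smul_zero]),
    finsum_apply_of_eventually (by
      filter_upwards [X.eventually_mode_mode_eq_zero u v l] with i hi
      rw [hi, LinearMap.zero_comp, smul_zero])]
  exact X.jacobi_of_mem_sector hT hu v (ι w) l n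

end Truncated

variable (ι Φ) in
/-- The linear map `v ↦ Φ(o(v) ∘ ι)`, a matrix coefficient of the zero mode. -/
def zeroModeForm : V →ₗ[ℂ] N := Φ ∘ₗ LinearMap.lcomp ℂ M ι ∘ₗ X.zeroMode

lemma zeroModeForm_apply (v : V) : X.zeroModeForm ι Φ v = Φ (X.zeroMode v ∘ₗ ι) := rfl

lemma zeroModeForm_residue (hι : ∀ v, ∀ᶠ k in atTop, X.mode v k ∘ₗ ι = 0) (hT : IsOfFinOrder g)
    (hu : u ∈ sector g m) (hd : u ∈ VertexOperatorAlgebra.weightSpace V d)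
    (he : v ∈ VertexOperatorAlgebra.weightSpace V e) (l : ℤ) {n : ℚ}
    (hn : m + n = d + e - l - 2) :
    X.zeroModeForm ι Φ (residue m l u v) =
      (∑ᶠ i : ℕ, ((-1 : ℂ) ^ i * Ring.choose (l : ℂ) i) •
          Φ (X.mode u (m + l - i) ∘ₗ X.mode v (n + i) ∘ₗ ι))
        - (∑ᶠ i : ℕ, ((-1 : ℂ) ^ (l + i) * Ring.choose (l : ℂ) i) •
          Φ (X.mode v (n + l - i) ∘ₗ X.mode u (m + i) ∘ₗ ι)) := by
  have h := congrArg Φ (X.jacobi_comp hι hT hu v l n)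
  rw [map_sub, map_finsum_of_eventually Φ (by
      filter_upwards [X.eventually_comp_mode_comp_eq_zero_of_truncated hι v n] with i hi
      rw [hi, smul_zero]),
    map_finsum_of_eventually Φ (by
      filter_upwards [X.eventually_comp_mode_comp_eq_zero_of_truncated hι u m] with i hi
      rw [hi, smul_zero]),
    map_finsum_of_eventually Φ (by
      filter_upwards [X.eventually_mode_mode_eq_zero u v l] with i hi
      rw [hi, LinearMap.zero_comp, smul_zero])] at h
  simp only [map_smul] at h
  rw [h, residue_apply, act, map_finsum_of_eventually _ (by
    filter_upwards [(tendsto_const_add_natCast l).eventually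
      (VertexOperatorAlgebra.eventually_mode_eq_zero u v)] with i hi
    rw [hi, smul_zero])]
  refine finsum_congr fun i => ?_
  rw [binomialSeries_coeff, smul_eq_mul, mul_one, map_smul, zeroModeForm_apply,
    X.zeroMode_of_mem (VertexOperatorAlgebra.mode_mem_weightSpace hd he (l + i)),
    show (((d + e - (l + i) - 1 : ℤ) : ℚ) - 1) = m + n - i by rw [hn]; push_cast; ring]

variable (ι Φ) in
/-- The condition that `Φ` vanishes on those products of two modes in which the mode acting first
lowers the weight. -/
def KillsLowering : Prop :=
  ∀ (a : V) (m : ℚ) (e : ℤ), ∀ v ∈ VertexOperatorAlgebra.weightSpace V e, ∀ k : ℚ,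
    (e : ℚ) - 1 < k → Φ (X.mode a m ∘ₗ X.mode v k ∘ₗ ι) = 0

lemma zeroModeForm_residue_eq_zero (hι : ∀ v, ∀ᶠ k in atTop, X.mode v k ∘ₗ ι = 0)
    (hΦ : X.KillsLowering ι Φ) (hT : IsOfFinOrder g) {r : ℕ} (hr : r < orderOf g)
    (hu : u ∈ twistedSector g r) (hd : u ∈ VertexOperatorAlgebra.weightSpace V d)
    (he : v ∈ VertexOperatorAlgebra.weightSpace V e) :
    X.zeroModeForm ι Φ (residue ((((r : ℚ) / orderOf g : ℚ) : ℂ) + ((d - 1 + delta r : ℤ) : ℂ))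
      (-(1 + delta r)) u v) = 0 := by
  have hpos : (0 : ℚ) < orderOf g := by exact_mod_cast hT.orderOf_pos
  have hlt : (r : ℚ) / orderOf g < 1 := (div_lt_one hpos).mpr (by exact_mod_cast hr)
  have hsum : (0 : ℚ) < delta r + (r : ℚ) / orderOf g := by
    rcases Nat.eq_zero_or_pos r with rfl | h
    · norm_num [delta]
    · have : (0 : ℚ) ≤ delta r := by exact_mod_cast delta_nonneg r
      positivity
  rw [twistedSector_eq_sector, ← sector_add_intCast _ (d - 1 + delta r)] at hu
  rw [← Rat.cast_intCast, ← Rat.cast_add,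
    X.zeroModeForm_residue hι hT hu hd he (-(1 + delta r)) (add_sub_cancel _ _),
    finsum_eq_zero_of_forall_eq_zero fun i => ?_, finsum_eq_zero_of_forall_eq_zero fun i => ?_,
    sub_zero]
  · rw [hΦ _ _ d u hd _ ?_, smul_zero]
    push_cast
    linarith [(Nat.cast_nonneg i : (0 : ℚ) ≤ i)]
  · rw [hΦ _ _ e v he _ ?_, smul_zero]
    push_cast
    linarith [(Nat.cast_nonneg i : (0 : ℚ) ≤ i)]

lemma twistedO_le_ker_zeroModeForm (hι : ∀ v, ∀ᶠ k in atTop, X.mode v k ∘ₗ ι = 0)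
    (hΦ : X.KillsLowering ι Φ) (hT : IsOfFinOrder g) :
    twistedO g ≤ LinearMap.ker (X.zeroModeForm ι Φ) := by
  refine twistedO_le_iff.mpr fun r hr d u hu hd v => ?_
  have h : ∀ e, VertexOperatorAlgebra.weightSpace V e ≤ (LinearMap.ker (X.zeroModeForm ι Φ)).comap
      (residue ((((r : ℚ) / orderOf g : ℚ) : ℂ) + ((d - 1 + delta r : ℤ) : ℂ))
        (-(1 + delta r)) u) := fun e v hv =>
    X.zeroModeForm_residue_eq_zero hι hΦ hT hr hu hd hv
  exact mem_of_forall_weightSpace_le h v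

lemma residueForm_omega_zeroModeForm {Φ : Module.Dual ℂ (E →ₗ[ℂ] M)}
    (hι : ∀ v, ∀ᶠ k in atTop, X.mode v k ∘ₗ ι = 0) (hΦ : X.KillsLowering ι Φ)
    (hg : IsAutomorphism g) (hT : IsOfFinOrder g) {c : ℂ} (hc : X.mode omega 1 ∘ₗ ι = c • ι) :
    residueForm 0 1 1 omega (X.zeroModeForm ι Φ) = c • X.zeroModeForm ι Φ := by
  have h : ∀ e, VertexOperatorAlgebra.weightSpace V e ≤ LinearMap.eqLocus
      (residueForm 0 1 1 omega (X.zeroModeForm ι Φ)) (c • X.zeroModeForm ι Φ) := fun e v hv => by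
    have hres := X.zeroModeForm_residue (Φ := Φ) hι hT (omega_mem_sector hg 1)
      omega_mem_weightSpace hv (-1) (n := e) (by push_cast; ring)
    rw [LinearMap.mem_eqLocus, residueForm_apply, Rat.cast_zero, zero_add, ← Rat.cast_intCast,
      hres,
      finsum_eq_zero_of_forall_eq_zero fun i => ?_, finsum_eq_single _ 0 fun i hi => ?_]
    · rw [LinearMap.smul_apply, zeroModeForm_apply, X.zeroMode_of_mem hv, ← map_smul Φ c,
        ← LinearMap.comp_smul _ c, ← hc]
      norm_num [sub_eq_add_neg]
    · rw [hΦ _ _ 2 omega omega_mem_weightSpace _ ?_, smul_zero]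
      push_cast
      linarith [show (1 : ℚ) ≤ i by exact_mod_cast Nat.pos_of_ne_zero hi]
    · rw [hΦ _ _ e v hv _ ?_, smul_zero]
      linarith [(Nat.cast_nonneg i : (0 : ℚ) ≤ i)]
  exact LinearMap.ext (mem_of_forall_weightSpace_le h)

end ZeroMode

end WeakTwistedModule

namespace WeakTwistedModule

section LowestWeight

variable {V : Type u} [AddCommGroup V] [Module ℂ V] [VertexOperatorAlgebra V]
  {g : V ≃ₗ[ℂ] V} {M : Type u} [AddCommGroup M] [Module ℂ M] (X : WeakTwistedModule g M)
  {s w : M} {c : ℂ} {d : ℤ} {u : V} {q : ℚ}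

lemma orbit_le_of_homogeneous {N : Submodule ℂ M}
    (h : ∀ d, ∀ u ∈ VertexOperatorAlgebra.weightSpace V d, ∀ n, X.mode u n w ∈ N) :
    X.orbit w ≤ N := by
  refine Submodule.span_le.mpr ?_
  rintro _ ⟨u, n, rfl⟩
  have hle : ∀ d, VertexOperatorAlgebra.weightSpace V d ≤
      N.comap (LinearMap.applyₗ w ∘ₗ LinearMap.proj n ∘ₗ X.mode : V →ₗ[ℂ] M) :=
    fun d u hu => h d u hu n
  exact mem_of_forall_weightSpace_le hle u

lemma iSupIndep_weightSpace : iSupIndep X.weightSpace := Module.End.eigenspaces_iSupIndep _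

lemma mode_mem_weightSpace_add_ratCast (hg : IsAutomorphism g) (hT : IsOfFinOrder g)
    (hu : u ∈ VertexOperatorAlgebra.weightSpace V d) (hw : w ∈ X.weightSpace (c + q)) (n : ℚ) :
    X.mode u n w ∈ X.weightSpace (c + (q + d - n - 1 : ℚ)) := by
  convert X.mode_mem_weightSpace hg hT hu hw n using 2
  push_cast
  ring

lemma zeroMode_mem_weightSpace (hg : IsAutomorphism g) (hT : IsOfFinOrder g)
    (hw : w ∈ X.weightSpace c) (v : V) : X.zeroMode v w ∈ X.weightSpace c := by
  refine mem_of_forall_weightSpace_le (P := (X.weightSpace c).comap (X.zeroMode.flip w))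
    (fun d u hu => ?_) v
  have h := X.mode_mem_weightSpace hg hT hu hw ((d : ℚ) - 1)
  rw [Submodule.mem_comap, LinearMap.flip_apply, X.zeroMode_of_mem hu]
  rwa [show c + d - ((d - 1 : ℚ) : ℂ) - 1 = c by push_cast; ring] at h

/-- A nonzero eigenvector of `L(0)` of eigenvalue `c` killed by all weight-lowering modes. -/
structure IsLowestWeightVector (s : M) (c : ℂ) : Prop where
  ne_zero : s ≠ 0
  mem : s ∈ X.weightSpace c
  lowering (d : ℤ) (u : V) (hu : u ∈ VertexOperatorAlgebra.weightSpace V d) (n : ℚ)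
    (hn : (d : ℚ) - 1 < n) : X.mode u n s = 0

variable {X}

lemma IsSimple.orbit_eq_top (hX : X.IsSimple) (hT : IsOfFinOrder g) (hs : s ≠ 0) :
    X.orbit s = ⊤ :=
  (hX.eq_bot_or_eq_top _ (X.isStable_orbit hT s)).resolve_left fun h =>
    hs ((Submodule.mem_bot ℂ).mp (h ▸ X.self_mem_orbit s))

namespace IsLowestWeightVector

lemma mode_mem_iSup_of_mem_sector (hs : X.IsLowestWeightVector s c) (hg : IsAutomorphism g)
    (hT : IsOfFinOrder g) {r : ℕ} (hu : u ∈ VertexOperatorAlgebra.weightSpace V d)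
    (hr : u ∈ sector g ((r : ℚ) / orderOf g)) (n : ℚ) :
    X.mode u n s ∈ ⨆ k : ℕ, X.weightSpace (c + (k / orderOf g : ℚ)) := by
  by_cases hn : ∃ k : ℤ, n = (r : ℚ) / orderOf g + k
  · rcases lt_or_ge ((d : ℚ) - 1) n with hlow | hle
    · rw [hs.lowering d u hu n hlow]
      exact zero_mem _
    · obtain ⟨k, rfl⟩ := hn
      have hpos : (0 : ℚ) < orderOf g := by exact_mod_cast hT.orderOf_pos
      obtain ⟨j, hj⟩ : ∃ j : ℕ, (d - 1 - k) * orderOf g - r = (j : ℤ) := by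
        refine Int.eq_ofNat_of_zero_le (sub_nonneg.mpr ?_)
        rw [← le_sub_iff_add_le, div_le_iff₀ hpos] at hle
        exact_mod_cast hle
      have hj' : (j : ℚ) / orderOf g = d - 1 - k - r / orderOf g := by
        rw [← Int.cast_natCast j, ← hj]
        push_cast
        field_simp
      refine Submodule.mem_iSup_of_mem j ?_
      convert X.mode_mem_weightSpace hg hT hu hs.mem _ using 2
      rw [hj']
      push_cast
      ring
  · rw [X.mode_eq_zero_of_mem_sector hT hr (not_exists.mp hn)]
    exact zero_mem _

lemma iSup_weightSpace (hs : X.IsLowestWeightVector s c) (hX : X.IsSimple)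
    (hg : IsAutomorphism g) (hT : IsOfFinOrder g) :
    ⨆ k : ℕ, X.weightSpace (c + (k / orderOf g : ℚ)) = ⊤ := by
  rw [eq_top_iff, ← hX.orbit_eq_top hT hs.ne_zero]
  refine X.orbit_le_of_homogeneous fun d u hu n => ?_
  rw [← sum_sectorProj hT u, map_sum, Finset.sum_apply, LinearMap.sum_apply]
  exact sum_mem fun r _ => hs.mode_mem_iSup_of_mem_sector hg hT
    (sectorProj_mem_weightSpace hg hu _) (sectorProj_mem _ _) n

lemma exists_eq_of_weightSpace_ne_bot (hs : X.IsLowestWeightVector s c) (hX : X.IsSimple)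
    (hg : IsAutomorphism g) (hT : IsOfFinOrder g) {b : ℂ} (hb : X.weightSpace b ≠ ⊥) :
    ∃ k : ℕ, b = c + (k / orderOf g : ℚ) := by
  by_contra! h
  have htop : ⨆ j, ⨆ (_ : j ≠ b), X.weightSpace j = ⊤ := by
    rw [eq_top_iff, ← hs.iSup_weightSpace hX hg hT]
    exact iSup_le fun k => le_iSup₂_of_le _ (h k).symm le_rfl
  have hdisj := X.iSupIndep_weightSpace b
  rw [htop, disjoint_top] at hdisj
  exact hb hdisj

lemma weightSpace_eq_bot_of_neg (hs : X.IsLowestWeightVector s c) (hX : X.IsSimple)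
    (hg : IsAutomorphism g) (hT : IsOfFinOrder g) (hq : q < 0) : X.weightSpace (c + q) = ⊥ := by
  by_contra hb
  obtain ⟨k, hk⟩ := hs.exists_eq_of_weightSpace_ne_bot hX hg hT hb
  rw [add_right_inj, Rat.cast_inj] at hk
  rw [hk] at hq
  exact hq.not_ge (by positivity)

lemma eventually_mode_comp_subtype_eq_zero (hs : X.IsLowestWeightVector s c) (hX : X.IsSimple)
    (hg : IsAutomorphism g) (hT : IsOfFinOrder g) (q : ℚ) (v : V) :
    ∀ᶠ n in atTop, X.mode v n ∘ₗ (X.weightSpace (c + q)).subtype = 0 := by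
  refine eventually_eq_zero_of_homogeneous
    ((LinearMap.lcomp ℂ M (X.weightSpace (c + q)).subtype).compLeft ℚ ∘ₗ X.mode)
    (fun d u hu => ?_) v
  filter_upwards [eventually_gt_atTop (q + d - 1)] with n hn
  refine LinearMap.ext fun w => ?_
  have h := X.mode_mem_weightSpace_add_ratCast hg hT hu w.2 n
  rwa [hs.weightSpace_eq_bot_of_neg hX hg hT (by linarith), Submodule.mem_bot] at h

lemma eventually_comp_mode_eq_zero (hs : X.IsLowestWeightVector s c) (hX : X.IsSimple)
    (hg : IsAutomorphism g) (hT : IsOfFinOrder g) {φ : Module.Dual ℂ M}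
    (hφ : ⨆ j, ⨆ (_ : j ≠ c), X.weightSpace j ≤ LinearMap.ker φ) (u : V) :
    ∀ᶠ n in atBot, φ ∘ₗ X.mode u n = 0 := by
  refine eventually_eq_zero_of_homogeneous
    ((LinearMap.compRight ℂ φ).compLeft ℚ ∘ₗ X.mode) (fun d u hu => ?_) u
  filter_upwards [eventually_lt_atBot ((d : ℚ) - 1)] with n hn
  have hle : ⨆ k : ℕ, X.weightSpace (c + (k / orderOf g : ℚ)) ≤
      LinearMap.ker (φ ∘ₗ X.mode u n) := iSup_le fun k w hw => by
    have hne : c + (k / orderOf g + d - n - 1 : ℚ) ≠ c := by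
      have hk : (0 : ℚ) ≤ k / orderOf g := by positivity
      rw [Ne, add_eq_left, Rat.cast_eq_zero]
      linarith
    exact hφ (le_iSup₂ (f := fun j (_ : j ≠ c) => X.weightSpace j) _ hne
      (X.mode_mem_weightSpace_add_ratCast hg hT hu hw n))
  rwa [hs.iSup_weightSpace hX hg hT, top_le_iff, LinearMap.ker_eq_top] at hle

lemma exists_dual_ne_zero (hs : X.IsLowestWeightVector s c) (hX : X.IsSimple)
    (hg : IsAutomorphism g) (hT : IsOfFinOrder g) :
    ∃ φ : Module.Dual ℂ M, φ ≠ 0 ∧ ∀ u : V, ∀ᶠ n in atBot, φ ∘ₗ X.mode u n = 0 := by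
  obtain ⟨φ, hφs, hφ⟩ := Submodule.exists_le_ker_of_notMem
    (p := ⨆ j, ⨆ (_ : j ≠ c), X.weightSpace j) (v := s) fun h =>
      hs.ne_zero (Submodule.disjoint_def.mp (X.iSupIndep_weightSpace c) s hs.mem h)
  exact ⟨φ, fun h => hφs (by rw [h, LinearMap.zero_apply]),
    hs.eventually_comp_mode_eq_zero hX hg hT hφ⟩

lemma twistedO_le_ker_zeroMode_flip (hs : X.IsLowestWeightVector s c) (hT : IsOfFinOrder g) :
    twistedO g ≤ LinearMap.ker (X.zeroMode.flip s) := by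
  have h := X.twistedO_le_ker_zeroModeForm (ι := LinearMap.toSpanSingleton ℂ M s)
    (Φ := LinearMap.applyₗ 1) (fun v => ?_) (fun a m e v hv k hk => ?_) hT
  · rwa [show X.zeroModeForm (LinearMap.toSpanSingleton ℂ M s) (LinearMap.applyₗ 1) =
      X.zeroMode.flip s from LinearMap.ext fun v => congrArg (X.zeroMode v) (one_smul ℂ s)] at h
  · filter_upwards [X.eventually_mode_eq_zero v s] with k hk
    rw [LinearMap.comp_toSpanSingleton, hk, LinearMap.toSpanSingleton_zero]
  · rw [LinearMap.comp_toSpanSingleton, hs.lowering e v hv k hk, LinearMap.toSpanSingleton_zero,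
      LinearMap.comp_zero, map_zero]

lemma weightSpace_le_range_zeroMode_flip (hs : X.IsLowestWeightVector s c) (hX : X.IsSimple)
    (hg : IsAutomorphism g) (hT : IsOfFinOrder g) :
    X.weightSpace c ≤ LinearMap.range (X.zeroMode.flip s) := by
  set R := LinearMap.range (X.zeroMode.flip s)
  set N := ⨆ j, ⨆ (_ : j ≠ c), X.weightSpace j
  have hR : R ≤ X.weightSpace c := by
    rintro _ ⟨v, rfl⟩
    exact X.zeroMode_mem_weightSpace hg hT hs.mem v
  have htop : R ⊔ N = ⊤ := by
    rw [eq_top_iff, ← hX.orbit_eq_top hT hs.ne_zero]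
    refine X.orbit_le_of_homogeneous fun d u hu n => ?_
    rcases eq_or_ne n ((d : ℚ) - 1) with rfl | hn
    · exact Submodule.mem_sup_left ⟨u, by rw [LinearMap.flip_apply, X.zeroMode_of_mem hu]⟩
    · have hne : c + d - n - 1 ≠ c := fun h => hn (by
        have : (n : ℂ) = d - 1 := by linear_combination -h
        exact_mod_cast this)
      exact Submodule.mem_sup_right (le_iSup₂ (f := fun j (_ : j ≠ c) => X.weightSpace j) _ hne
        (X.mode_mem_weightSpace hg hT hu hs.mem n))
  refine Eq.le ?_
  calc X.weightSpace c = (R ⊔ N) ⊓ X.weightSpace c := by rw [htop, top_inf_eq]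
    _ = R ⊔ N ⊓ X.weightSpace c := sup_inf_assoc_of_le N hR
    _ = R := by rw [(X.iSupIndep_weightSpace c).symm.eq_bot, sup_bot_eq]

lemma finiteDimensional_weightSpace (hs : X.IsLowestWeightVector s c) (hX : X.IsSimple)
    (hg : IsAutomorphism g) (hT : IsOfFinOrder g) [FiniteDimensional ℂ (TwistedZhu g)] :
    FiniteDimensional ℂ (X.weightSpace c) := by
  have hrange : FiniteDimensional ℂ (LinearMap.range (X.zeroMode.flip s)) := by
    rw [← Submodule.range_liftQ _ _ (hs.twistedO_le_ker_zeroMode_flip hT)]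
    infer_instance
  exact Submodule.finiteDimensional_of_le (hs.weightSpace_le_range_zeroMode_flip hX hg hT)

end IsLowestWeightVector

end LowestWeight

end WeakTwistedModule

lemma exists_countable_span_eq_top (V : Type*) [AddCommGroup V] [Module ℂ V]
    [VertexOperatorAlgebra V] : ∃ B : Set V, B.Countable ∧ Submodule.span ℂ B = ⊤ := by
  have h : ∀ d : ℤ, ∃ s : Set V, s.Finite ∧ Submodule.span ℂ s = weightSpace V d := fun d => by
    have : FiniteDimensional ℂ (weightSpace V d) := finite_weight d
    exact Submodule.fg_def.mp (Module.Finite.iff_fg.mp this)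
  choose s hs hspan using h
  refine ⟨⋃ d, s d, Set.countable_iUnion fun d => (hs d).countable, ?_⟩
  rw [Submodule.span_iUnion, iSup_congr hspan]
  exact grading.submodule_iSup_eq_top

namespace WeakTwistedModule

variable {V : Type u} [AddCommGroup V] [Module ℂ V] [VertexOperatorAlgebra V]
  {g : V ≃ₗ[ℂ] V} {M : Type u} [AddCommGroup M] [Module ℂ M] (X : WeakTwistedModule g M)
  {φ : Module.Dual ℂ M} {W : Submodule ℂ M} {s w : M} {c : ℂ} {q : ℚ}

section DualOrbit

/-- The space of restrictions to `W` of functionals in the dual orbit of `φ`. -/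
def restrictedDualOrbit (φ : Module.Dual ℂ M) (W : Submodule ℂ M) :
    Submodule ℂ (Module.Dual ℂ W) :=
  (X.dualOrbit φ).map W.subtype.dualMap

lemma rank_restrictedDualOrbit_le_aleph0 (φ : Module.Dual ℂ M) (W : Submodule ℂ M) :
    Module.rank ℂ (X.restrictedDualOrbit φ W) ≤ Cardinal.aleph0 := by
  obtain ⟨B, hB, hspan⟩ := exists_countable_span_eq_top V
  let F (n : ℚ) : V →ₗ[ℂ] Module.Dual ℂ W :=
    LinearMap.lcomp ℂ ℂ W.subtype ∘ₗ LinearMap.compRight ℂ φ ∘ₗ LinearMap.proj n ∘ₗ X.mode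
  set G : Set (Module.Dual ℂ W) := ⋃ n, F n '' B
  have hle : X.restrictedDualOrbit φ W ≤ Submodule.span ℂ G := by
    rw [restrictedDualOrbit, Submodule.map_le_iff_le_comap, dualOrbit, Submodule.span_le]
    rintro _ ⟨u, n, rfl⟩
    have hu : F n u ∈ (Submodule.span ℂ B).map (F n) :=
      Submodule.mem_map_of_mem (hspan ▸ Submodule.mem_top)
    rw [Submodule.map_span] at hu
    exact Submodule.span_mono (Set.subset_iUnion (fun n => F n '' B) n) hu
  calc Module.rank ℂ (X.restrictedDualOrbit φ W) ≤ Module.rank ℂ (Submodule.span ℂ G) :=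
        Submodule.rank_mono hle
    _ ≤ Cardinal.mk G := rank_span_le G
    _ ≤ Cardinal.aleph0 := (Set.countable_iUnion fun n => hB.image (F n)).le_aleph0

variable {X}

-- An infinite-dimensional space has a dual of uncountable dimension.
lemma finiteDimensional_of_restrictedDualOrbit_eq_top (h : X.restrictedDualOrbit φ W = ⊤) :
    FiniteDimensional ℂ W := by
  by_contra hW
  have hinf : Cardinal.aleph0 ≤ Module.rank ℂ W := by rwa [← not_lt, Module.rank_lt_aleph0_iff]
  have hdual : Module.rank ℂ W < Module.rank ℂ (Module.Dual ℂ W) := by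
    simpa using lift_rank_lt_rank_dual hinf
  have hle := X.rank_restrictedDualOrbit_le_aleph0 φ W
  rw [h, rank_top] at hle
  exact (hinf.trans_lt hdual).not_ge hle

section Simple

variable (hX : X.IsSimple) (hT : IsOfFinOrder g) (hφ0 : φ ≠ 0)
  (hφ : ∀ u : V, ∀ᶠ n in atBot, φ ∘ₗ X.mode u n = 0)

include hX hT hφ0 hφ

lemma dualCoannihilator_dualOrbit : (X.dualOrbit φ).dualCoannihilator = ⊥ := by
  refine (hX.eq_bot_or_eq_top _ fun v n w hw => ?_).resolve_right fun htop => hφ0 ?_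
  · rw [Submodule.mem_dualCoannihilator] at hw ⊢
    exact fun ψ hψ => hw _ (X.comp_mode_mem_dualOrbit_of_mem_dualOrbit hφ hT v n hψ)
  · refine LinearMap.ext fun x => ?_
    have hx : x ∈ (X.dualOrbit φ).dualCoannihilator := htop ▸ Submodule.mem_top
    have hmem : φ ∈ X.dualOrbit φ := by
      have h := X.comp_mode_mem_dualOrbit φ vacuum (-1)
      rwa [X.vacuum_mode, if_pos rfl] at h
    exact (Submodule.mem_dualCoannihilator x).mp hx φ hmem

lemma restrictedDualOrbit_eq_top (W : Submodule ℂ M) [FiniteDimensional ℂ W] :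
    X.restrictedDualOrbit φ W = ⊤ := by
  have h : (X.restrictedDualOrbit φ W).dualCoannihilator = ⊥ := by
    refine (Submodule.eq_bot_iff _).mpr fun w hw => Subtype.ext ?_
    rw [Submodule.mem_dualCoannihilator] at hw
    rw [ZeroMemClass.coe_zero, ← Submodule.mem_bot ℂ, ← dualCoannihilator_dualOrbit hX hT hφ0 hφ,
      Submodule.mem_dualCoannihilator]
    exact fun ψ hψ => hw _ (Submodule.mem_map_of_mem hψ)
  rw [← Subspace.dualCoannihilator_dualAnnihilator_eq (W := X.restrictedDualOrbit φ W), h,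
    Submodule.dualAnnihilator_bot]

-- The lowering mode lands in a finite-dimensional weight space, where any functional is the
-- restriction of an element of the dual orbit.
lemma killsLowering_of_restrictedDualOrbit_le_ker (hg : IsAutomorphism g)
    (hfin : ∀ q' < q, FiniteDimensional ℂ (X.weightSpace (c + (q' : ℚ))))
    {ξ : Module.Dual ℂ (Module.Dual ℂ (X.weightSpace (c + q)))}
    (hξ : X.restrictedDualOrbit φ (X.weightSpace (c + q)) ≤ LinearMap.ker ξ)
    (ψ : Module.Dual ℂ M) :
    X.KillsLowering (X.weightSpace (c + q)).subtype (ξ ∘ₗ LinearMap.compRight ℂ ψ) := by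
  intro a m e v hv k hk
  have := hfin (q + e - k - 1) (by linarith)
  have hmem : (X.weightSpace (c + (q + e - k - 1 : ℚ))).subtype.dualMap (ψ ∘ₗ X.mode a m) ∈
      X.restrictedDualOrbit φ (X.weightSpace (c + (q + e - k - 1 : ℚ))) := by
    rw [restrictedDualOrbit_eq_top hX hT hφ0 hφ]
    exact Submodule.mem_top
  obtain ⟨χ, hχ, hχψ⟩ := hmem
  refine hξ ⟨χ ∘ₗ X.mode v k, X.comp_mode_mem_dualOrbit_of_mem_dualOrbit hφ hT v k hχ,
    LinearMap.ext fun w => ?_⟩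
  exact LinearMap.congr_fun hχψ ⟨_, X.mode_mem_weightSpace_add_ratCast hg hT hv w.2 k⟩

end Simple

end DualOrbit

variable {X}

namespace IsLowestWeightVector

lemma finiteDimensional_weightSpace_of_lt (hs : X.IsLowestWeightVector s c) (hX : X.IsSimple)
    (hg : IsAutomorphism g) (hT : IsOfFinOrder g)
    (hq : ∀ F ∈ (twistedO g).dualAnnihilator,
      residueForm 0 1 1 omega F = (c + q) • F → F = 0)
    (hfin : ∀ q' < q, FiniteDimensional ℂ (X.weightSpace (c + (q' : ℚ)))) :
    FiniteDimensional ℂ (X.weightSpace (c + q)) := by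
  obtain ⟨φ, hφ0, hφ⟩ := hs.exists_dual_ne_zero hX hg hT
  refine finiteDimensional_of_restrictedDualOrbit_eq_top (X := X) (φ := φ) ?_
  by_contra htop
  obtain ⟨ξ, hξ0, hξ⟩ := Submodule.exists_le_ker_of_lt_top _ (lt_top_iff_ne_top.mpr htop)
  refine hξ0 (LinearMap.ext fun η => ?_)
  obtain ⟨ψ, rfl⟩ := LinearMap.dualMap_surjective_of_injective
    (X.weightSpace (c + q)).subtype_injective η
  have hι := hs.eventually_mode_comp_subtype_eq_zero hX hg hT q
  have hΦ := killsLowering_of_restrictedDualOrbit_le_ker hX hT hφ0 hφ hg hfin hξ ψ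
  have hzero := hq _ ?_ (X.residueForm_omega_zeroModeForm hι hΦ hg hT
    (LinearMap.ext fun w => X.mem_weightSpace.mp w.2))
  · have h := LinearMap.congr_fun hzero vacuum
    rwa [zeroModeForm_apply, X.zeroMode_vacuum] at h
  · exact (Submodule.mem_dualAnnihilator _).mpr (X.twistedO_le_ker_zeroModeForm hι hΦ hT)

lemma finiteDimensional_weightSpace_natCast_div (hs : X.IsLowestWeightVector s c)
    (hX : X.IsSimple) (hg : IsAutomorphism g) (hT : IsOfFinOrder g)
    [FiniteDimensional ℂ (TwistedZhu g)]
    (hmax : ∀ x : ℝ, 0 < x → ∀ F ∈ (twistedO g).dualAnnihilator,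
      residueForm 0 1 1 omega F = (c + x) • F → F = 0) (k : ℕ) :
    FiniteDimensional ℂ (X.weightSpace (c + (k / orderOf g : ℚ))) := by
  have hpos : (0 : ℚ) < orderOf g := by exact_mod_cast hT.orderOf_pos
  induction k using Nat.strong_induction_on with
  | _ k ih =>
    rcases Nat.eq_zero_or_pos k with rfl | hk
    · rw [Nat.cast_zero, zero_div, Rat.cast_zero, add_zero]
      exact hs.finiteDimensional_weightSpace hX hg hT
    · refine hs.finiteDimensional_weightSpace_of_lt hX hg hT (fun F hF h => ?_) fun q hq => ?_
      · have hx : (0 : ℚ) < k / orderOf g := by positivity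
        exact hmax (k / orderOf g : ℚ) (by exact_mod_cast hx) F hF (by exact_mod_cast h)
      · by_cases hbot : X.weightSpace (c + q) = ⊥
        · rw [hbot]
          infer_instance
        · obtain ⟨j, hj⟩ := hs.exists_eq_of_weightSpace_ne_bot hX hg hT hbot
          rw [add_right_inj, Rat.cast_inj] at hj
          rw [hj, div_lt_div_iff_of_pos_right hpos, Nat.cast_lt] at hq
          rw [hj]
          exact ih j hq

lemma exists_forall_lt_weightSpace_eq_bot (hs : X.IsLowestWeightVector s c) (hX : X.IsSimple)
    (hg : IsAutomorphism g) (hT : IsOfFinOrder g) (b : ℂ) :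
    ∃ N : ℤ, ∀ n : ℤ, n < N → X.weightSpace ((n : ℂ) / orderOf g + b) = ⊥ := by
  refine ⟨⌊(orderOf g : ℝ) * (c - b).re⌋, fun n hn => ?_⟩
  by_contra hbot
  obtain ⟨k, hk⟩ := hs.exists_eq_of_weightSpace_ne_bot hX hg hT hbot
  have hT0 : (orderOf g : ℂ) ≠ 0 := Nat.cast_ne_zero.mpr hT.orderOf_pos.ne'
  have hnk : ((n - k : ℝ) : ℂ) = (orderOf g : ℝ) * (c - b) := by
    push_cast at hk ⊢
    field_simp at hk
    linear_combination hk
  have hre := congrArg Complex.re hnk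
  rw [Complex.ofReal_re, Complex.re_ofReal_mul] at hre
  rw [Int.lt_floor_iff, ← hre] at hn
  linarith [(Nat.cast_nonneg k : (0 : ℝ) ≤ k)]

theorem isOrdinary (hs : X.IsLowestWeightVector s c) (hX : X.IsSimple) (hg : IsAutomorphism g)
    (hT : IsOfFinOrder g) [FiniteDimensional ℂ (TwistedZhu g)]
    (hmax : ∀ x : ℝ, 0 < x → ∀ F ∈ (twistedO g).dualAnnihilator,
      residueForm 0 1 1 omega F = (c + x) • F → F = 0) : X.IsOrdinary where
  grading := by
    refine (DirectSum.isInternal_submodule_iff_iSupIndep_and_iSup_eq_top _).mpr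
      ⟨X.iSupIndep_weightSpace, ?_⟩
    rw [eq_top_iff, ← hs.iSup_weightSpace hX hg hT]
    exact iSup_le fun k => le_iSup X.weightSpace _
  finite_weight b := by
    by_cases hb : X.weightSpace b = ⊥
    · rw [hb]
      infer_instance
    · obtain ⟨k, rfl⟩ := hs.exists_eq_of_weightSpace_ne_bot hX hg hT hb
      exact hs.finiteDimensional_weightSpace_natCast_div hX hg hT hmax k
  bounded_below := hs.exists_forall_lt_weightSpace_eq_bot hX hg hT

end IsLowestWeightVector

end WeakTwistedModule

end VertexOperatorAlgebra

end

theorem theorem9p1 {V : Type u} [AddCommGroup V] [Module ℂ V] [VertexOperatorAlgebra V]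
    (g : V ≃ₗ[ℂ] V) (hg : VertexOperatorAlgebra.IsAutomorphism g) (hT : IsOfFinOrder g)
    (hfin : FiniteDimensional ℂ (VertexOperatorAlgebra.TwistedZhu g))
    (hne : Nontrivial (VertexOperatorAlgebra.TwistedZhu g)) :
    ∃ (M : Type u) (_ : AddCommGroup M) (_ : Module ℂ M)
      (X : VertexOperatorAlgebra.WeakTwistedModule g M), X.IsOrdinary ∧ X.IsSimple := by
  obtain ⟨c, f, hf, hf0, hfc, hmax⟩ :=
    VertexOperatorAlgebra.exists_extremal_eigenvector hg hfin hne
  have hreg := VertexOperatorAlgebra.dualAnnihilator_le_regularDual hg hT hf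
  obtain ⟨S, _, _, X, s, hs0, hX, hs⟩ :=
    (VertexOperatorAlgebra.regularModule hg hT).exists_simple_subquotient hT
      (w := ⟨f, hreg⟩) fun h => hf0 (congrArg Subtype.val h)
  have hlow : X.IsLowestWeightVector s c :=
    { ne_zero := hs0
      mem := X.mem_weightSpace.mpr (hs _ _ _ (Subtype.ext
        ((VertexOperatorAlgebra.dualMode_omega hg hT hf).trans hfc)))
      lowering d u hu n hn := by
        rw [← zero_smul ℂ s]
        exact hs u n 0 (Subtype.ext
          ((VertexOperatorAlgebra.dualMode_eq_zero_of_lt hg hT hf hu hn).trans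
            (zero_smul ℂ f).symm)) }
  exact ⟨S, _, _, X, hlow.isOrdinary hX hg hT hmax, hX⟩
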